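/- Let $d>2$, $N\ge 2$, let $L\ge 2$ be an even integer and $\lambda>0$. Let $(\mathbb T_L,\mathbb E_L)$ be the (simple) nearest-neighbour graph of the torus $\mathbb Z^d/L\mathbb Z^d$, with vertices identified with points of $\mathbb Z^d$ having coordinates in $(-\frac L2,\frac L2]$. *Parameters.* Let $v:\mathbb Z^d\to\mathbb R$ satisfy $v(-x)=v(x)$ and put $v_L(x,y)=\sum_{z\in\mathbb Z^d}v(y+Lz-x)$ for $x,y\in\mathbb T_L$. Assume that $v$ is tempered: $\sum_x|v(x)|<\infty$ and $\overline v:=v(0)+\sum_x v(x)\mathbf 1_{\{v(x)<0\}}\ge 0$. Assume that $v$ is separable on $\mathbb T_L$: for each $i\in\{1,\dots,d\}$ there are $k\in\mathbb N$, a finite measure space $(T,\nu)$ and bounded measurable $\alpha,\tilde\alpha:T\times\mathbb T_L\to\mathbb C^k$ with $-v_L(x,y)=\int_T\sum_{j=1}^k\alpha_j(t,x)\,\tilde\alpha_j(t,y)\,d\nu(t)$ whenever $x_i>0\ge y_i$, and $\tilde\alpha(t,x)=\overline{\alpha(t,\Theta_i x)}$ for all $x$ and $\nu$-almost all $t$,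 where $\Theta_i$ is the reflection $x_i\mapsto 1-x_i \pmod L$, which exchanges these two halves of the torus. Let $U:\mathbb N_0\to[0,\infty)$ be good, i.e. for some $M<\infty$ and all $n$, $n\,\overline U(n+1)\le M\,\overline U(n)$, where $\overline U(n)=U(n)e^{-\overline v n^2}$, and of range at least $2$, i.e. $U(n)>0$ for some $n\ge2$. *Model.* A configuration $w=(m,c,\pi,g)$ consists of a number $m_e\in\mathbb N_0$ of labelled links on each edge $e\in\mathbb E_L$, such that every vertex is touched by an even number of links; a colour in $\{1,\dots,N\}$ for each link; for each vertex $x$ a partition $\pi_x$ of the links touching $x$ into sets of at most two links, any two links in a common set (a pairing at $x$) having the same colour; and numbers $g_x\in\{0,1,2,3,4\}$ of ghost pairings. Let $u^i_x$ be the number of links of colour $i$ touching $x$ that are unpaired at $x$, $n_x$ the number of pairings at $x$ plus $g_x$, and $m^{(i)}_e$ the number of links of colour $i$ on $e$. Set $$\mu(w)=\prod_{e\in\mathbb E_L}\frac{\lambda^{m_e}}{m_e!}\ \prod_{x\in\mathbb T_L}U(n_x)\ \exp\Big(-\sum_{x,y\in\mathbb T_L}v_L(x,y)n_xn_y\Big),\qquad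 \mu(f)=\sum_w\mu(w)f(w).$$ Let $\mathbb Z^\ell$ be the $\mu$-mass of the set $\tilde{\mathcal W}$ of configurations with $u_x^i=g_x=0$ for all $x,i$, and let $\mathbb E(f)=\mu(f\,\mathbf 1_{\tilde{\mathcal W}})/\mathbb Z^\ell$. For $x\ne y$ let $\mathbb Z(x,y)$ be the $\mu$-mass of the set of configurations with $u_z^i=g_z=0$ for all $i$ and all $z\notin\{x,y\}$, and with $u_z^1=u_z^2=1$, $u_z^i=0$ for $i\ge3$ and $g_z=2$ for $z\in\{x,y\}$. Let $\mathbb Z(x,x)=\mu\big(2^{q}\,\mathbf 1_{\mathcal W_{x,x}}\big)$, where $q=\mathbf 1_{\{u_x^1=2\}}+\mathbf 1_{\{u_x^2=2\}}$ and $\mathcal W_{x,x}$ is the set of configurations with $u_z^i=g_z=0$ for all $i$ and all $z\ne x$, $u_x^1,u_x^2\in\{0,2\}$, $u_x^i=0$ for $i\ge 3$, and $g_x=2+q$. The two-point function is $\mathbb G(x,y)=\lambda^2\,\mathbb Z(x,y)/\mathbb Z^\ell$. For $\boldsymbol v=(v_x)_{x\in\mathbb T_L}\in\mathbb R^{\mathbb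 T_L}$ let $(\triangle v)_x=\sum_{y\sim x}(v_y-v_x)$. **Theorem (Key Inequality).** The sums defining $\mathbb Z^\ell$, $\mathbb Z(x,y)$ and $\mathbb E(m_e^{(1)})$ converge absolutely, $\mathbb Z^\ell>0$, and for every real vector $\boldsymbol v=(v_x)_{x\in\mathbb T_L}$, $$\sum_{x,y\in\mathbb T_L}\mathbb G(x,y)(\triangle v)_x(\triangle v)_y\ \le\ \sum_{\{x,y\}\in\mathbb E_L}\big(1+2\,\mathbb E(m^{(1)}_{\{x,y\}})\big)(v_y-v_x)^2 .$$ If the potential is moreover invariant under permutations of the coordinates of $\mathbb Z^d$ (for instance if $v(x)$ depends only on $|x|_1$), then for every real vector $\boldsymbol v=(v_x)_{x\in\mathbb T_L}$, with $o$ the origin and $\boldsymbol e_1$ the first unit vector, $$\sum_{x,y\in\mathbb T_L}\mathbb G(x,y)(\triangle v)_x(\triangle v)_y\ \le\ \big(1+2\,\mathbb E(m^{(1)}_{\{o,\boldsymbol e_1\}})\big)\sum_{\{x,y\}\in\mathbb E_L}(v_y-v_x)^2 .$$ -/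

import Mathlib

open scoped BigOperators

noncomputable section

namespace RandomPath

/-! ### The random path model on a finite simple graph -/

section Model

variable {V : Type*} (G : SimpleGraph V)

/-- The links of a link configuration `m`: the pair `(e, p)` is the `p`-th link on the edge `e`. -/
abbrev Link (m : G.edgeSet → ℕ) : Type _ := Σ e : G.edgeSet, Fin (m e)

/-- The links touching the vertex `x`. -/
abbrev LinkAt (m : G.edgeSet → ℕ) (x : V) : Type _ :=
  {l : Link G m // x ∈ (l.1 : Sym2 V)}

/-- A configuration `w = (m, c, π, g)` of the random path model with `N` colours.  A partition of
the links touching `x` into sets of at most two links of equal colour is encoded by the involution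
that exchanges the two elements of every two-element block; its fixed points are the links that
are unpaired at `x`.  `g` is the number of ghost pairings. -/
structure Config (N : ℕ) where
  /-- number of links on each edge -/
  m : G.edgeSet → ℕ
  /-- every vertex is touched by an even number of links -/
  even_deg : ∀ x : V, Even (Nat.card (LinkAt G m x))
  /-- colour of each link -/
  c : Link G m → Fin N
  /-- pairing at each vertex -/
  pair : ∀ x : V, LinkAt G m x → LinkAt G m x
  pair_pair : ∀ x l, pair x (pair x l) = l
  colour_pair : ∀ x l, c (pair x l).1 = c l.1
  /-- number of ghost pairings at each vertex -/
  g : V → Fin 5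

variable {G} {N : ℕ}

/-- `u_x^i`: the number of `i`-links touching `x` that are unpaired at `x`. -/
def Config.unpaired (w : Config G N) (x : V) (i : Fin N) : ℕ :=
  Nat.card {l : LinkAt G w.m x // w.c l.1 = i ∧ w.pair x l = l}

/-- `n_x^i`: the number of pairings of `i`-links at `x` (every pairing involves two links). -/
def Config.pairings (w : Config G N) (x : V) (i : Fin N) : ℕ :=
  Nat.card {l : LinkAt G w.m x // w.c l.1 = i ∧ w.pair x l ≠ l} / 2

/-- `n_x`: the total number of pairings at `x`, ghost or not. -/
def Config.localTime (w : Config G N) (x : V) : ℕ :=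
  ∑ i, w.pairings x i + (w.g x : ℕ)

/-- `m_e^{(i)}`: the number of `i`-links on the edge `e`. -/
def Config.linkCount (w : Config G N) (e : Sym2 V) (i : Fin N) : ℕ :=
  Nat.card {l : Link G w.m // (l.1 : Sym2 V) = e ∧ w.c l = i}

/-- The configurations without unpaired links and without ghost pairings. -/
def Config.IsClosed (w : Config G N) : Prop :=
  ∀ x, (∀ i, w.unpaired x i = 0) ∧ (w.g x : ℕ) = 0

/-- For `x ≠ y`, the configurations in which precisely one `1`-link and one `2`-link are unpaired
at each of `x` and `y`, with two ghost pairings at `x` and `y`, and no other unpaired links or ghost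
pairings.  (The colours `1, 2, …, N` are the elements `0, 1, …, N - 1` of `Fin N`.) -/
def Config.IsOpenBetween (w : Config G N) (x y : V) : Prop :=
  (∀ z, z ≠ x → z ≠ y → (∀ i, w.unpaired z i = 0) ∧ (w.g z : ℕ) = 0) ∧
  ∀ z, z = x ∨ z = y →
    (∀ i : Fin N, w.unpaired z i = if (i : ℕ) < 2 then 1 else 0) ∧ (w.g z : ℕ) = 2

/-- The diagonal case: there are no unpaired links or ghost pairings outside `x`; at `x` the numbers
of unpaired `1`-links and of unpaired `2`-links belong to `{0, 2}`, no link of another colour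
is unpaired, and there are two ghost pairings plus one for each of the colours that has two unpaired
links. -/
def Config.IsOpenAt (w : Config G N) (x : V) : Prop :=
  (∀ z, z ≠ x → (∀ i, w.unpaired z i = 0) ∧ (w.g z : ℕ) = 0) ∧
  (∀ i : Fin N, w.unpaired x i = 0 ∨ ((i : ℕ) < 2 ∧ w.unpaired x i = 2)) ∧
  (w.g x : ℕ) = 2 + Nat.card {i : Fin N // w.unpaired x i = 2}

variable [Fintype V]

open scoped Classical in
/-- The weight `μ(w)`, for the potential `vG`, weight function `U` and parameter `lam`. -/
def Config.weight (lam : ℝ) (U : ℕ → ℝ) (vG : V → V → ℝ) (w : Config G N) : ℝ :=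
  (∏ e : G.edgeSet, lam ^ w.m e / ((w.m e).factorial : ℝ)) *
    (∏ x, U (w.localTime x)) *
    Real.exp (-∑ x, ∑ y, vG x y * (w.localTime x : ℝ) * (w.localTime y : ℝ))

variable (G N) (lam : ℝ) (U : ℕ → ℝ) (vG : V → V → ℝ)

/-- The average `μ(f)` with respect to the (non-normalised) measure. -/
def avg (f : Config G N → ℝ) : ℝ := ∑' w : Config G N, w.weight lam U vG * f w

/-- `f` is absolutely summable with respect to the (non-normalised) measure. -/
def AvgSummable (f : Config G N → ℝ) : Prop :=
  Summable fun w : Config G N => w.weight lam U vG * f w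

variable {G N}

/-- Indicator of the set of configurations without unpaired links and ghost pairings. -/
def closedInd : Config G N → ℝ := Set.indicator {w | w.IsClosed} 1

open scoped Classical in
/-- The function averaged in the directed partition function: for `x ≠ y` the indicator of
`IsOpenBetween x y`, for `x = y` the indicator of `IsOpenAt x` times a factor `2` for each of the
colours that has two unpaired links at `x`. -/
def directedFun (x y : V) : Config G N → ℝ := fun w =>
  if x = y then
    (if w.IsOpenAt x then 2 ^ Nat.card {i : Fin N // w.unpaired x i = 2} else 0)
  else (if w.IsOpenBetween x y then 1 else 0)

variable (G N)

/-- The partition function `Z^ℓ`. -/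
def Zloop : ℝ := avg G N lam U vG closedInd

/-- The expectation `E(f)` in the model with closed paths only. -/
def expect (f : Config G N → ℝ) : ℝ :=
  avg G N lam U vG (fun w => closedInd w * f w) / Zloop G N lam U vG

/-- The directed partition function `Z(x, y)`. -/
def Zdir (x y : V) : ℝ := avg G N lam U vG (directedFun x y)

/-- The two-point function `G(x, y)`. -/
def twoPoint (x y : V) : ℝ := lam ^ 2 * (Zdir G N lam U vG x y / Zloop G N lam U vG)

end Model

/-! ### The torus -/

/-- The vertex set of the torus `ℤ^d / L ℤ^d`. -/
abbrev Torus (d L : ℕ) : Type := Fin d → ZMod L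

/-- The representative of a vertex of the torus in `ℤ^d` with coordinates in `(-L/2, L/2]`. -/
def rep {d L : ℕ} (x : Torus d L) : Fin d → ℤ := fun i => (x i).valMinAbs

/-- The nearest-neighbour graph of the torus (a simple graph, for every `L`). -/
def torusGraph (d L : ℕ) : SimpleGraph (Torus d L) :=
  SimpleGraph.fromRel fun x y => ∃ i, y = x + Pi.single i 1

/-- The periodised potential `v_L(x, y) = ∑_{z ∈ ℤ^d} v(y + L z - x)`. -/
def periodic {d : ℕ} (L : ℕ) (v : (Fin d → ℤ) → ℝ) (x y : Torus d L) : ℝ :=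
  ∑' z : Fin d → ℤ, v (fun i => rep y i + L * z i - rep x i)

open scoped Classical in
/-- `v̄ = v(0) + ∑_x v(x) 1_{v(x) < 0}`. -/
def vbar {d : ℕ} (v : (Fin d → ℤ) → ℝ) : ℝ :=
  v 0 + ∑' x, if v x < 0 then v x else 0

/-- Tempered potentials. -/
def Tempered {d : ℕ} (v : (Fin d → ℤ) → ℝ) : Prop :=
  0 ≤ vbar v ∧ Summable fun x => |v x|

/-- Good weight functions: `n Ū(n+1) ≤ M Ū(n)` with `Ū(n) = U(n) exp(-v̄ n²)`. -/
def Good {d : ℕ} (v : (Fin d → ℤ) → ℝ) (U : ℕ → ℝ) : Prop :=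
  ∃ M : ℝ, ∀ n : ℕ, (n : ℝ) * (U (n + 1) * Real.exp (-vbar v * ((n + 1 : ℕ) : ℝ) ^ 2)) ≤
    M * (U n * Real.exp (-vbar v * (n : ℝ) ^ 2))

/-- The range `sup {n : U(n) > 0}` of a weight function. -/
def range (U : ℕ → ℝ) : ℕ∞ := ⨆ n ∈ {n : ℕ | 0 < U n}, (n : ℕ∞)

/-- The reflection of the torus in direction `i` which exchanges the two halves with `i`-th
coordinate in `(0, L/2]` and in `(-L/2, 0]`; its plane passes through the midpoints of edges. -/
def reflect {d L : ℕ} (i : Fin d) (x : Torus d L) : Torus d L := Function.update x i (1 - x i)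

/-- Separability in direction `i` on the torus of side `L`, with respect to `reflect i`. -/
def SeparableDir {d : ℕ} (L : ℕ) (v : (Fin d → ℤ) → ℝ) (i : Fin d) : Prop :=
  ∃ (k : ℕ) (T : Type) (_ : MeasurableSpace T) (ν : MeasureTheory.Measure T)
    (α α' : T → Torus d L → Fin k → ℂ),
    MeasureTheory.IsFiniteMeasure ν ∧
    (∀ x j, Measurable fun t => α t x j) ∧ (∀ x j, Measurable fun t => α' t x j) ∧
    (∃ C : ℝ, ∀ t x j, ‖α t x j‖ ≤ C ∧ ‖α' t x j‖ ≤ C) ∧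
    (∀ x y : Torus d L, 0 < rep x i → rep y i ≤ 0 →
      ((-periodic L v x y : ℝ) : ℂ) = ∫ t, ∑ j, α t x j * α' t y j ∂ν) ∧
    ∀ x, ∀ᵐ t ∂ν, ∀ j, α' t x j = starRingEnd ℂ (α t (reflect i x) j)

/-- Separability on the torus of side `L`, in every direction. -/
def Separable {d : ℕ} (L : ℕ) (v : (Fin d → ℤ) → ℝ) : Prop := ∀ i, SeparableDir L v i

/-- The two-point function on the torus, for the periodised potential. -/
def torusTwoPoint (d N L : ℕ) [NeZero L] (lam : ℝ) (U : ℕ → ℝ) (v : (Fin d → ℤ) → ℝ)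
    (x y : Torus d L) : ℝ :=
  twoPoint (torusGraph d L) N lam U (periodic L v) x y

/-- The expected number of `i`-links on `e` in the model on the torus with closed paths only. -/
def torusMeanLinks (d N L : ℕ) [NeZero L] (lam : ℝ) (U : ℕ → ℝ) (v : (Fin d → ℤ) → ℝ)
    (i : Fin N) (e : Sym2 (Torus d L)) : ℝ :=
  expect (torusGraph d L) N lam U (periodic L v) fun w => (w.linkCount e i : ℝ)

section Gradient

variable {V : Type*} [Fintype V] (G : SimpleGraph V)

open scoped Classical in
/-- The discrete Laplacian `(Δψ)_x = ∑_{y ∼ x} (ψ_y - ψ_x)`. -/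
def lap (ψ : V → ℝ) (x : V) : ℝ := ∑ y, if G.Adj x y then ψ y - ψ x else 0

/-- `(ψ_y - ψ_x)²` as a function of the unordered pair `{x, y}`. -/
def sqGrad (ψ : V → ℝ) : Sym2 V → ℝ :=
  Sym2.lift ⟨fun x y => (ψ y - ψ x) ^ 2, fun x y => by ring⟩

end Gradient

end RandomPath

end

open scoped BigOperators

noncomputable section

namespace RandomPath

/-! ### Counting involutions -/

/-! Summing out the pairings. Attach to a vertex with r insertions r extra ends in each of the first
two colours. Pairings, unpaired links and ghost pairings then encode perfect matchings, colour by
colour, of the link ends together with the extra ends: an unpaired link is matched with an extra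
end, and the ghost pairings count the pairs that contain an extra end. So the local time is half the
number of all ends, whatever the pairings are, and the sum over pairings is a product of numbers
`matchings`. Colouring the links splits λ^m/m! into Poisson weights, one for each colour. Thus every
partition function becomes a `moment`, a sum over link numbers q(e,i) of `linkWeight` times
`vertexWeight` of the numbers of ends (`hasSum_config`).

Reflection positivity. A reflection through midpoints of edges cuts the torus into two halves. For
fixed link numbers on the crossing edges the weight is a product over the halves, up to the
exponential of a form that separability makes positive semidefinite; the Schur product theorem gives
`Reflection.sum_nonneg`. It is applied to two kinds of `Move`: an insertion at a vertex of the half,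
and the removal, on one side only, of one link of each of the first two colours on a crossing edge,
weighted by the number of choices. The identity q λ^q/q! = λ λ^(q-1)/(q-1)! turns a removal at x
into λ² times an insertion at the mirror image of x. So all correlations of moves are directed
partition functions, except that two removals on the same edge produce in addition λ² times Z + 2 Z
E(m): this is the origin of the factor 1 + 2 E(m). If a is supported on the half, then its Laplacian
beyond the plane is a itself, read at the mirror image. With the coefficients λ Δa for insertions
and a/λ for removals, positivity therefore reads B(a, θa) ≥ 0, where B (`keyForm`) is the polarised
difference of the two sides of the inequality (`Reflection.keyForm_nonneg`).

Folding. By bilinearity and invariance, B(ψ,ψ) is at most the average of its values at the two folds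
of ψ (`two_mul_le_fold`). Among the finitely many functions ψ ∘ F with F a self-map of the torus, a
maximiser stays one after folding, and folds compose to a constant map (`exists_const_of_fold`),
where B vanishes. Hence B(ψ,ψ) ≤ 0.

Convergence. Temperedness bounds the interaction energy below by v̄ ∑ n_x². Goodness makes n! Ū(n)
grow at most exponentially, which compensates for the number of matchings, and the Poisson weights
have all exponential moments (`expBounded_periodic`, `summable_of_expBounded`). -/

/-- The number of perfect matchings of a set with `n` elements. -/
def matchings : ℕ → ℕ
  | 0 => 1
  | 1 => 0
  | n + 2 => (n + 1) * matchings n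

lemma matchings_odd : ∀ {n : ℕ}, ¬ Even n → matchings n = 0
  | 0, h => by simp at h
  | 1, _ => rfl
  | n + 2, h => by
    have : ¬ Even n := by simpa [Nat.even_add] using h
    simp [matchings, matchings_odd this]

lemma matchings_two_mul (p : ℕ) :
    matchings (2 * p) * (2 ^ p * p.factorial) = (2 * p).factorial := by
  induction p with
  | zero => rfl
  | succ p ih =>
    have h : 2 * (p + 1) = 2 * p + 2 := by ring
    rw [h, matchings, Nat.factorial_succ (2 * p + 1), Nat.factorial_succ (2 * p), ← ih,
      Nat.factorial_succ, pow_succ]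
    ring

/-- The involutions of a type. -/
abbrev Invol (T : Type*) : Type _ := {f : T → T // ∀ t, f (f t) = t}

section
open scoped Classical
variable {T : Type*} [Fintype T]

/-- Such a permutation is a product of p disjoint transpositions with u fixed points. The size
n!/(u! 2^p p!) of the conjugacy class is rewritten as the choice of the fixed points times the
matchings of the other points. -/
lemma card_perm_replicate (u p : ℕ) (h : Fintype.card T = u + 2 * p) :
    (Finset.univ.filter fun σ : Equiv.Perm T => σ.cycleType = Multiset.replicate p 2).card
      = (u + 2 * p).choose u * matchings (2 * p) := by
  have h1 := Equiv.Perm.card_of_cycleType_mul_eq (α := T) (Multiset.replicate p 2)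
  have h2 : (Multiset.replicate p 2).sum ≤ Fintype.card T ∧
      ∀ a ∈ Multiset.replicate p 2, 2 ≤ a := by
    refine ⟨by simp [h]; omega, fun a ha => ?_⟩
    rw [Multiset.eq_of_mem_replicate ha]
  rw [if_pos h2] at h1
  have h3 : ∏ n ∈ (Multiset.replicate p 2).toFinset, ((Multiset.replicate p 2).count n).factorial
      = p.factorial := by
    rcases Nat.eq_zero_or_pos p with rfl | hp
    · simp
    · rw [Multiset.toFinset_replicate, if_neg hp.ne']
      simp
  have h4 : Fintype.card T - (Multiset.replicate p 2).sum = u := by simp [h]; omega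
  rw [h3, h4, Multiset.prod_replicate, h] at h1
  have h5 := Nat.add_choose_mul_factorial_mul_factorial u (2 * p)
  rw [← matchings_two_mul p] at h5
  have h6 : 0 < u.factorial * 2 ^ p * p.factorial := by positivity
  apply Nat.eq_of_mul_eq_mul_right h6
  rw [h1, ← h5, Nat.choose_symm_add]
  ring

lemma card_fixed_add_support (f : Invol T) :
    Fintype.card {t // f.1 t = t} + 2 * (Function.Involutive.toPerm f.1 f.2).cycleType.card
      = Fintype.card T ∧ (Function.Involutive.toPerm f.1 f.2).cycleType
        = Multiset.replicate (Function.Involutive.toPerm f.1 f.2).cycleType.card 2 := by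
  set σ := Function.Involutive.toPerm f.1 f.2 with hσ
  have h2 : σ ^ 2 = 1 := by
    ext t
    exact f.2 t
  have : Fact (Nat.Prime 2) := ⟨Nat.prime_two⟩
  have h3 : σ.cycleType = Multiset.replicate σ.cycleType.card 2 :=
    Multiset.eq_replicate.mpr ⟨rfl, Equiv.Perm.pow_prime_eq_one_iff.mp h2⟩
  refine ⟨?_, h3⟩
  have h4 : σ.cycleType.sum = σ.support.card := Equiv.Perm.sum_cycleType σ
  rw [h3] at h4
  simp only [Multiset.sum_replicate, smul_eq_mul] at h4
  have h5 : σ.support = Finset.univ.filter fun t => ¬ f.1 t = t := by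
    ext t
    rw [Equiv.Perm.mem_support, Finset.mem_filter]
    exact (and_iff_right (Finset.mem_univ t)).symm
  rw [mul_comm, h4, h5, Fintype.card_subtype, Finset.card_filter_add_card_filter_not]
  rfl

/-- Choose the fixed points and match the rest. Both sides vanish if u is too large or has the wrong
parity; otherwise cycle types apply. -/
lemma card_invol_fixed (u : ℕ) :
    (Finset.univ.filter fun f : Invol T => Fintype.card {t // f.1 t = t} = u).card
      = (Fintype.card T).choose u * matchings (Fintype.card T - u) := by
  by_cases hu : u ≤ Fintype.card T
  swap
  · rw [Nat.choose_eq_zero_of_lt (by omega), zero_mul, Finset.card_eq_zero,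
      Finset.filter_eq_empty_iff]
    rintro f - rfl
    exact hu (Fintype.card_subtype_le _)
  by_cases he : Even (Fintype.card T - u)
  swap
  · rw [matchings_odd he, mul_zero, Finset.card_eq_zero, Finset.filter_eq_empty_iff]
    rintro f - rfl
    apply he
    have := (card_fixed_add_support f).1
    exact ⟨(Function.Involutive.toPerm f.1 f.2).cycleType.card, by omega⟩
  obtain ⟨p, hp⟩ := he
  have h : Fintype.card T = u + 2 * p := by omega
  rw [h, show u + 2 * p - u = 2 * p by omega, ← card_perm_replicate (T := T) u p h]
  refine Finset.card_bij (fun f _ => Function.Involutive.toPerm f.1 f.2) ?_ ?_ ?_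
  · intro f hf
    have h1 := card_fixed_add_support f
    simp only [Finset.mem_filter, Finset.mem_univ, true_and] at hf ⊢
    rw [h1.2]
    congr 1
    omega
  · intro f _ g _ hfg
    apply Subtype.ext
    exact congrArg (fun σ : Equiv.Perm T => (σ : T → T)) hfg
  · intro σ hσ
    simp only [Finset.mem_filter, Finset.mem_univ, true_and] at hσ
    have h2 : σ ^ 2 = 1 := by
      have : Fact (Nat.Prime 2) := ⟨Nat.prime_two⟩
      refine Equiv.Perm.pow_prime_eq_one_iff.mpr fun c hc => ?_
      rw [hσ] at hc
      exact Multiset.eq_of_mem_replicate hc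
    have h3 : ∀ t, σ (σ t) = t := fun t => by
      have := congrArg (fun τ : Equiv.Perm T => τ t) h2
      simpa [pow_two] using this
    refine ⟨⟨σ, h3⟩, ?_, Equiv.ext fun t => rfl⟩
    have h4 := (card_fixed_add_support (⟨σ, h3⟩ : Invol T)).1
    have h5 : Function.Involutive.toPerm (σ : T → T) h3 = σ := Equiv.ext fun t => rfl
    simp only [h5, hσ, Multiset.card_replicate] at h4
    simp only [Finset.mem_filter, Finset.mem_univ, true_and]
    omega

/-- Weight of the number `u` of unpaired links of a colour at a vertex with `r` insertions. -/
def unpairedWeight : ℕ → ℕ → ℝ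
  | 0, u => if u = 0 then 1 else 0
  | 1, u => if u = 1 then 1 else 0
  | _ + 2, u => if u = 0 then 1 else if u = 2 then 2 else 0

lemma sum_invol (φ : ℕ → ℝ) (S : Finset ℕ) (hS : ∀ u ∉ S, φ u = 0) :
    ∑ f : Invol T, φ (Fintype.card {t // f.1 t = t}) =
      ∑ u ∈ S, φ u * ((Fintype.card T).choose u * matchings (Fintype.card T - u) : ℕ) := by
  have h1 : ∀ f : Invol T, φ (Fintype.card {t // f.1 t = t}) =
      ∑ u ∈ S, if Fintype.card {t // f.1 t = t} = u then φ u else 0 := fun f => by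
    rw [Finset.sum_ite_eq]
    split_ifs with h
    · rfl
    · exact hS _ h
  simp_rw [h1]
  rw [Finset.sum_comm]
  refine Finset.sum_congr rfl fun u _ => ?_
  rw [← card_invol_fixed, ← Finset.sum_filter, Finset.sum_const, nsmul_eq_mul, mul_comm]

lemma matchings_succ (n : ℕ) : matchings (n + 1) = n * matchings (n - 1) := by
  cases n with
  | zero => rfl
  | succ n => rfl

/-- The right side counts the matchings of the set with r extra points. One extra point takes one
fixed point as its partner. Two extra points are either matched with each other (u = 0) or matched
with two fixed points, in two ways (u = 2): hence the weight 2. -/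
lemma sum_invol_unpairedWeight_aux (r : ℕ) (hr : r ≤ 2) :
    ∑ f : Invol T, unpairedWeight r (Fintype.card {t // f.1 t = t}) =
      matchings (Fintype.card T + r) := by
  interval_cases r
  · rw [sum_invol _ {0}]
    · simp [unpairedWeight]
    · intro u hu
      simp at hu
      simp [unpairedWeight, hu]
  · rw [sum_invol _ {1}]
    · simp [unpairedWeight, matchings_succ]
    · intro u hu
      simp at hu
      simp [unpairedWeight, hu]
  · rw [sum_invol _ {0, 2}]
    · rw [Finset.sum_insert (by simp), Finset.sum_singleton]
      simp only [unpairedWeight, if_true, if_neg (show (2 : ℕ) ≠ 0 by norm_num), matchings]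
      rcases hn : Fintype.card T with _ | _ | n
      · simp [matchings]
      · simp [matchings]
      · have h := Nat.triangle_succ (n + 1)
        have h2 : 2 * (n + 2).choose 2 = (n + 2) * (n + 1) := by
          rw [Nat.choose_two_right, show n + 2 - 1 = n + 1 by omega]
          have : 2 ∣ (n + 2) * (n + 1) := by
            rw [mul_comm]; exact (Nat.even_mul_succ_self (n + 1)).two_dvd
          omega
        have h3 : (2 : ℝ) * ((n + 2).choose 2 : ℕ) = (n + 2) * (n + 1) := by exact_mod_cast h2
        simp only [Nat.choose_zero_right, Nat.sub_zero, one_mul, matchings]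
        push_cast
        rw [← mul_assoc, h3]
        ring
    · intro u hu
      simp only [Finset.mem_insert, Finset.mem_singleton, not_or] at hu
      simp [unpairedWeight, hu.1, hu.2]

lemma sum_invol_unpairedWeight [Fintype (Invol T)] (r : ℕ) (hr : r ≤ 2) :
    ∑ f : Invol T, unpairedWeight r (Nat.card {t // f.1 t = t}) =
      matchings (Nat.card T + r) := by
  rw [Nat.card_eq_fintype_card, ← sum_invol_unpairedWeight_aux r hr]
  simp only [Nat.card_eq_fintype_card]
  congr!

lemma exists_card_fixed_add (f : Invol T) :
    ∃ c, Nat.card {t // f.1 t = t} + 2 * c = Nat.card T := by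
  simp only [Nat.card_eq_fintype_card]
  exact ⟨_, (card_fixed_add_support f).1⟩

end

/-! ### Local sums over pairings and ghost pairings -/

section
open scoped Classical

/-- The colour-preserving involutions of a coloured set. -/
abbrev ColInvol {T : Type*} {N : ℕ} (col : T → Fin N) : Type _ :=
  {f : T → T // (∀ t, f (f t) = t) ∧ ∀ t, col (f t) = col t}

/-- The number of insertions of the colour `i` at a vertex with `r` insertions: only the first two
colours are inserted. -/
def inserted {N : ℕ} (r : ℕ) (i : Fin N) : ℕ := if (i : ℕ) < 2 then r else 0

variable {T : Type*} [Fintype T] {N : ℕ} (col : T → Fin N)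

/-- A colour-preserving involution is a family of involutions, one for each colour. -/
def colInvolEquiv : ColInvol col ≃ ∀ i : Fin N, Invol {t // col t = i} where
  toFun f i := ⟨fun t => ⟨f.1 t.1, (f.2.2 t.1).trans t.2⟩, fun t => Subtype.ext (f.2.1 t.1)⟩
  invFun F := ⟨fun t => ((F (col t)).1 ⟨t, rfl⟩).1, by
    have key : ∀ t i (h : col t = i), ((F (col t)).1 ⟨t, rfl⟩).1 = ((F i).1 ⟨t, h⟩).1 := by
      rintro t _ rfl; rfl
    refine ⟨fun t => ?_, fun t => ((F (col t)).1 ⟨t, rfl⟩).2⟩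
    refine (key _ (col t) ((F (col t)).1 ⟨t, rfl⟩).2).trans ?_
    exact congrArg Subtype.val ((F (col t)).2 ⟨t, rfl⟩)⟩
  left_inv f := rfl
  right_inv F := by
    have key : ∀ t i (h : col t = i), ((F (col t)).1 ⟨t, rfl⟩).1 = ((F i).1 ⟨t, h⟩).1 := by
      rintro t _ rfl; rfl
    funext i
    apply Subtype.ext
    funext t
    apply Subtype.ext
    exact key t.1 i t.2

lemma card_fixed_colInvol (f : ColInvol col) (i : Fin N) :
    Nat.card {t // col t = i ∧ f.1 t = t} =
      Nat.card {t // ((colInvolEquiv col f) i).1 t = t} := by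
  refine Nat.card_congr ⟨fun t => ⟨⟨t.1, t.2.1⟩, Subtype.ext t.2.2⟩,
    fun t => ⟨t.1.1, t.1.2, congrArg Subtype.val t.2⟩, fun t => rfl, fun t => rfl⟩

lemma sum_colInvol (r : ℕ) (hr : r ≤ 2) :
    ∑ f : ColInvol col, ∏ i, unpairedWeight (inserted r i)
        (Nat.card {t // col t = i ∧ f.1 t = t}) =
      ∏ i, (matchings (Nat.card {t // col t = i} + inserted r i) : ℝ) := by
  simp_rw [card_fixed_colInvol]
  rw [(colInvolEquiv col).sum_comp (fun F => ∏ i, unpairedWeight (inserted r i)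
        (Nat.card {t // (F i).1 t = t}))]
  have := Finset.prod_univ_sum (fun i : Fin N => (Finset.univ : Finset (Invol {t // col t = i})))
    (fun i f => unpairedWeight (inserted r i) (Nat.card {t // f.1 t = t}))
  rw [Fintype.piFinset_univ] at this
  rw [← this]
  refine Finset.prod_congr rfl fun i _ => ?_
  rw [sum_invol_unpairedWeight]
  unfold inserted
  split_ifs <;> omega

/-- The points that are not fixed come in pairs, so the division by two is exact. -/
lemma card_nonfixed_colInvol (f : ColInvol col) (i : Fin N) :
    2 * (Nat.card {t // col t = i ∧ f.1 t ≠ t} / 2) + Nat.card {t // col t = i ∧ f.1 t = t} =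
      Nat.card {t // col t = i} := by
  obtain ⟨c, h1⟩ := exists_card_fixed_add ((colInvolEquiv col f) i)
  rw [← card_fixed_colInvol] at h1
  have h2 : Nat.card {t // col t = i} = Nat.card {t // col t = i ∧ f.1 t = t} +
      Nat.card {t // col t = i ∧ f.1 t ≠ t} := by
    simp only [Nat.card_eq_fintype_card, Fintype.card_subtype]
    rw [← Finset.card_filter_add_card_filter_not (s := Finset.univ.filter fun t => col t = i)
      (fun t => f.1 t = t), Finset.filter_filter, Finset.filter_filter]
  omega

/-- The prescribed number of ghost pairings, given the numbers of unpaired links. -/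
def ghosts {N : ℕ} (r : ℕ) (u : Fin N → ℕ) : ℕ :=
  (if r = 0 then 0 else 2) + Nat.card {i // u i = 2}

lemma unpairedWeight_ne_zero {r u : ℕ} (hr : r ≤ 2) (h : unpairedWeight r u ≠ 0) :
    (r = 0 → u = 0) ∧ (r = 1 → u = 1) ∧ (r = 2 → u = 0 ∨ u = 2) := by
  interval_cases r <;> simp only [unpairedWeight] at h <;> split_ifs at h <;> simp_all

lemma unpairedWeight_nonneg (r u : ℕ) : 0 ≤ unpairedWeight r u := by
  unfold unpairedWeight
  split <;> split_ifs <;> norm_num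

lemma sum_inserted {N : ℕ} (hN : 2 ≤ N) (r : ℕ) : ∑ i : Fin N, inserted r i = 2 * r := by
  obtain ⟨M, rfl⟩ := Nat.exists_eq_add_of_le hN
  rw [Fin.sum_univ_add]
  simp only [inserted, Fin.sum_univ_two, two_mul, Fin.val_castAdd, Fin.val_natAdd]
  rw [Finset.sum_eq_zero (s := (Finset.univ : Finset (Fin M)))]
  · simp
  · intro i _
    rw [if_neg (by omega)]

/-- `ghosts` counts the pairs that contain an inserted end: with r = 1 one for each of the two
colours, with r = 2 one for each colour whose inserted ends are matched together and two otherwise.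
Each such pair consists of inserted ends and unpaired links only. The bound shows that the type `Fin
5` is large enough. -/
lemma ghosts_spec {N : ℕ} (hN : 2 ≤ N) {r : ℕ} (hr : r ≤ 2) (u : Fin N → ℕ)
    (h : ∀ i, unpairedWeight (inserted r i) (u i) ≠ 0) :
    ∑ i : Fin N, inserted r i + ∑ i, u i = 2 * ghosts r u ∧ ghosts r u < 5 := by
  have hcard : Nat.card {i // u i = 2} = ∑ i, if u i = 2 then 1 else 0 := by
    rw [Nat.card_eq_fintype_card, Fintype.card_subtype, Finset.card_filter]
  have hsi := sum_inserted hN r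
  have hu : ∀ i : Fin N, (r ≠ 2 → u i = inserted r i) ∧
      (r = 2 → (u i = 0 ∨ u i = 2) ∧ u i ≤ inserted r i) := by
    intro i
    have h1 := h i
    unfold inserted at h1 ⊢
    split_ifs at h1 ⊢ with hlt
    · obtain ⟨h0, h1, h2⟩ := unpairedWeight_ne_zero hr h1
      omega
    · obtain ⟨h0, -, -⟩ := unpairedWeight_ne_zero (by norm_num) h1
      have := h0 rfl
      omega
  rw [hsi]
  unfold ghosts
  rw [hcard]
  by_cases h2 : r = 2
  · have h3 : ∑ i, u i = 2 * ∑ i, (if u i = 2 then 1 else 0) := by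
      rw [Finset.mul_sum]
      refine Finset.sum_congr rfl fun i _ => ?_
      rcases ((hu i).2 h2).1 with h | h <;> simp [h]
    have h4 : ∑ i, u i ≤ ∑ i : Fin N, inserted r i :=
      Finset.sum_le_sum fun i _ => ((hu i).2 h2).2
    rw [hsi] at h4
    rw [if_neg (by omega)]
    omega
  · have h3 : ∑ i, u i = ∑ i : Fin N, inserted r i :=
      Finset.sum_congr rfl fun i _ => (hu i).1 h2
    have h4 : (∑ i, if u i = 2 then 1 else 0) = 0 := Finset.sum_eq_zero fun i _ => by
      rw [if_neg]
      rw [(hu i).1 h2]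
      unfold inserted
      by_cases hi : (i : ℕ) < 2
      · rwa [if_pos hi]
      · rw [if_neg hi]
        norm_num
    rw [h3, h4, hsi]
    split_ifs <;> omega

/-- The weight of the pairings and ghost pairings at a vertex with `r` insertions. -/
def siteWeight (r : ℕ) (p : ColInvol col × Fin 5) : ℝ :=
  (∏ i, unpairedWeight (inserted r i) (Nat.card {t // col t = i ∧ p.1.1 t = t})) *
    if (p.2 : ℕ) = ghosts r (fun i => Nat.card {t // col t = i ∧ p.1.1 t = t}) then 1 else 0

lemma siteWeight_nonneg (r : ℕ) (p : ColInvol col × Fin 5) : 0 ≤ siteWeight col r p :=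
  mul_nonneg (Finset.prod_nonneg fun _ _ => unpairedWeight_nonneg _ _) (by split_ifs <;> norm_num)

/-- On the support of `siteWeight` the local time depends only on the numbers of ends. This allows
the factors U and the interaction to be taken out of the sum over pairings. -/
lemma localTime_of_siteWeight_ne_zero (hN : 2 ≤ N) {r : ℕ} (hr : r ≤ 2)
    (p : ColInvol col × Fin 5) (h : siteWeight col r p ≠ 0) :
    2 * (∑ i, Nat.card {t // col t = i ∧ p.1.1 t ≠ t} / 2 + (p.2 : ℕ)) =
      ∑ i, (Nat.card {t // col t = i} + inserted r i) := by
  unfold siteWeight at h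
  have h1 := left_ne_zero_of_mul h
  have h2 := right_ne_zero_of_mul h
  rw [Finset.prod_ne_zero_iff] at h1
  have h3 : (p.2 : ℕ) = ghosts r (fun i => Nat.card {t // col t = i ∧ p.1.1 t = t}) := by
    by_contra h4
    exact h2 (if_neg h4)
  have h4 := (ghosts_spec hN hr _ fun i => h1 i (Finset.mem_univ i)).1
  rw [h3, mul_add, ← h4, Finset.mul_sum, Finset.sum_add_distrib]
  simp_rw [← card_nonfixed_colInvol col p.1]
  rw [Finset.sum_add_distrib]
  ring

lemma sum_siteWeight (hN : 2 ≤ N) {r : ℕ} (hr : r ≤ 2) :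
    ∑ p : ColInvol col × Fin 5, siteWeight col r p =
      ∏ i, (matchings (Nat.card {t // col t = i} + inserted r i) : ℝ) := by
  rw [← sum_colInvol col r hr, Fintype.sum_prod_type]
  refine Finset.sum_congr rfl fun f _ => ?_
  simp only [siteWeight]
  rw [← Finset.mul_sum]
  by_cases h : ∏ i, unpairedWeight (inserted r i) (Nat.card {t // col t = i ∧ f.1 t = t}) = 0
  · rw [h, zero_mul]
  · have h1 := (ghosts_spec hN hr _ fun i => Finset.prod_ne_zero_iff.mp h i (Finset.mem_univ i)).2
    rw [Finset.sum_eq_single ⟨_, h1⟩]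
    · simp
    · intro b _ hb
      rw [if_neg]
      intro h2
      exact hb (Fin.ext h2)
    · simp

end

/-! ### Sums over coloured links -/

section
open scoped Classical

lemma hasSum_sigma_of_nonneg {β : Type*} {γ : β → Type*} {f : (Σ b, γ b) → ℝ} (hf : ∀ x, 0 ≤ f x)
    {g : β → ℝ} {a : ℝ} (ha : HasSum g a) (h : ∀ b, HasSum (fun c => f ⟨b, c⟩) (g b)) :
    HasSum f a := by
  refine HasSum.sigma_of_hasSum ha h ((summable_sigma_of_nonneg hf).mpr
    ⟨fun b => (h b).summable, ?_⟩)
  simpa only [(h _).tsum_eq] using ha.summable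

lemma hasSum_fiber_of_nonneg {X Y : Type*} (π : X → Y) {f : X → ℝ} (hf : ∀ x, 0 ≤ f x)
    {g : Y → ℝ} {a : ℝ} (ha : HasSum g a)
    (h : ∀ y, HasSum (fun x : {x // π x = y} => f x.1) (g y)) : HasSum f a := by
  rw [← (Equiv.sigmaFiberEquiv π).hasSum_iff]
  exact hasSum_sigma_of_nonneg (fun x => hf _) ha h

/-- The numbers of times that a word uses each of the colours. -/
def wordCount {N : ℕ} (s : Σ n, Fin n → Fin N) (i : Fin N) : ℕ := Nat.card {j // s.2 j = i}

lemma sum_wordCount {N : ℕ} (s : Σ n, Fin n → Fin N) : ∑ i, wordCount s i = s.1 := by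
  unfold wordCount
  simp only [Nat.card_eq_fintype_card, Fintype.card_subtype]
  rw [← Finset.card_eq_sum_card_fiberwise (f := s.2) (t := Finset.univ)]
  · simp
  · intro x _; simp

/-- Both sides are the coefficient of X^κ in (∑ X_i)^n, expanded into words on the left and by the
multinomial theorem on the right. -/
lemma card_words {N n : ℕ} (κ : Fin N → ℕ) (h : n = ∑ i, κ i) :
    (Finset.univ.filter fun c : Fin n → Fin N => wordCount ⟨n, c⟩ = κ).card =
      Nat.multinomial Finset.univ κ := by
  have h1 := MvPolynomial.coeff_sum_X_pow_of_fintype (R := ℕ) (Finsupp.equivFunOnFinite.symm κ) n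
  rw [if_pos (by rw [Finsupp.sum_fintype _ _ (by simp)]; exact h.symm),
    Finsupp.multinomial_eq_of_support_subset (Finset.subset_univ _), Finset.sum_pow',
    Fintype.piFinset_univ, MvPolynomial.coeff_sum] at h1
  have h2 : ∀ c : Fin n → Fin N, (∏ j, (MvPolynomial.X (c j) : MvPolynomial (Fin N) ℕ)) =
      MvPolynomial.monomial (Finsupp.equivFunOnFinite.symm (wordCount ⟨n, c⟩)) 1 := by
    intro c
    rw [← Finset.prod_fiberwise (s := Finset.univ) (g := c), MvPolynomial.monomial_eq,
      Finsupp.prod_fintype _ _ (by simp)]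
    simp only [map_one, one_mul]
    refine Finset.prod_congr rfl fun i _ => ?_
    rw [Finset.prod_congr rfl (g := fun _ => MvPolynomial.X i)]
    · rw [Finset.prod_const]
      congr 1
      simp [wordCount, Fintype.card_subtype]
    · intro j hj
      rw [(Finset.mem_filter.mp hj).2]
  simp_rw [h2, MvPolynomial.coeff_monomial] at h1
  rw [Finset.card_filter]
  simpa using h1

/-- The Poisson weight of the numbers of links of each colour on each edge. -/
def linkWeight {E : Type*} [Fintype E] {N : ℕ} (lam : ℝ) (q : E → Fin N → ℕ) : ℝ :=
  ∏ e, ∏ i, lam ^ q e i / ((q e i).factorial : ℝ)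

lemma linkWeight_nonneg {E : Type*} [Fintype E] {N : ℕ} {lam : ℝ} (hlam : 0 ≤ lam)
    (q : E → Fin N → ℕ) : 0 ≤ linkWeight lam q :=
  Finset.prod_nonneg fun _ _ => Finset.prod_nonneg fun _ _ => by positivity

/-- On each edge the multinomial number of colourings cancels the factorial of the total number of
links and leaves one Poisson weight for every colour. -/
lemma hasSum_words {E : Type*} [Fintype E] {N : ℕ} {lam : ℝ} (hlam : 0 ≤ lam)
    (H : (E → Fin N → ℕ) → ℝ) (hH : ∀ q, 0 ≤ H q) {a : ℝ}
    (ha : HasSum (fun q => linkWeight lam q * H q) a) :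
    HasSum (fun F : E → Σ n, Fin n → Fin N =>
      (∏ e, lam ^ (F e).1 / ((F e).1.factorial : ℝ)) * H (fun e => wordCount (F e))) a := by
  refine hasSum_fiber_of_nonneg (fun F e => wordCount (F e))
    (fun F => mul_nonneg (Finset.prod_nonneg fun _ _ => by positivity) (hH _)) ha fun q => ?_
  let M : E → ℕ := fun e => ∑ i, q e i
  let eqv : (∀ e, {c : Fin (M e) → Fin N // wordCount ⟨M e, c⟩ = q e}) ≃
      {F : E → Σ n, Fin n → Fin N // (fun e => wordCount (F e)) = q} :=
    Equiv.ofBijective (fun c => ⟨fun e => ⟨M e, (c e).1⟩, funext fun e => (c e).2⟩) <| by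
      constructor
      · intro c c' h
        funext e
        have := congrFun (congrArg Subtype.val h) e
        simp only [Sigma.mk.injEq, heq_eq_eq, true_and] at this
        exact Subtype.ext this
      · rintro ⟨F, hF⟩
        have key : ∀ e, ∃ c : {c : Fin (M e) → Fin N // wordCount ⟨M e, c⟩ = q e},
            (⟨M e, c.1⟩ : Σ n, Fin n → Fin N) = F e := by
          intro e
          have h1 : M e = (F e).1 := by
            rw [← sum_wordCount (F e)]
            exact Finset.sum_congr rfl fun i _ => (congrFun (congrFun hF e) i).symm
          have h2 := congrFun hF e
          rcases hFe : F e with ⟨n, c⟩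
          rw [hFe] at h1 h2
          subst h1
          exact ⟨⟨c, h2⟩, rfl⟩
        choose c hc using key
        exact ⟨c, Subtype.ext (funext hc)⟩
  rw [← eqv.hasSum_iff]
  have h1 : ∀ c, ((fun F : {F : E → Σ n, Fin n → Fin N // (fun e => wordCount (F e)) = q} =>
      (∏ e, lam ^ (F.1 e).1 / ((F.1 e).1.factorial : ℝ)) *
        H (fun e => wordCount (F.1 e))) ∘ eqv) c =
      (∏ e, lam ^ (M e) / ((M e).factorial : ℝ)) * H q := by
    intro c
    simp only [Function.comp]
    rw [(eqv c).2]
    rfl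
  have h2 := hasSum_fintype fun _ : (∀ e, {c : Fin (M e) → Fin N // wordCount ⟨M e, c⟩ = q e}) =>
      (∏ e, lam ^ (M e) / ((M e).factorial : ℝ)) * H q
  rw [funext h1]
  convert! h2 using 1
  rw [Finset.sum_const, Finset.card_univ, Fintype.card_pi, nsmul_eq_mul, ← mul_assoc]
  congr 1
  push_cast
  rw [← Finset.prod_mul_distrib]
  unfold linkWeight
  refine Finset.prod_congr rfl fun e _ => ?_
  rw [Fintype.card_subtype, card_words (q e) rfl]
  have h3 := Nat.multinomial_spec Finset.univ (q e)
  rw [Finset.prod_div_distrib, Finset.prod_pow_eq_pow_sum]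
  have h4 : ((∏ i, (q e i).factorial : ℕ) : ℝ) * (Nat.multinomial Finset.univ (q e) : ℝ) =
      ((M e).factorial : ℝ) := by exact_mod_cast h3
  push_cast at h4
  rw [← h4]
  have h5 : (∏ i, ((q e i).factorial : ℝ)) ≠ 0 :=
    Finset.prod_ne_zero_iff.mpr fun i _ => by positivity
  have h6 : (Nat.multinomial Finset.univ (q e) : ℝ) ≠ 0 := by
    have := Nat.multinomial_pos Finset.univ (q e)
    positivity
  field_simp
  rfl

end

/-! ### Reduction of averages over configurations to sums over link numbers -/

section
open scoped Classical

/-- The number of links of the colour `i` touching `x`. -/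
def degree {V E : Type*} [Fintype E] {N : ℕ} (inc : V → E → Prop) (q : E → Fin N → ℕ) (x : V)
    (i : Fin N) : ℕ := ∑ e, if inc x e then q e i else 0

/-- The total weight of all the pairings, given the numbers of link ends. -/
def vertexWeight {V : Type*} [Fintype V] {N : ℕ} (U : ℕ → ℝ) (vG : V → V → ℝ)
    (k : V → Fin N → ℕ) : ℝ :=
  (∏ x, ∏ i, (matchings (k x i) : ℝ)) * (∏ x, U ((∑ i, k x i) / 2)) *
    Real.exp (-∑ x, ∑ y, vG x y * (((∑ i, k x i) / 2 : ℕ) : ℝ) * (((∑ i, k y i) / 2 : ℕ) : ℝ))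

lemma vertexWeight_nonneg {V : Type*} [Fintype V] {N : ℕ} {U : ℕ → ℝ} (hU : ∀ n, 0 ≤ U n)
    (vG : V → V → ℝ) (k : V → Fin N → ℕ) : 0 ≤ vertexWeight U vG k :=
  mul_nonneg (mul_nonneg (Finset.prod_nonneg fun _ _ => Finset.prod_nonneg fun _ _ =>
    Nat.cast_nonneg _) (Finset.prod_nonneg fun _ _ => hU _)) (Real.exp_nonneg _)

variable {V : Type*} [Fintype V] (G : SimpleGraph V) {N : ℕ}

/-- Incidence of vertices and edges. -/
def incident (x : V) (e : G.edgeSet) : Prop := x ∈ (e : Sym2 V)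

variable {G}

/-- The numbers of links of each colour on each edge. -/
def Config.counts (w : Config G N) (e : G.edgeSet) : Fin N → ℕ :=
  wordCount ⟨w.m e, fun j => w.c ⟨e, j⟩⟩

lemma card_colour_at (F : G.edgeSet → Σ n, Fin n → Fin N) (x : V) (i : Fin N) :
    Nat.card {t : LinkAt G (fun e => (F e).1) x // (F t.1.1).2 t.1.2 = i} =
      degree (incident G) (fun e => wordCount (F e)) x i := by
  have e1 : {t : LinkAt G (fun e => (F e).1) x // (F t.1.1).2 t.1.2 = i} ≃
      Σ e : {e : G.edgeSet // incident G x e}, {j // (F e.1).2 j = i} :=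
    { toFun := fun t => ⟨⟨t.1.1.1, t.1.2⟩, ⟨t.1.1.2, t.2⟩⟩
      invFun := fun s => ⟨⟨⟨s.1.1, s.2.1⟩, s.1.2⟩, s.2.2⟩
      left_inv := fun t => rfl
      right_inv := fun s => rfl }
  rw [Nat.card_congr e1, Nat.card_sigma]
  unfold degree
  rw [← Finset.sum_filter, ← Finset.sum_subtype_eq_sum_filter, Finset.subtype_univ]
  rfl

/-- The possible pairings and ghost pairings at the vertex `x`, given the links. -/
abbrev SiteData (F : G.edgeSet → Σ n, Fin n → Fin N) (x : V) : Type _ :=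
  ColInvol (fun t : LinkAt G (fun e => (F e).1) x => (F t.1.1).2 t.1.2) × Fin 5

/-- Links on the edges, with pairings and ghost pairings at the vertices. -/
abbrev RawConfig (G : SimpleGraph V) (N : ℕ) : Type _ :=
  Σ F : G.edgeSet → Σ n, Fin n → Fin N, ∀ x, SiteData F x

/-- The underlying links, pairings and ghost pairings of a configuration. -/
def Config.toRaw (w : Config G N) : RawConfig G N :=
  ⟨fun e => ⟨w.m e, fun j => w.c ⟨e, j⟩⟩,
    fun x => (⟨w.pair x, w.pair_pair x, w.colour_pair x⟩, w.g x)⟩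

lemma Config.toRaw_injective : Function.Injective (Config.toRaw (G := G) (N := N)) := by
  rintro ⟨m, h, c, p, h1, h2, g⟩ ⟨m', h', c', p', h1', h2', g'⟩ hw
  simp only [Config.toRaw, Sigma.mk.injEq] at hw
  obtain ⟨hF, hp⟩ := hw
  have hm : m = m' := funext fun e => congrArg Sigma.fst (congrFun hF e)
  subst hm
  have hc : c = c' := by
    funext l
    have := congrFun hF l.1
    simp only [Sigma.mk.injEq, heq_eq_eq, true_and] at this
    exact congrFun this l.2
  subst hc
  simp only [heq_eq_eq] at hp
  have hp1 : p = p' := funext fun x => congrArg (fun s => s.1.1) (congrFun hp x)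
  have hg : g = g' := funext fun x => congrArg (fun s => s.2) (congrFun hp x)
  subst hp1 hg
  rfl

/-- The total number of pairings at a vertex. -/
def rawLocalTime (z : RawConfig G N) (x : V) : ℕ :=
  ∑ i, Nat.card {t : LinkAt G (fun e => (z.1 e).1) x //
    (z.1 t.1.1).2 t.1.2 = i ∧ (z.2 x).1.1 t ≠ t} / 2 + ((z.2 x).2 : ℕ)

/-- The weight of a family of links, pairings and ghost pairings with `r x` insertions at `x`. -/
def rawWeight (lam : ℝ) (U : ℕ → ℝ) (vG : V → V → ℝ) (r : V → ℕ) (z : RawConfig G N) : ℝ :=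
  (∏ e, lam ^ (z.1 e).1 / ((z.1 e).1.factorial : ℝ)) *
    (∏ x, U (rawLocalTime z x)) *
    Real.exp (-∑ x, ∑ y, vG x y * (rawLocalTime z x : ℝ) * (rawLocalTime z y : ℝ)) *
    ∏ x, siteWeight _ (r x) (z.2 x)

/-- The restriction to `r x` insertions at every vertex `x`. -/
def insertionFun (r : V → ℕ) (w : Config G N) : ℝ :=
  ∏ x, siteWeight _ (r x) (w.toRaw.2 x)

lemma weight_mul_insertionFun (lam : ℝ) (U : ℕ → ℝ) (vG : V → V → ℝ) (r : V → ℕ)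
    (w : Config G N) :
    w.weight lam U vG * insertionFun r w = rawWeight lam U vG r w.toRaw := rfl

lemma two_mul_rawLocalTime (hN : 2 ≤ N) {r : V → ℕ} (hr : ∀ x, r x ≤ 2) (z : RawConfig G N) (x : V)
    (h : siteWeight _ (r x) (z.2 x) ≠ 0) :
    2 * rawLocalTime z x =
      ∑ i, (degree (incident G) (fun e => wordCount (z.1 e)) x i + inserted (r x) i) := by
  rw [rawLocalTime, localTime_of_siteWeight_ne_zero _ hN (hr x) _ h]
  simp_rw [card_colour_at]

/-- The local times are constant on the support of the site weights, so the sum over all pairings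
factorises over the vertices. -/
lemma sum_rawWeight (hN : 2 ≤ N) (lam : ℝ) (U : ℕ → ℝ) (vG : V → V → ℝ)
    {r : V → ℕ} (hr : ∀ x, r x ≤ 2) (F : G.edgeSet → Σ n, Fin n → Fin N) :
    ∑ s : ∀ x, SiteData F x, rawWeight lam U vG r ⟨F, s⟩ =
      (∏ e, lam ^ (F e).1 / ((F e).1.factorial : ℝ)) *
        vertexWeight U vG (fun x i =>
          degree (incident G) (fun e => wordCount (F e)) x i + inserted (r x) i) := by
  set k : V → Fin N → ℕ := fun x i =>
    degree (incident G) (fun e => wordCount (F e)) x i + inserted (r x) i with hk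
  have h1 : ∀ s : ∀ x, SiteData F x, rawWeight lam U vG r ⟨F, s⟩ =
      (∏ e, lam ^ (F e).1 / ((F e).1.factorial : ℝ)) *
        ((∏ x, U ((∑ i, k x i) / 2)) * Real.exp (-∑ x, ∑ y, vG x y *
          (((∑ i, k x i) / 2 : ℕ) : ℝ) * (((∑ i, k y i) / 2 : ℕ) : ℝ))) *
        ∏ x, siteWeight _ (r x) (s x) := by
    intro s
    unfold rawWeight
    by_cases h : ∏ x, siteWeight _ (r x) (s x) = 0
    · rw [h, mul_zero, mul_zero]
    · have h2 : ∀ x, rawLocalTime ⟨F, s⟩ x = (∑ i, k x i) / 2 := fun x => by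
        have := two_mul_rawLocalTime hN hr ⟨F, s⟩ x
          (Finset.prod_ne_zero_iff.mp h x (Finset.mem_univ x))
        simp only [hk]
        simp only at this
        omega
      simp_rw [h2]
      ring
  simp_rw [h1]
  rw [← Finset.mul_sum]
  have h2 := Finset.prod_univ_sum (fun x => (Finset.univ : Finset (SiteData F x)))
    (fun x s => siteWeight _ (r x) s)
  simp only [Fintype.piFinset_univ] at h2
  rw [← h2]
  have h3 : ∀ x, ∑ s : SiteData F x, siteWeight _ (r x) s = ∏ i, (matchings (k x i) : ℝ) := by
    intro x
    have := sum_siteWeight (fun t : LinkAt G (fun e => (F e).1) x => (F t.1.1).2 t.1.2) hN (hr x)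
    simp_rw [card_colour_at] at this
    convert! this
  simp_rw [h3]
  unfold vertexWeight
  ring

/-- Raw data carry no parity condition. On the support it is automatic: the number of link ends at x
plus 2 r(x) is twice the local time. -/
lemma mem_range_toRaw (hN : 2 ≤ N) {lam : ℝ} {U : ℕ → ℝ} {vG : V → V → ℝ}
    {r : V → ℕ} (hr : ∀ x, r x ≤ 2) (z : RawConfig G N) (h : rawWeight lam U vG r z ≠ 0) :
    z ∈ Set.range (Config.toRaw (G := G) (N := N)) := by
  have h1 : ∀ x, siteWeight _ (r x) (z.2 x) ≠ 0 := fun x =>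
    Finset.prod_ne_zero_iff.mp (right_ne_zero_of_mul h) x (Finset.mem_univ x)
  obtain ⟨F, s⟩ := z
  refine ⟨⟨fun e => (F e).1, fun x => ?_, fun l => (F l.1).2 l.2, fun x => (s x).1.1,
    fun x => (s x).1.2.1, fun x => (s x).1.2.2, fun x => (s x).2⟩, rfl⟩
  have h2 := two_mul_rawLocalTime hN hr ⟨F, s⟩ x (h1 x)
  rw [Finset.sum_add_distrib, sum_inserted hN] at h2
  simp_rw [← card_colour_at] at h2
  have h3 : Nat.card (LinkAt G (fun e => (F e).1) x) = ∑ i, Nat.card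
      {t : LinkAt G (fun e => (F e).1) x // (F t.1.1).2 t.1.2 = i} := by
    rw [← Nat.card_sigma]
    exact Nat.card_congr (Equiv.sigmaFiberEquiv _).symm
  rw [h3]
  exact ⟨rawLocalTime ⟨F, s⟩ x - r x, by omega⟩

/-- The average of a function of the link numbers over the configurations with `r x` insertions
at every vertex `x`. -/
lemma hasSum_config (hN : 2 ≤ N) {lam : ℝ} (hlam : 0 ≤ lam) {U : ℕ → ℝ} (hU : ∀ n, 0 ≤ U n)
    (vG : V → V → ℝ) {r : V → ℕ} (hr : ∀ x, r x ≤ 2) (ψ : (G.edgeSet → Fin N → ℕ) → ℝ)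
    (hψ : ∀ q, 0 ≤ ψ q) {a : ℝ}
    (ha : HasSum (fun q : G.edgeSet → Fin N → ℕ => linkWeight lam q *
      (vertexWeight U vG (fun x i => degree (incident G) q x i + inserted (r x) i) * ψ q)) a) :
    HasSum (fun w : Config G N => w.weight lam U vG * (insertionFun r w * ψ w.counts)) a := by
  have h1 : (fun w : Config G N => w.weight lam U vG * (insertionFun r w * ψ w.counts)) =
      (fun z : RawConfig G N => rawWeight lam U vG r z * ψ (fun e => wordCount (z.1 e))) ∘
        Config.toRaw := by
    funext w
    rw [← mul_assoc, weight_mul_insertionFun]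
    rfl
  rw [h1, Config.toRaw_injective.hasSum_iff]
  swap
  · intro z hz
    by_contra h
    exact hz (mem_range_toRaw hN hr z (left_ne_zero_of_mul h))
  refine hasSum_sigma_of_nonneg (fun z => mul_nonneg (mul_nonneg (mul_nonneg (mul_nonneg
    (Finset.prod_nonneg fun _ _ => by positivity) (Finset.prod_nonneg fun _ _ => hU _))
    (Real.exp_nonneg _)) (Finset.prod_nonneg fun _ _ => siteWeight_nonneg _ _ _)) (hψ _))
    (hasSum_words hlam _ (fun q => mul_nonneg (vertexWeight_nonneg hU _ _) (hψ q)) ha) fun F => ?_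
  have h2 := hasSum_fintype fun s : ∀ x, SiteData F x =>
    rawWeight lam U vG r ⟨F, s⟩ * ψ (fun e => wordCount (F e))
  rw [← Finset.sum_mul, sum_rawWeight hN lam U vG hr F, mul_assoc] at h2
  exact h2

end

/-! ### The averages in the main theorem as sums over link numbers -/

section
open scoped Classical

/-- The weight of `u i` unpaired links of each colour `i` and `g` ghost pairings at a vertex with
`r` insertions. -/
def siteIndicator {N : ℕ} (r : ℕ) (u : Fin N → ℕ) (g : ℕ) : ℝ :=
  (∏ i, unpairedWeight (inserted r i) (u i)) * if g = ghosts r u then 1 else 0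

lemma siteIndicator_zero {N : ℕ} (u : Fin N → ℕ) (g : ℕ) :
    siteIndicator 0 u g = if (∀ i, u i = 0) ∧ g = 0 then 1 else 0 := by
  have h : ∏ i, unpairedWeight (inserted 0 i) (u i) = if ∀ i, u i = 0 then 1 else 0 := by
    have : ∀ i, unpairedWeight (inserted 0 i) (u i) = if u i = 0 then 1 else 0 := fun i => by
      simp [inserted, unpairedWeight]
    simp_rw [this, Finset.prod_ite_zero]
    simp
  unfold siteIndicator
  rw [h]
  by_cases hu : ∀ i, u i = 0
  · have hc : ghosts 0 u = 0 := by simp [ghosts, hu]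
    simp [hu, hc]
  · simp [hu]

lemma siteIndicator_one {N : ℕ} (u : Fin N → ℕ) (g : ℕ) :
    siteIndicator 1 u g =
      if (∀ i : Fin N, u i = if (i : ℕ) < 2 then 1 else 0) ∧ g = 2 then 1 else 0 := by
  have h : ∏ i, unpairedWeight (inserted 1 i) (u i) =
      if ∀ i : Fin N, u i = (if (i : ℕ) < 2 then 1 else 0) then 1 else 0 := by
    have : ∀ i : Fin N, unpairedWeight (inserted 1 i) (u i) =
        if u i = (if (i : ℕ) < 2 then 1 else 0) then 1 else 0 := fun i => by
      unfold inserted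
      by_cases hi : (i : ℕ) < 2 <;> simp [hi, unpairedWeight]
    simp_rw [this, Finset.prod_ite_zero]
    simp
  unfold siteIndicator
  rw [h]
  by_cases hu : ∀ i : Fin N, u i = if (i : ℕ) < 2 then 1 else 0
  · have hc : ghosts 1 u = 2 := by
      have : IsEmpty {i // u i = 2} := ⟨fun i => by
        have h1 := hu i.1
        rw [i.2] at h1
        split_ifs at h1
        omega⟩
      simp [ghosts]
    simp [hu, ← hc]
  · rw [if_neg hu, zero_mul, if_neg fun h => hu h.1]

lemma siteIndicator_two {N : ℕ} (u : Fin N → ℕ) (g : ℕ) :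
    siteIndicator 2 u g =
      if (∀ i : Fin N, u i = 0 ∨ ((i : ℕ) < 2 ∧ u i = 2)) ∧ g = 2 + Nat.card {i // u i = 2}
        then 2 ^ Nat.card {i // u i = 2} else 0 := by
  have h : ∏ i, unpairedWeight (inserted 2 i) (u i) =
      if ∀ i : Fin N, u i = 0 ∨ ((i : ℕ) < 2 ∧ u i = 2) then 2 ^ Nat.card {i // u i = 2} else 0 := by
    have : ∀ i : Fin N, unpairedWeight (inserted 2 i) (u i) =
        if u i = 0 ∨ ((i : ℕ) < 2 ∧ u i = 2) then (if u i = 2 then 2 else 1) else 0 := fun i => by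
      unfold inserted
      by_cases hi : (i : ℕ) < 2
      · by_cases h0 : u i = 0
        · simp [hi, unpairedWeight, h0]
        · simp only [hi, unpairedWeight, h0]
          by_cases h2 : u i = 2 <;> simp [h0, h2]
      · by_cases h0 : u i = 0 <;> simp [hi, unpairedWeight, h0]
    simp_rw [this, Finset.prod_ite_zero]
    simp only [Finset.mem_univ, true_imp_iff]
    congr 1
    rw [Finset.prod_ite, Finset.prod_const, Finset.prod_const, one_pow, mul_one,
      Nat.card_eq_fintype_card, Fintype.card_subtype]
  unfold siteIndicator
  rw [h]
  by_cases hu : ∀ i : Fin N, u i = 0 ∨ ((i : ℕ) < 2 ∧ u i = 2)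
  · rw [if_pos hu]
    simp only [ghosts, if_neg (show (2 : ℕ) ≠ 0 by norm_num), hu, implies_true, true_and,
      mul_ite, mul_one, mul_zero]
  · rw [if_neg hu, zero_mul, if_neg fun h => hu h.1]

variable {V : Type*} [Fintype V] {G : SimpleGraph V} {N : ℕ}

lemma insertionFun_eq (r : V → ℕ) (w : Config G N) :
    insertionFun r w = ∏ x, siteIndicator (r x) (w.unpaired x) (w.g x : ℕ) := rfl

lemma closedInd_eq (w : Config G N) : closedInd w = insertionFun 0 w := by
  rw [insertionFun_eq]
  simp only [Pi.zero_apply, siteIndicator_zero, Finset.prod_ite_zero, Finset.mem_univ,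
    true_imp_iff, Finset.prod_const_one, closedInd, Set.indicator_apply, Set.mem_ofPred_eq,
    Config.IsClosed, Pi.one_apply]

/-- One insertion at `x` and one at `y`. -/
def pairInsertion (x y : V) (z : V) : ℕ := (if z = x then 1 else 0) + if z = y then 1 else 0

lemma pairInsertion_le (x y z : V) : pairInsertion x y z ≤ 2 := by
  unfold pairInsertion
  split_ifs <;> norm_num

/-- The diagonal and off-diagonal definitions are unified: two insertions at the same vertex produce
the factor 2^q through the value 2 of `unpairedWeight`. -/
lemma directedFun_eq (x y : V) (w : Config G N) :
    directedFun x y w = insertionFun (pairInsertion x y) w := by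
  rw [insertionFun_eq]
  unfold directedFun
  by_cases hxy : x = y
  · subst hxy
    rw [if_pos rfl]
    have h : ∀ z, siteIndicator (pairInsertion x x z) (w.unpaired z) (w.g z : ℕ) =
        if (z ≠ x → (∀ i, w.unpaired z i = 0) ∧ (w.g z : ℕ) = 0) ∧
          (z = x → (∀ i : Fin N, w.unpaired x i = 0 ∨ ((i : ℕ) < 2 ∧ w.unpaired x i = 2)) ∧
            (w.g x : ℕ) = 2 + Nat.card {i : Fin N // w.unpaired x i = 2})
        then (if z = x then 2 ^ Nat.card {i : Fin N // w.unpaired x i = 2} else 1) else 0 := by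
      intro z
      by_cases hz : z = x
      · subst hz
        simp only [pairInsertion, if_true]
        rw [siteIndicator_two]
        simp
      · simp only [pairInsertion, if_neg hz, add_zero, siteIndicator_zero]
        simp [hz]
    simp_rw [h, Finset.prod_ite_zero]
    simp only [Finset.mem_univ, true_imp_iff, Finset.prod_ite_eq', if_true]
    congr 1
    apply propext
    unfold Config.IsOpenAt
    constructor
    · rintro ⟨h1, h2, h3⟩ z
      exact ⟨h1 z, fun _ => ⟨h2, h3⟩⟩
    · intro h
      exact ⟨fun z => (h z).1, ((h x).2 rfl).1, ((h x).2 rfl).2⟩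
  · rw [if_neg hxy]
    have h : ∀ z, siteIndicator (pairInsertion x y z) (w.unpaired z) (w.g z : ℕ) =
        if (z ≠ x → z ≠ y → (∀ i, w.unpaired z i = 0) ∧ (w.g z : ℕ) = 0) ∧
          (z = x ∨ z = y → (∀ i : Fin N, w.unpaired z i = if (i : ℕ) < 2 then 1 else 0) ∧
            (w.g z : ℕ) = 2) then 1 else 0 := by
      intro z
      by_cases hz : z = x
      · subst hz
        simp only [pairInsertion, if_true, if_neg hxy, add_zero, siteIndicator_one]
        simp
      · by_cases hz' : z = y
        · subst hz'
          simp only [pairInsertion, if_true, if_neg hz, zero_add, siteIndicator_one]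
          simp
        · simp only [pairInsertion, if_neg hz, if_neg hz', add_zero, siteIndicator_zero]
          simp [hz, hz']
    simp_rw [h, Finset.prod_ite_zero]
    simp only [Finset.mem_univ, true_imp_iff, Finset.prod_const_one]
    congr 1
    apply propext
    unfold Config.IsOpenBetween
    exact forall_and.symm

lemma linkCount_eq (w : Config G N) (e : G.edgeSet) (i : Fin N) :
    w.linkCount e i = w.counts e i := by
  unfold Config.linkCount Config.counts wordCount
  refine (Nat.card_congr (Equiv.ofBijective
    (fun j : {j : Fin (w.m e) // w.c ⟨e, j⟩ = i} =>
      (⟨⟨e, j.1⟩, rfl, j.2⟩ : {l : Link G w.m // (l.1 : Sym2 V) = e ∧ w.c l = i})) ⟨?_, ?_⟩)).symm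
  · intro j j' h
    simpa [Subtype.ext_iff] using h
  · rintro ⟨⟨e', j⟩, h1, h2⟩
    obtain rfl : e' = e := Subtype.ext h1
    exact ⟨⟨j, h2⟩, rfl⟩

lemma linkCount_of_notMem (w : Config G N) {e : Sym2 V} (he : e ∉ G.edgeSet) (i : Fin N) :
    w.linkCount e i = 0 := by
  unfold Config.linkCount
  have : IsEmpty {l : Link G w.m // (l.1 : Sym2 V) = e ∧ w.c l = i} :=
    ⟨fun l => he (l.2.1 ▸ l.1.1.2)⟩
  exact Nat.card_of_isEmpty

end

/-! ### Summability and shifts of the link numbers -/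

section
open scoped Classical

variable {V E : Type*} [Fintype V] [Fintype E] {N : ℕ}

/-- Every finite set of link numbers lies in a box, and the sum over a box is a product of partial
sums of the exponential series. -/
lemma summable_linkWeight {lam : ℝ} (hlam : 0 ≤ lam) :
    Summable (linkWeight (E := E) (N := N) lam) := by
  refine summable_of_sum_le (c := ∏ _e : E, ∏ _i : Fin N, Real.exp lam) (linkWeight_nonneg hlam)
    fun S => ?_
  let M : ℕ := ∑ q ∈ S, ∑ e, ∑ i, (q e i + 1)
  have hM : ∀ q ∈ S, ∀ e i, q e i < M := fun q hq e i => by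
    have h1 : q e i + 1 ≤ ∑ i, (q e i + 1) :=
      Finset.single_le_sum (f := fun i => q e i + 1) (fun _ _ => Nat.zero_le _) (Finset.mem_univ i)
    have h2 : ∑ i, (q e i + 1) ≤ ∑ e, ∑ i, (q e i + 1) :=
      Finset.single_le_sum (f := fun e => ∑ i, (q e i + 1)) (fun _ _ => Nat.zero_le _)
        (Finset.mem_univ e)
    have h3 : ∑ e, ∑ i, (q e i + 1) ≤ M :=
      Finset.single_le_sum (f := fun q : E → Fin N → ℕ => ∑ e, ∑ i, (q e i + 1))
        (fun _ _ => Nat.zero_le _) hq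
    omega
  have hS : S ⊆ Fintype.piFinset fun _ : E => Fintype.piFinset fun _ : Fin N => Finset.range M := by
    intro q hq
    simp only [Fintype.mem_piFinset, Finset.mem_range]
    exact hM q hq
  refine (Finset.sum_le_sum_of_subset_of_nonneg hS fun q _ _ => linkWeight_nonneg hlam q).trans ?_
  unfold linkWeight
  rw [Finset.sum_prod_piFinset _ (fun (_ : E) (a : Fin N → ℕ) =>
    ∏ i, lam ^ a i / ((a i).factorial : ℝ))]
  refine Finset.prod_le_prod (fun e _ => Finset.sum_nonneg fun a _ => Finset.prod_nonneg
    fun i _ => by positivity) fun e _ => ?_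
  rw [Finset.sum_prod_piFinset _ (fun (_ : Fin N) (n : ℕ) => lam ^ n / (n.factorial : ℝ))]
  exact Finset.prod_le_prod (fun e _ => Finset.sum_nonneg fun a _ => by positivity)
    fun i _ => Real.sum_le_exp_of_nonneg hlam M

/-- The total number of links. -/
def totalLinks (q : E → Fin N → ℕ) : ℕ := ∑ e, ∑ i, q e i

/-- An exponential of the total number of links only rescales λ, so all exponential moments are
finite. -/
lemma linkWeight_mul_pow (lam R : ℝ) (q : E → Fin N → ℕ) :
    linkWeight lam q * R ^ totalLinks q = linkWeight (lam * R) q := by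
  unfold linkWeight totalLinks
  rw [← Finset.prod_pow_eq_pow_sum, ← Finset.prod_mul_distrib]
  refine Finset.prod_congr rfl fun e _ => ?_
  rw [← Finset.prod_pow_eq_pow_sum, ← Finset.prod_mul_distrib]
  refine Finset.prod_congr rfl fun i _ => ?_
  rw [mul_pow]
  ring

lemma sum_degree_le (inc : V → E → Prop) (q : E → Fin N → ℕ) :
    ∑ x, ∑ i, degree inc q x i ≤ Fintype.card V * totalLinks q := by
  rw [← smul_eq_mul, ← Finset.card_univ, ← Finset.sum_const]
  refine Finset.sum_le_sum fun x _ => ?_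
  unfold degree totalLinks
  rw [Finset.sum_comm]
  refine Finset.sum_le_sum fun e _ => Finset.sum_le_sum fun i _ => ?_
  split_ifs <;> omega

lemma le_totalLinks (q : E → Fin N → ℕ) (e : E) (i : Fin N) : q e i ≤ totalLinks q :=
  (Finset.single_le_sum (f := fun i => q e i) (fun _ _ => Nat.zero_le _) (Finset.mem_univ i)).trans
    (Finset.single_le_sum (f := fun e => ∑ i, q e i) (fun _ _ => Nat.zero_le _)
      (Finset.mem_univ e))

/-- Exponential growth of the weights of the pairings. -/
def ExpBounded (N : ℕ) (U : ℕ → ℝ) (vG : V → V → ℝ) : Prop :=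
  ∃ C ρ : ℝ, 0 ≤ C ∧ 1 ≤ ρ ∧ ∀ k : V → Fin N → ℕ,
    vertexWeight U vG k ≤ C * ρ ^ (∑ x, ∑ i, k x i)

lemma summable_of_expBounded {lam : ℝ} (hlam : 0 ≤ lam) {U : ℕ → ℝ} (hU : ∀ n, 0 ≤ U n)
    {vG : V → V → ℝ} (hb : ExpBounded N U vG)
    (k : (E → Fin N → ℕ) → V → Fin N → ℕ) (a b : ℕ)
    (hk : ∀ q, ∑ x, ∑ i, k q x i ≤ a + b * totalLinks q)
    (ψ : (E → Fin N → ℕ) → ℝ) (hψ0 : ∀ q, 0 ≤ ψ q) (c R : ℝ)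
    (hψ : ∀ q, ψ q ≤ c * R ^ totalLinks q) :
    Summable fun q => linkWeight lam q * (vertexWeight U vG (k q) * ψ q) := by
  obtain ⟨C, ρ, hC, hρ, h⟩ := hb
  have hs : Summable fun q : E → Fin N → ℕ =>
      (C * ρ ^ a * |c|) * linkWeight (lam * (ρ ^ b * |R|)) q :=
    (summable_linkWeight (by positivity)).mul_left _
  refine hs.of_nonneg_of_le (fun q => mul_nonneg (linkWeight_nonneg hlam q)
    (mul_nonneg (vertexWeight_nonneg hU _ _) (hψ0 q))) fun q => ?_
  rw [← linkWeight_mul_pow]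
  have h1 : vertexWeight U vG (k q) ≤ C * (ρ ^ a * (ρ ^ b) ^ totalLinks q) := by
    refine (h _).trans (mul_le_mul_of_nonneg_left ?_ hC)
    rw [← pow_mul, ← pow_add]
    exact pow_le_pow_right₀ hρ (hk q)
  have h2 : ψ q ≤ |c| * |R| ^ totalLinks q := by
    refine (hψ q).trans ((le_abs_self _).trans ?_)
    rw [abs_mul, abs_pow]
  calc linkWeight lam q * (vertexWeight U vG (k q) * ψ q)
      ≤ linkWeight lam q * (C * (ρ ^ a * (ρ ^ b) ^ totalLinks q) * (|c| * |R| ^ totalLinks q)) :=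
        mul_le_mul_of_nonneg_left (mul_le_mul h1 h2 (hψ0 q) (by positivity))
          (linkWeight_nonneg hlam q)
    _ = C * ρ ^ a * |c| * (linkWeight lam q * (ρ ^ b * |R|) ^ totalLinks q) := by
        rw [mul_pow]; ring

/-- One link of colour `i` on the edge `e`. -/
def oneLink (e : E) (i : Fin N) : E → Fin N → ℕ := fun e' i' => if e' = e ∧ i' = i then 1 else 0

lemma linkWeight_add_oneLink (lam : ℝ) (q : E → Fin N → ℕ) (e : E) (i : Fin N) :
    linkWeight lam (q + oneLink e i) * (q e i + 1) = lam * linkWeight lam q := by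
  unfold linkWeight
  rw [← Fintype.prod_prod_type' (f := fun e' i' =>
      lam ^ (q + oneLink e i) e' i' / (((q + oneLink e i) e' i').factorial : ℝ)),
    ← Fintype.prod_prod_type' (f := fun e' i' => lam ^ q e' i' / ((q e' i').factorial : ℝ)),
    ← Finset.mul_prod_erase _ _ (Finset.mem_univ (e, i)),
    ← Finset.mul_prod_erase (Finset.univ : Finset (E × Fin N)) (fun p : E × Fin N =>
      lam ^ q p.1 p.2 / ((q p.1 p.2).factorial : ℝ)) (Finset.mem_univ (e, i))]
  have h1 : ∏ p ∈ Finset.univ.erase (e, i), lam ^ (q + oneLink e i) p.1 p.2 /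
        (((q + oneLink e i) p.1 p.2).factorial : ℝ) =
      ∏ p ∈ Finset.univ.erase (e, i), lam ^ q p.1 p.2 / ((q p.1 p.2).factorial : ℝ) := by
    refine Finset.prod_congr rfl fun p hp => ?_
    have h2 : (q + oneLink e i) p.1 p.2 = q p.1 p.2 := by
      simp only [Pi.add_apply, oneLink]
      rw [if_neg, add_zero]
      rintro ⟨h1, h2⟩
      exact (Finset.ne_of_mem_erase hp) (Prod.ext h1 h2)
    rw [h2]
  rw [h1]
  simp only [Pi.add_apply, oneLink, and_self, if_true, Nat.factorial_succ, pow_succ]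
  push_cast
  have h3 : ((q e i : ℝ) + 1) ≠ 0 := by positivity
  have h4 : ((q e i).factorial : ℝ) ≠ 0 := by positivity
  field_simp

/-- The shift identity of Poisson weights. Summability is not needed: the terms with count zero
vanish and the others are reindexed. -/
lemma tsum_linkWeight_mul_count {lam : ℝ} (e : E) (i : Fin N) (H : (E → Fin N → ℕ) → ℝ) :
    ∑' q, linkWeight lam q * ((q e i : ℝ) * H q) =
      lam * ∑' q, linkWeight lam q * H (q + oneLink e i) := by
  have hinj : Function.Injective fun q : E → Fin N → ℕ => q + oneLink e i :=
    fun q q' h => add_right_cancel h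
  rw [← hinj.tsum_eq, ← tsum_mul_left]
  · refine tsum_congr fun q => ?_
    have := linkWeight_add_oneLink lam q e i
    have h1 : ((q + oneLink e i) e i : ℝ) = q e i + 1 := by simp [oneLink]
    rw [h1, ← mul_assoc, this, mul_assoc]
  · intro q hq
    have h1 : q e i ≠ 0 := by
      rintro h0
      simp [h0] at hq
    -- The count on `e` is positive, so the truncated subtraction is exact.
    refine ⟨q - oneLink e i, ?_⟩
    funext e' i'
    simp only [Pi.add_apply, Pi.sub_apply, oneLink]
    split_ifs with h
    · obtain ⟨rfl, rfl⟩ := h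
      omega
    · omega

lemma degree_add (inc : V → E → Prop) (q q' : E → Fin N → ℕ) :
    degree inc (q + q') = degree inc q + degree inc q' := by
  funext x i
  simp only [degree, Pi.add_apply, ← Finset.sum_add_distrib]
  refine Finset.sum_congr rfl fun e _ => ?_
  split_ifs <;> simp

lemma degree_oneLink (inc : V → E → Prop) (e : E) (i : Fin N) (x : V) (j : Fin N) :
    degree inc (oneLink e i) x j = if inc x e ∧ j = i then 1 else 0 := by
  unfold degree oneLink
  rw [Finset.sum_eq_single e]
  · by_cases h1 : inc x e <;> by_cases h2 : j = i <;> simp [h1, h2]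
  · intro e' _ h; simp [h]
  · simp

end

/-! ### Reflection positivity -/

section
open scoped Classical
open Filter Topology

/-- Positivity of a sum over objects that are glued from two halves. -/
lemma tsum_nonneg_of_glue {Q P C : Type*} (l r : Q → P)
    (hinj : ∀ q q', l q = l q' → r q = r q' → q = q') (c : P → C) (hc : ∀ q, c (l q) = c (r q))
    (hs : ∀ p p', c p = c p' → ∃ q, l q = p ∧ r q = p') (F : P → P → ℝ)
    (hF : ∀ S : Finset P, 0 ≤ ∑ p ∈ S, ∑ p' ∈ S, if c p = c p' then F p p' else 0)
    (hsum : Summable fun q => F (l q) (r q)) : 0 ≤ ∑' q, F (l q) (r q) := by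
  let f : P × P → ℝ := fun p => if c p.1 = c p.2 then F p.1 p.2 else 0
  let g : Q → P × P := fun q => (l q, r q)
  have hg : Function.Injective g := fun q q' h =>
    hinj q q' (congrArg Prod.fst h) (congrArg Prod.snd h)
  have hfg : f ∘ g = fun q => F (l q) (r q) := by
    funext q
    simp [f, g, hc]
  have h1 : HasSum f (∑' q, F (l q) (r q)) := by
    rw [← hg.hasSum_iff, hfg]
    · exact hsum.hasSum
    · intro p hp
      by_contra h
      have h2 : c p.1 = c p.2 := by
        by_contra h3
        exact h (if_neg h3)
      obtain ⟨q, hq1, hq2⟩ := hs _ _ h2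
      exact hp ⟨q, Prod.ext hq1 hq2⟩
  -- The squares S × S are cofinal among the finite sets of pairs, so the sum is a limit of
  -- symmetric partial sums, which are nonnegative by hypothesis.
  have h2 : Tendsto (fun S : Finset P => S ×ˢ S) atTop atTop := by
    refine tendsto_atTop_finset_of_monotone (fun S T h => Finset.product_subset_product h h)
      fun p => ⟨{p.1, p.2}, by simp⟩
  refine ge_of_tendsto' (h1.comp h2) fun S => ?_
  simp only [Function.comp, Finset.sum_product]
  exact hF S

/-- The exponential of a positive semidefinite form is a positive semidefinite kernel. -/
lemma sum_exp_form_nonneg {ι I : Type*} [Fintype ι] [Fintype I] (M : ι → ι → ℝ)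
    (hsymm : ∀ x y, M x y = M y x) (hM : ∀ a : ι → ℝ, 0 ≤ ∑ x, ∑ y, M x y * a x * a y)
    (n : I → ι → ℝ) (f : I → ℝ) :
    0 ≤ ∑ i, ∑ j, f i * f j * Real.exp (∑ x, ∑ y, M x y * n i x * n j y) := by
  let K : Matrix I I ℝ := Matrix.of fun i j => ∑ x, ∑ y, M x y * n i x * n j y
  have hquad : ∀ (A : Matrix I I ℝ) (f : I → ℝ),
      dotProduct (star f) (A.mulVec f) = ∑ i, ∑ j, f i * f j * A i j := by
    intro A f
    simp only [dotProduct, Matrix.mulVec, Finset.mul_sum]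
    refine Finset.sum_congr rfl fun i _ => Finset.sum_congr rfl fun j _ => ?_
    simp only [star_trivial]
    ring
  have hK : K.PosSemidef := by
    rw [Matrix.posSemidef_iff_dotProduct_mulVec]
    refine ⟨?_, fun f => ?_⟩
    · ext i j
      simp only [Matrix.conjTranspose_apply, star_trivial, K, Matrix.of_apply]
      rw [Finset.sum_comm]
      refine Finset.sum_congr rfl fun x _ => Finset.sum_congr rfl fun y _ => ?_
      rw [hsymm]
      ring
    · rw [hquad]
      have h := hM fun x => ∑ i, f i * n i x
      refine h.trans_eq ?_
      simp only [K, Matrix.of_apply, Finset.mul_sum, Finset.sum_mul]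
      rw [Finset.sum_comm' (t' := Finset.univ) (s' := fun _ => Finset.univ) (by simp)]
      have e1 : ∀ y, ∑ x, ∑ j, ∑ i, M x y * (f i * n i x) * (f j * n j y) =
          ∑ i, ∑ j, ∑ x, f i * f j * (M x y * n i x * n j y) := by
        intro y
        rw [Finset.sum_comm]
        rw [Finset.sum_comm (s := (Finset.univ : Finset I)) (t := (Finset.univ : Finset I))]
        refine Finset.sum_congr rfl fun j _ => ?_
        rw [Finset.sum_comm]
        refine Finset.sum_congr rfl fun i _ => Finset.sum_congr rfl fun x _ => ?_
        ring
      simp_rw [e1]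
      rw [Finset.sum_comm]
      refine Finset.sum_congr rfl fun i _ => ?_
      rw [Finset.sum_comm]
      refine Finset.sum_congr rfl fun j _ => ?_
      rw [Finset.sum_comm]
  -- By the Schur product theorem all entrywise powers of K are positive semidefinite; the
  -- exponential series combines them with nonnegative coefficients.
  have hpow : ∀ p : ℕ, (Matrix.of fun i j => K i j ^ p : Matrix I I ℝ).PosSemidef := by
    intro p
    induction p with
    | zero =>
      convert! Matrix.posSemidef_vecMulVec_self_star (fun _ : I => (1 : ℝ)) using 1
      ext i j
      simp [Matrix.vecMulVec]
    | succ p ih =>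
      convert! ih.hadamard hK using 1
  have hsum : HasSum (fun p : ℕ => ∑ i, ∑ j, f i * f j * (K i j ^ p / (p.factorial : ℝ)))
      (∑ i, ∑ j, f i * f j * Real.exp (K i j)) := by
    refine hasSum_sum fun i _ => hasSum_sum fun j _ => HasSum.mul_left _ ?_
    rw [Real.exp_eq_exp_ℝ]
    exact NormedSpace.expSeries_div_hasSum_exp (K i j)
  refine hsum.nonneg fun p => ?_
  have h1 := (Matrix.posSemidef_iff_dotProduct_mulVec.mp (hpow p)).2 f
  rw [hquad] at h1
  have h2 : ∑ i, ∑ j, f i * f j * (K i j ^ p / (p.factorial : ℝ)) =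
      (∑ i, ∑ j, f i * f j * K i j ^ p) / (p.factorial : ℝ) := by
    simp only [Finset.sum_div, mul_div_assoc]
  rw [h2]
  exact div_nonneg h1 (by positivity)

/-- The condition c i = c j cuts the kernel into blocks, one for each value of c, and each block is
the previous form with coefficients restricted to one fibre of c. -/
lemma sum_exp_form_nonneg_of_eq {ι I C : Type*} [Fintype ι] [Fintype I] (M : ι → ι → ℝ)
    (hsymm : ∀ x y, M x y = M y x) (hM : ∀ a : ι → ℝ, 0 ≤ ∑ x, ∑ y, M x y * a x * a y)
    (n : I → ι → ℝ) (f : I → ℝ) (c : I → C) :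
    0 ≤ ∑ i, ∑ j, if c i = c j then
      f i * f j * Real.exp (∑ x, ∑ y, M x y * n i x * n j y) else 0 := by
  have h1 : ∀ i j, (if c i = c j then
      f i * f j * Real.exp (∑ x, ∑ y, M x y * n i x * n j y) else 0) =
      ∑ κ ∈ Finset.univ.image c, (if c i = κ then f i else 0) * (if c j = κ then f j else 0) *
        Real.exp (∑ x, ∑ y, M x y * n i x * n j y) := by
    intro i j
    rw [Finset.sum_eq_single (c i)]
    · by_cases h : c i = c j
      · simp [h]
      · simp [h, Ne.symm h]
    · intro κ _ h
      simp [Ne.symm h]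
    · simp
  simp_rw [h1]
  have h2 : ∀ i, ∑ j, ∑ κ ∈ Finset.univ.image c, (if c i = κ then f i else 0) *
      (if c j = κ then f j else 0) * Real.exp (∑ x, ∑ y, M x y * n i x * n j y) =
      ∑ κ ∈ Finset.univ.image c, ∑ j, (if c i = κ then f i else 0) *
      (if c j = κ then f j else 0) * Real.exp (∑ x, ∑ y, M x y * n i x * n j y) :=
    fun i => Finset.sum_comm
  simp_rw [h2]
  rw [Finset.sum_comm]
  exact Finset.sum_nonneg fun κ _ => sum_exp_form_nonneg M hsymm hM n _

/-! ### Reflections of a graph and the splitting of weights into two halves. -/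

variable {V E : Type*} [Fintype V] [Fintype E] {N : ℕ}

/-- A finite graph with an involution that exchanges the half `A` with its complement and fixes
every edge between the halves. -/
structure Reflection (inc : V → E → Prop) where
  /-- the action on vertices -/
  onV : V → V
  /-- the action on edges -/
  onE : E → E
  /-- one of the halves -/
  half : V → Prop
  onV_onV : ∀ x, onV (onV x) = x
  onE_onE : ∀ e, onE (onE e) = e
  inc_iff : ∀ x e, inc (onV x) (onE e) ↔ inc x e
  half_iff : ∀ x, half (onV x) ↔ ¬ half x
  exists_inc : ∀ e, ∃ x, inc x e
  crossing : ∀ e x y, half x → ¬ half y → inc x e → inc y e → onE e = e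

namespace Reflection

variable {inc : V → E → Prop} (θ : Reflection inc)

/-- The edges with an end in the half. -/
def meets (e : E) : Prop := ∃ x, θ.half x ∧ inc x e

/-- The edges between the two halves. -/
def cross (e : E) : Prop := θ.meets e ∧ θ.meets (θ.onE e)

lemma meets_onE (e : E) : θ.meets (θ.onE e) ↔ ∃ x, ¬ θ.half x ∧ inc x e := by
  constructor
  · rintro ⟨x, h1, h2⟩
    refine ⟨θ.onV x, ?_, ?_⟩
    · rw [θ.half_iff, not_not]; exact h1
    · rw [← θ.inc_iff, θ.onV_onV]; exact h2
  · rintro ⟨x, h1, h2⟩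
    exact ⟨θ.onV x, (θ.half_iff x).mpr h1, (θ.inc_iff x e).mpr h2⟩

lemma onE_of_cross {e : E} (h : θ.cross e) : θ.onE e = e := by
  obtain ⟨⟨x, h1, h2⟩, h3⟩ := h
  obtain ⟨y, h4, h5⟩ := (θ.meets_onE e).mp h3
  exact θ.crossing e x y h1 h4 h2 h5

lemma meets_onE_of_not {e : E} (h : ¬ θ.meets e) : θ.meets (θ.onE e) := by
  rw [meets_onE]
  obtain ⟨x, hx⟩ := θ.exists_inc e
  exact ⟨x, fun h1 => h ⟨x, h1, hx⟩, hx⟩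

/-- The equivalence of edges. -/
def equivE : E ≃ E := ⟨θ.onE, θ.onE, θ.onE_onE, θ.onE_onE⟩

/-- The equivalence of vertices. -/
def equivV : V ≃ V := ⟨θ.onV, θ.onV, θ.onV_onV, θ.onV_onV⟩

lemma degree_onE (q : E → Fin N → ℕ) (x : V) :
    degree inc (fun e => q (θ.onE e)) x = degree inc q (θ.onV x) := by
  funext i
  unfold degree
  rw [← θ.equivE.sum_comp]
  refine Finset.sum_congr rfl fun e _ => ?_
  have h : inc x (θ.equivE e) ↔ inc (θ.onV x) e := by
    rw [← θ.inc_iff x]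
    simp [equivE, θ.onE_onE]
  simp only [h]
  simp [equivE, θ.onE_onE]

/-- The numbers of links on the edges that meet the half. -/
def restrict (q : E → Fin N → ℕ) : {p : E → Fin N → ℕ // ∀ e, ¬ θ.meets e → p e = 0} :=
  ⟨fun e => if θ.meets e then q e else 0, fun _ he => if_neg he⟩

lemma degree_restrict (q : E → Fin N → ℕ) {x : V} (hx : θ.half x) :
    degree inc (θ.restrict q).1 x = degree inc q x := by
  funext i
  unfold degree
  refine Finset.sum_congr rfl fun e _ => ?_
  by_cases h : inc x e
  · simp only [restrict, if_pos (show θ.meets e from ⟨x, hx, h⟩)]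
  · simp [h]

/-- The weight of the links on an edge, split evenly for the edges between the halves. -/
def halfLinkWeight (lam : ℝ) (p : E → Fin N → ℕ) : ℝ :=
  ∏ e, if θ.cross e then Real.sqrt (∏ i, lam ^ p e i / ((p e i).factorial : ℝ))
    else if θ.meets e then ∏ i, lam ^ p e i / ((p e i).factorial : ℝ) else 1

/-- A crossing edge is fixed by the reflection and seen from both halves, so each half gets the
square root of its weight. Every other edge belongs to exactly one half. -/
lemma linkWeight_split {lam : ℝ} (hlam : 0 ≤ lam) (q : E → Fin N → ℕ) :
    θ.halfLinkWeight lam (θ.restrict q).1 *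
      θ.halfLinkWeight lam (θ.restrict (fun e => q (θ.onE e))).1 = linkWeight lam q := by
  unfold halfLinkWeight linkWeight
  rw [← θ.equivE.prod_comp (fun e => if θ.cross e then Real.sqrt (∏ i,
    lam ^ (θ.restrict (fun e => q (θ.onE e))).1 e i /
      (((θ.restrict (fun e => q (θ.onE e))).1 e i).factorial : ℝ)) else _), ← Finset.prod_mul_distrib]
  refine Finset.prod_congr rfl fun e _ => ?_
  have h0 : ∀ e, θ.equivE e = θ.onE e := fun _ => rfl
  simp only [h0]
  by_cases hc : θ.cross e
  · rw [θ.onE_of_cross hc, if_pos hc, if_pos hc]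
    simp only [restrict, if_pos hc.1, θ.onE_of_cross hc]
    exact Real.mul_self_sqrt (Finset.prod_nonneg fun i _ => by positivity)
  · have hc' : ¬ θ.cross (θ.onE e) := fun h => hc ⟨by simpa [θ.onE_onE] using h.2, h.1⟩
    rw [if_neg hc, if_neg hc']
    by_cases hm : θ.meets e
    · have hm' : ¬ θ.meets (θ.onE e) := fun h => hc ⟨hm, h⟩
      simp [hm, hm', restrict]
    · have hm' := θ.meets_onE_of_not hm
      simp [hm, hm', restrict, θ.onE_onE]

/-- The weight of the pairings in the half. -/
def halfWeight (U : ℕ → ℝ) (vG : V → V → ℝ) (k : V → Fin N → ℕ) : ℝ :=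
  (∏ x, if θ.half x then (∏ i, (matchings (k x i) : ℝ)) * U ((∑ i, k x i) / 2) else 1) *
    Real.exp (-∑ x, ∑ y, if θ.half x ∧ θ.half y then vG x y * (((∑ i, k x i) / 2 : ℕ) : ℝ) *
      (((∑ i, k y i) / 2 : ℕ) : ℝ) else 0)

/-- The interaction between the halves. -/
def interaction (vG : V → V → ℝ) (x y : V) : ℝ :=
  if θ.half x ∧ θ.half y then 2 * -vG x (θ.onV y) else 0

lemma halfWeight_congr (U : ℕ → ℝ) (vG : V → V → ℝ) {k k' : V → Fin N → ℕ}
    (h : ∀ x, θ.half x → k x = k' x) : θ.halfWeight U vG k = θ.halfWeight U vG k' := by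
  unfold halfWeight
  congr 1
  · refine Finset.prod_congr rfl fun x _ => ?_
    split_ifs with hx
    · rw [h x hx]
    · rfl
  · congr 2
    refine Finset.sum_congr rfl fun x _ => Finset.sum_congr rfl fun y _ => ?_
    split_ifs with hx
    · rw [h x hx.1, h y hx.2]
    · rfl

/-- The energy between the halves appears twice, as (x, θy) and as (θx, y). The two contributions
agree by symmetry, hence the factor 2 in `interaction`. -/
lemma vertexWeight_split (U : ℕ → ℝ) (vG : V → V → ℝ) (hv : ∀ x y, vG x y = vG y x)
    (hθ : ∀ x y, vG (θ.onV x) (θ.onV y) = vG x y) (k : V → Fin N → ℕ) :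
    vertexWeight U vG k = θ.halfWeight U vG k * θ.halfWeight U vG (fun x => k (θ.onV x)) *
      Real.exp (∑ x, ∑ y, θ.interaction vG x y * (((∑ i, k x i) / 2 : ℕ) : ℝ) *
        (((∑ i, k (θ.onV y) i) / 2 : ℕ) : ℝ)) := by
  have h1 : vertexWeight U vG k = (∏ x, (∏ i, (matchings (k x i) : ℝ)) * U ((∑ i, k x i) / 2)) *
      Real.exp (-∑ x, ∑ y, vG x y * (((∑ i, k x i) / 2 : ℕ) : ℝ) *
        (((∑ i, k y i) / 2 : ℕ) : ℝ)) := by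
    rw [Finset.prod_mul_distrib]; rfl
  rw [h1]
  unfold halfWeight
  have h2 : ∀ f : V → ℝ, ∏ x, f x = (∏ x, if θ.half x then f x else 1) *
      ∏ x, if θ.half x then f (θ.onV x) else 1 := by
    intro f
    rw [← θ.equivV.prod_comp (fun x => if θ.half x then f (θ.onV x) else 1),
      ← Finset.prod_mul_distrib]
    refine Finset.prod_congr rfl fun x _ => ?_
    have h0 : θ.equivV x = θ.onV x := rfl
    rw [h0, θ.onV_onV]
    by_cases hx : θ.half x
    · simp [hx, θ.half_iff]
    · simp [hx, θ.half_iff]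
  rw [h2]
  have hsum : ∀ f : V → ℝ, ∑ x, f x = (∑ x, if θ.half x then f x else 0) +
      ∑ x, if θ.half x then f (θ.onV x) else 0 := by
    intro f
    rw [← θ.equivV.sum_comp (fun x => if θ.half x then f (θ.onV x) else 0),
      ← Finset.sum_add_distrib]
    refine Finset.sum_congr rfl fun x _ => ?_
    have h0 : θ.equivV x = θ.onV x := rfl
    rw [h0, θ.onV_onV]
    by_cases hx : θ.half x
    · simp [hx, θ.half_iff]
    · simp [hx, θ.half_iff]
  set n : V → ℝ := fun x => (((∑ i, k x i) / 2 : ℕ) : ℝ) with hn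
  have h3 : ∑ x, ∑ y, vG x y * n x * n y =
      (∑ x, ∑ y, if θ.half x ∧ θ.half y then vG x y * n x * n y else 0) +
      (∑ x, ∑ y, if θ.half x ∧ θ.half y then vG x y * n (θ.onV x) * n (θ.onV y) else 0) -
      ∑ x, ∑ y, θ.interaction vG x y * n x * n (θ.onV y) := by
    have e1 : ∑ x, ∑ y, vG x y * n x * n y = ∑ x, ∑ y, ((if θ.half x ∧ θ.half y then
        vG x y * n x * n y else 0) + (if θ.half x ∧ θ.half y then
        vG x (θ.onV y) * n x * n (θ.onV y) else 0) + ((if θ.half x ∧ θ.half y then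
        vG (θ.onV x) y * n (θ.onV x) * n y else 0) + (if θ.half x ∧ θ.half y then
        vG (θ.onV x) (θ.onV y) * n (θ.onV x) * n (θ.onV y) else 0))) := by
      rw [hsum, ← Finset.sum_add_distrib]
      refine Finset.sum_congr rfl fun x _ => ?_
      by_cases hx : θ.half x
      · simp only [hx, if_true, true_and, Finset.sum_add_distrib]
        rw [hsum (fun y => vG x y * n x * n y), hsum (fun y => vG (θ.onV x) y * n (θ.onV x) * n y)]
      · simp [hx]
    have e2 : ∑ x, ∑ y, (if θ.half x ∧ θ.half y then vG (θ.onV x) y * n (θ.onV x) * n y else 0) =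
        ∑ x, ∑ y, (if θ.half x ∧ θ.half y then vG x (θ.onV y) * n x * n (θ.onV y) else 0) := by
      rw [Finset.sum_comm]
      refine Finset.sum_congr rfl fun x _ => Finset.sum_congr rfl fun y _ => ?_
      rw [hv (θ.onV y) x]
      by_cases hx : θ.half x <;> by_cases hy : θ.half y <;> simp [hx, hy]
      ring
    have e3 : ∑ x, ∑ y, θ.interaction vG x y * n x * n (θ.onV y) =
        -2 * ∑ x, ∑ y, (if θ.half x ∧ θ.half y then vG x (θ.onV y) * n x * n (θ.onV y) else 0) := by
      rw [Finset.mul_sum]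
      refine Finset.sum_congr rfl fun x _ => ?_
      rw [Finset.mul_sum]
      refine Finset.sum_congr rfl fun y _ => ?_
      unfold interaction
      split_ifs <;> ring
    rw [e1, e3]
    simp only [Finset.sum_add_distrib, e2, hθ]
    ring
  rw [h3]
  have h4 : ∀ a b c : ℝ, Real.exp (-(a + b - c)) = Real.exp (-a) * Real.exp (-b) * Real.exp c := by
    intro a b c
    rw [← Real.exp_add, ← Real.exp_add]
    congr 1
    ring
  rw [h4]
  ring

/-- The combination of two fields, given on the half and on its reflection. -/
def combine (k k' : V → Fin N → ℕ) (x : V) : Fin N → ℕ :=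
  if θ.half x then k x else k' (θ.onV x)

/-- Reflection positivity of the model with link numbers. -/
theorem sum_nonneg {lam : ℝ} (hlam : 0 ≤ lam) (U : ℕ → ℝ) (vG : V → V → ℝ)
    (hv : ∀ x y, vG x y = vG y x) (hθ : ∀ x y, vG (θ.onV x) (θ.onV y) = vG x y)
    (hpos : ∀ a : V → ℝ, 0 ≤ ∑ x, ∑ y, θ.interaction vG x y * a x * a y)
    {J : Type*} [Fintype J] (γ : J → ℝ) (sh : J → (V → Fin N → ℕ) → V → Fin N → ℕ)
    (hsh : ∀ j k k', (∀ x, θ.half x → k x = k' x) → ∀ x, θ.half x → sh j k x = sh j k' x)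
    (wt : J → (E → Fin N → ℕ) → ℝ)
    (hwt : ∀ j q q', (∀ e, θ.meets e → q e = q' e) → wt j q = wt j q')
    (hsum : ∀ j j', Summable fun q : E → Fin N → ℕ => linkWeight lam q *
      (vertexWeight U vG (θ.combine (sh j (degree inc q))
        (sh j' (fun x => degree inc q (θ.onV x)))) * (wt j q * wt j' (fun e => q (θ.onE e))))) :
    0 ≤ ∑ j, ∑ j', γ j * γ j' * ∑' q : E → Fin N → ℕ, linkWeight lam q *
      (vertexWeight U vG (θ.combine (sh j (degree inc q))
        (sh j' (fun x => degree inc q (θ.onV x)))) * (wt j q * wt j' (fun e => q (θ.onE e)))) := by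
  have hsum' : ∀ j j', Summable fun q : E → Fin N → ℕ => γ j * γ j' * (linkWeight lam q *
      (vertexWeight U vG (θ.combine (sh j (degree inc q))
        (sh j' (fun x => degree inc q (θ.onV x)))) * (wt j q * wt j' (fun e => q (θ.onE e))))) :=
    fun j j' => (hsum j j').mul_left _
  simp_rw [← tsum_mul_left]
  have hex : ∀ j, ∑ j', ∑' q : E → Fin N → ℕ, γ j * γ j' * (linkWeight lam q *
      (vertexWeight U vG (θ.combine (sh j (degree inc q))
        (sh j' (fun x => degree inc q (θ.onV x)))) * (wt j q * wt j' (fun e => q (θ.onE e))))) =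
      ∑' q : E → Fin N → ℕ, ∑ j', γ j * γ j' * (linkWeight lam q *
      (vertexWeight U vG (θ.combine (sh j (degree inc q))
        (sh j' (fun x => degree inc q (θ.onV x)))) * (wt j q * wt j' (fun e => q (θ.onE e))))) :=
    fun j => (Summable.tsum_finsetSum fun j' _ => hsum' j j').symm
  simp_rw [hex]
  rw [← Summable.tsum_finsetSum fun j _ => summable_sum fun j' _ => hsum' j j']
  -- the two halves
  let P := {p : E → Fin N → ℕ // ∀ e, ¬ θ.meets e → p e = 0}
  let l : (E → Fin N → ℕ) → P := θ.restrict
  let r : (E → Fin N → ℕ) → P := fun q => θ.restrict fun e => q (θ.onE e)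
  let c : P → E → Fin N → ℕ := fun p e => if θ.cross e then p.1 e else 0
  let ℓ : P × J → V → ℝ := fun a x => (((∑ i, sh a.2 (degree inc a.1.1) x i) / 2 : ℕ) : ℝ)
  let f : P × J → ℝ := fun a => γ a.2 * θ.halfLinkWeight lam a.1.1 * wt a.2 a.1.1 *
    θ.halfWeight U vG (sh a.2 (degree inc a.1.1))
  let F : P → P → ℝ := fun p p' => ∑ j, ∑ j', f (p, j) * f (p', j') *
    Real.exp (∑ x, ∑ y, θ.interaction vG x y * ℓ (p, j) x * ℓ (p', j') y)
  -- The summand depends on q only through its two restrictions: moves and their weights see one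
  -- half each, and the halves are coupled by the interaction alone.
  have hF : ∀ q, F (l q) (r q) = ∑ j, ∑ j', γ j * γ j' * (linkWeight lam q *
      (vertexWeight U vG (θ.combine (sh j (degree inc q))
        (sh j' (fun x => degree inc q (θ.onV x)))) * (wt j q * wt j' (fun e => q (θ.onE e))))) := by
    intro q
    refine Finset.sum_congr rfl fun j _ => Finset.sum_congr rfl fun j' _ => ?_
    set K := θ.combine (sh j (degree inc q)) (sh j' (fun x => degree inc q (θ.onV x))) with hK
    have d1 : ∀ x, θ.half x → degree inc (l q).1 x = degree inc q x :=
      fun x hx => θ.degree_restrict q hx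
    have d2 : ∀ x, θ.half x → degree inc (r q).1 x = degree inc q (θ.onV x) := fun x hx => by
      rw [← θ.degree_onE]; exact θ.degree_restrict _ hx
    have s1 : ∀ x, θ.half x → sh j (degree inc (l q).1) x = K x := fun x hx => by
      rw [hsh j _ _ d1 x hx, hK, combine, if_pos hx]
    have s2 : ∀ x, θ.half x → sh j' (degree inc (r q).1) x = K (θ.onV x) := fun x hx => by
      rw [hsh j' _ (fun x => degree inc q (θ.onV x)) d2 x hx, hK, combine,
        if_neg (by rw [θ.half_iff]; exact not_not.mpr hx), θ.onV_onV]
    have w1 : wt j (l q).1 = wt j q := hwt j _ _ fun e he => if_pos he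
    have w2 : wt j' (r q).1 = wt j' (fun e => q (θ.onE e)) := hwt j' _ _ fun e he => if_pos he
    rw [θ.vertexWeight_split U vG hv hθ K, ← θ.linkWeight_split hlam q]
    simp only [f, w1, w2]
    rw [θ.halfWeight_congr U vG s1, θ.halfWeight_congr U vG s2]
    have h5 : ∑ x, ∑ y, θ.interaction vG x y * ℓ (l q, j) x * ℓ (r q, j') y =
        ∑ x, ∑ y, θ.interaction vG x y * (((∑ i, K x i) / 2 : ℕ) : ℝ) *
          (((∑ i, K (θ.onV y) i) / 2 : ℕ) : ℝ) := by
      refine Finset.sum_congr rfl fun x _ => Finset.sum_congr rfl fun y _ => ?_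
      by_cases h : θ.half x ∧ θ.half y
      · simp only [ℓ]
        rw [s1 x h.1, s2 y h.2]
      · simp [interaction, h]
    rw [h5]
    ring
  -- Two half-configurations can be glued exactly when they agree on the crossing edges, which is
  -- what c records.
  have hgoal : 0 ≤ ∑' q, F (l q) (r q) := by
    refine tsum_nonneg_of_glue l r ?_ c ?_ ?_ F ?_ ?_
    · intro q q' h1 h2
      funext e
      by_cases he : θ.meets e
      · have := congrFun (congrArg Subtype.val h1) e
        simpa only [l, restrict, if_pos he] using this
      · have := congrFun (congrArg Subtype.val h2) (θ.onE e)
        simpa only [r, restrict, if_pos (θ.meets_onE_of_not he), θ.onE_onE] using this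
    · intro q
      funext e
      simp only [c, l, r, restrict]
      split_ifs with h1 h2
      · rw [θ.onE_of_cross h1]
      · rfl
      · rfl
    · intro p p' hp
      refine ⟨fun e => if θ.meets e then p.1 e else p'.1 (θ.onE e), ?_, ?_⟩
      · apply Subtype.ext
        funext e
        by_cases he : θ.meets e
        · simp [l, restrict, he]
        · simp [l, restrict, he, p.2 e he]
      · apply Subtype.ext
        funext e
        by_cases he : θ.meets e
        · by_cases he' : θ.meets (θ.onE e)
          · have hc : θ.cross e := ⟨he, he'⟩
            have := congrFun hp e
            simp only [c, if_pos hc] at this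
            simp [r, restrict, he, θ.onE_of_cross hc, this]
          · simp [r, restrict, he, he', θ.onE_onE]
        · simp [r, restrict, he, p'.2 e he]
    · intro S
      have h6 := sum_exp_form_nonneg_of_eq (θ.interaction vG) (fun x y => by
          unfold interaction
          have h : vG x (θ.onV y) = vG y (θ.onV x) := by
            rw [← hθ, θ.onV_onV, hv]
          by_cases hx : θ.half x <;> by_cases hy : θ.half y <;> simp [hx, hy, h]) hpos
        (fun a : S × J => ℓ (a.1.1, a.2)) (fun a => f (a.1.1, a.2)) (fun a => c a.1.1)
      refine h6.trans_eq ?_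
      rw [← Finset.sum_coe_sort S, Fintype.sum_prod_type]
      refine Finset.sum_congr rfl fun p _ => ?_
      rw [← Finset.sum_coe_sort S]
      simp only [Fintype.sum_prod_type]
      rw [Finset.sum_comm]
      refine Finset.sum_congr rfl fun p' _ => ?_
      by_cases h : c p.1 = c p'.1
      · simp only [h, if_true, F]
      · simp [h]
    · simp_rw [hF]
      exact summable_sum fun j _ => summable_sum fun j' _ => hsum' j j'
  simpa only [hF] using hgoal

end Reflection
end

/-! ### Moments of the model with link numbers -/

section
open scoped Classical

variable {V E : Type*} [Fintype V] [Fintype E] {N : ℕ}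

/-- One insertion at the vertex `x`, in each of the first two colours. -/
def insertion (N : ℕ) (x : V) : V → Fin N → ℕ := fun z i => inserted (if z = x then 1 else 0) i

/-- The moments of the model with link numbers: the sum of `ψ` with insertions `r`. -/
def moment (inc : V → E → Prop) (lam : ℝ) (U : ℕ → ℝ) (vG : V → V → ℝ) (r : V → Fin N → ℕ)
    (ψ : (E → Fin N → ℕ) → ℝ) : ℝ :=
  ∑' q : E → Fin N → ℕ, linkWeight lam q * (vertexWeight U vG (degree inc q + r) * ψ q)

lemma vertexWeight_comp (U : ℕ → ℝ) (vG : V → V → ℝ) (σ : V ≃ V)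
    (hσ : ∀ x y, vG (σ x) (σ y) = vG x y) (k : V → Fin N → ℕ) :
    vertexWeight U vG (fun x => k (σ x)) = vertexWeight U vG k := by
  unfold vertexWeight
  rw [← σ.prod_comp (fun x => ∏ i, (matchings (k x i) : ℝ)),
    ← σ.prod_comp (fun x => U ((∑ i, k x i) / 2)),
    ← σ.sum_comp (fun x => ∑ y, vG x y * (((∑ i, k x i) / 2 : ℕ) : ℝ) *
      (((∑ i, k y i) / 2 : ℕ) : ℝ))]
  congr 3
  refine Finset.sum_congr rfl fun x _ => ?_
  rw [← σ.sum_comp (fun y => vG (σ x) y * (((∑ i, k (σ x) i) / 2 : ℕ) : ℝ) *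
      (((∑ i, k y i) / 2 : ℕ) : ℝ))]
  simp_rw [hσ]

lemma vertexWeight_colour (U : ℕ → ℝ) (vG : V → V → ℝ) (π : Fin N ≃ Fin N) (k : V → Fin N → ℕ) :
    vertexWeight U vG (fun x i => k x (π i)) = vertexWeight U vG k := by
  unfold vertexWeight
  have h1 : ∀ x, ∑ i, k x (π i) = ∑ i, k x i := fun x => π.sum_comp (k x)
  have h2 : ∀ x, ∏ i, (matchings (k x (π i)) : ℝ) = ∏ i, (matchings (k x i) : ℝ) :=
    fun x => π.prod_comp fun i => (matchings (k x i) : ℝ)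
  simp_rw [h1, h2]

lemma moment_comp (inc : V → E → Prop) (lam : ℝ) (U : ℕ → ℝ) (vG : V → V → ℝ) (σ : V ≃ V)
    (τ : E ≃ E) (hinc : ∀ x e, inc (σ x) (τ e) ↔ inc x e) (hσ : ∀ x y, vG (σ x) (σ y) = vG x y)
    (r : V → Fin N → ℕ) (ψ : (E → Fin N → ℕ) → ℝ) :
    moment inc lam U vG (fun x => r (σ x)) ψ =
      moment inc lam U vG r (fun q => ψ (fun e => q (τ e))) := by
  unfold moment
  rw [← (Equiv.arrowCongr τ.symm (Equiv.refl (Fin N → ℕ))).tsum_eq]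
  refine tsum_congr fun q => ?_
  have h0 : (Equiv.arrowCongr τ.symm (Equiv.refl (Fin N → ℕ))) q = fun e => q (τ e) := rfl
  rw [h0]
  have h1 : linkWeight lam (fun e => q (τ e)) = linkWeight lam q :=
    τ.prod_comp fun e => ∏ i, lam ^ q e i / ((q e i).factorial : ℝ)
  have h2 : degree inc (fun e => q (τ e)) + (fun x => r (σ x)) =
      fun x => (degree inc q + r) (σ x) := by
    funext x i
    simp only [Pi.add_apply]
    congr 1
    unfold degree
    rw [← τ.sum_comp (fun e => if inc (σ x) e then q e i else 0)]
    simp_rw [hinc]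
  rw [h1, h2, vertexWeight_comp U vG σ hσ]

lemma moment_colour (inc : V → E → Prop) (lam : ℝ) (U : ℕ → ℝ) (vG : V → V → ℝ)
    (π : Fin N ≃ Fin N) (r : V → Fin N → ℕ) (ψ : (E → Fin N → ℕ) → ℝ) :
    moment inc lam U vG (fun x i => r x (π i)) ψ =
      moment inc lam U vG r (fun q => ψ (fun e i => q e (π i))) := by
  unfold moment
  rw [← (Equiv.arrowCongr (Equiv.refl E) (Equiv.arrowCongr π.symm (Equiv.refl ℕ))).tsum_eq]
  refine tsum_congr fun q => ?_
  have h0 : (Equiv.arrowCongr (Equiv.refl E) (Equiv.arrowCongr π.symm (Equiv.refl ℕ))) q =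
    fun e i => q e (π i) := rfl
  rw [h0]
  have h1 : linkWeight lam (fun e i => q e (π i)) = linkWeight lam q :=
    Finset.prod_congr rfl fun e _ => π.prod_comp fun i => lam ^ q e i / ((q e i).factorial : ℝ)
  have h2 : degree inc (fun e i => q e (π i)) + (fun x i => r x (π i)) =
      fun x i => (degree inc q + r) x (π i) := rfl
  rw [h1, h2, vertexWeight_colour]

/-- The shift identity is used once for each colour; as the colours differ, the first shift leaves
the other count unchanged. -/
lemma tsum_linkWeight_mul_counts (lam : ℝ) (e : E) {i j : Fin N} (hij : i ≠ j)
    (H : (E → Fin N → ℕ) → ℝ) :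
    ∑' q, linkWeight lam q * (H q * ((q e i : ℝ) * (q e j : ℝ))) =
      lam ^ 2 * ∑' q, linkWeight lam q * H (q + oneLink e j + oneLink e i) := by
  have h1 : ∀ q : E → Fin N → ℕ, linkWeight lam q * (H q * ((q e i : ℝ) * (q e j : ℝ))) =
      linkWeight lam q * ((q e i : ℝ) * (H q * (q e j : ℝ))) := fun q => by ring
  simp_rw [h1]
  rw [tsum_linkWeight_mul_count e i (fun q => H q * (q e j : ℝ))]
  have h2 : ∀ q : E → Fin N → ℕ, linkWeight lam q *
      (H (q + oneLink e i) * (((q + oneLink e i) e j : ℕ) : ℝ)) =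
      linkWeight lam q * ((q e j : ℝ) * H (q + oneLink e i)) := fun q => by
    have : (q + oneLink e i) e j = q e j := by simp [oneLink, hij.symm]
    rw [this]
    ring
  simp_rw [h2]
  rw [tsum_linkWeight_mul_count e j (fun q => H (q + oneLink e i))]
  ring

/-- This is the exchange between links and insertions: one link of each of the first two colours has
the same ends as one insertion at either endpoint. -/
lemma degree_add_two_links (inc : V → E → Prop) {e : E} {y y' : V} (hy : y ≠ y')
    (he : ∀ x, inc x e ↔ x = y ∨ x = y') {c₀ c₁ : Fin N} (h₀ : (c₀ : ℕ) = 0) (h₁ : (c₁ : ℕ) = 1)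
    (q : E → Fin N → ℕ) :
    degree inc (q + oneLink e c₁ + oneLink e c₀) =
      degree inc q + insertion N y + insertion N y' := by
  rw [degree_add, degree_add]
  funext x i
  simp only [Pi.add_apply, degree_oneLink, he, insertion]
  have hi0 : i = c₀ ↔ (i : ℕ) = 0 := by rw [Fin.ext_iff, h₀]
  have hi1 : i = c₁ ↔ (i : ℕ) = 1 := by rw [Fin.ext_iff, h₁]
  simp only [hi0, hi1]
  unfold inserted
  by_cases h1 : x = y
  · subst h1
    by_cases h2 : (i : ℕ) < 2
    · rcases Nat.lt_succ_iff_lt_or_eq.mp h2 with h3 | h3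
      · have : (i : ℕ) = 0 := by omega
        simp [this, hy]
      · simp [h3, hy]
    · have h3 : (i : ℕ) ≠ 0 := by omega
      have h4 : (i : ℕ) ≠ 1 := by omega
      simp [h2, h3, h4]
  · by_cases h1' : x = y'
    · subst h1'
      by_cases h2 : (i : ℕ) < 2
      · rcases Nat.lt_succ_iff_lt_or_eq.mp h2 with h3 | h3
        · have : (i : ℕ) = 0 := by omega
          simp [this, h1]
        · simp [h3, h1]
      · have h3 : (i : ℕ) ≠ 0 := by omega
        have h4 : (i : ℕ) ≠ 1 := by omega
        simp [h2, h3, h4]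
    · simp [h1, h1']

end

/-! ### The moments as averages over configurations -/

section
open scoped Classical

variable {V : Type*} [Fintype V] {G : SimpleGraph V} {N : ℕ} {lam : ℝ} {U : ℕ → ℝ}
  {vG : V → V → ℝ}

lemma summable_moment {E : Type*} [Fintype E] (inc : V → E → Prop) (hlam : 0 ≤ lam)
    (hU : ∀ n, 0 ≤ U n) (hb : ExpBounded N U vG) (r : V → Fin N → ℕ)
    (ψ : (E → Fin N → ℕ) → ℝ) (hψ0 : ∀ q, 0 ≤ ψ q) (R : ℝ) (hψ : ∀ q, ψ q ≤ R ^ totalLinks q) :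
    Summable fun q : E → Fin N → ℕ =>
      linkWeight lam q * (vertexWeight U vG (degree inc q + r) * ψ q) := by
  refine summable_of_expBounded hlam hU hb _ (∑ x, ∑ i, r x i) (Fintype.card V) (fun q => ?_) ψ hψ0
    1 R (fun q => by rw [one_mul]; exact hψ q)
  simp only [Pi.add_apply, Finset.sum_add_distrib]
  have := sum_degree_le inc q
  omega

lemma summable_moment_one {E : Type*} [Fintype E] (inc : V → E → Prop) (hlam : 0 ≤ lam)
    (hU : ∀ n, 0 ≤ U n) (hb : ExpBounded N U vG) (r : V → Fin N → ℕ) :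
    Summable fun q : E → Fin N → ℕ =>
      linkWeight lam q * (vertexWeight U vG (degree inc q + r) * 1) :=
  summable_moment inc hlam hU hb r (fun _ => 1) (fun _ => zero_le_one) 1 fun q => by simp

lemma count_le_two_pow {E : Type*} [Fintype E] (q : E → Fin N → ℕ) (e : E) (i : Fin N) :
    (q e i : ℝ) ≤ 2 ^ totalLinks q := by
  have h1 : q e i ≤ 2 ^ totalLinks q :=
    (le_totalLinks q e i).trans (Nat.lt_two_pow_self).le
  exact_mod_cast h1

lemma summable_moment_count {E : Type*} [Fintype E] (inc : V → E → Prop) (hlam : 0 ≤ lam)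
    (hU : ∀ n, 0 ≤ U n) (hb : ExpBounded N U vG) (r : V → Fin N → ℕ) (e : E) (i : Fin N) :
    Summable fun q : E → Fin N → ℕ =>
      linkWeight lam q * (vertexWeight U vG (degree inc q + r) * (q e i : ℝ)) :=
  summable_moment inc hlam hU hb r (fun q => (q e i : ℝ)) (fun _ => Nat.cast_nonneg _) 2
    fun q => count_le_two_pow q e i

variable (hN : 2 ≤ N) (hlam : 0 ≤ lam) (hU : ∀ n, 0 ≤ U n) (hb : ExpBounded N U vG)
include hN hlam hU hb

lemma hasSum_closedInd : HasSum (fun w : Config G N => w.weight lam U vG * closedInd w)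
    (moment (N := N) (incident G) lam U vG 0 fun _ => 1) := by
  have h := hasSum_config (G := G) hN hlam hU vG (r := 0) (fun x => Nat.zero_le 2) (fun _ => 1)
    (fun _ => zero_le_one) (a := moment (N := N) (incident G) lam U vG 0 fun _ => 1) ?_
  · simpa only [mul_one, closedInd_eq] using h
  · have h0 : ∀ q : G.edgeSet → Fin N → ℕ, (fun x i => degree (incident G) q x i +
        inserted ((0 : V → ℕ) x) i) = degree (incident G) q + 0 := fun q => by
      funext x i; simp [inserted]
    simp_rw [h0]
    exact (summable_moment_one (incident G) hlam hU hb 0).hasSum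

lemma hasSum_closedInd_count (e : G.edgeSet) (i : Fin N) :
    HasSum (fun w : Config G N => w.weight lam U vG * (closedInd w * (w.linkCount e i : ℝ)))
      (moment (N := N) (incident G) lam U vG 0 fun q => (q e i : ℝ)) := by
  have h := hasSum_config (G := G) hN hlam hU vG (r := 0) (fun x => Nat.zero_le 2)
    (fun q => (q e i : ℝ)) (fun _ => Nat.cast_nonneg _)
    (a := moment (N := N) (incident G) lam U vG 0 fun q => (q e i : ℝ)) ?_
  · simpa only [closedInd_eq, linkCount_eq] using h
  · have h0 : ∀ q : G.edgeSet → Fin N → ℕ, (fun x i => degree (incident G) q x i +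
        inserted ((0 : V → ℕ) x) i) = degree (incident G) q + 0 := fun q => by
      funext x i; simp [inserted]
    simp_rw [h0]
    exact (summable_moment_count (incident G) hlam hU hb 0 e i).hasSum

lemma hasSum_directedFun (x y : V) :
    HasSum (fun w : Config G N => w.weight lam U vG * directedFun x y w)
      (moment (incident G) lam U vG (insertion N x + insertion N y) fun _ => 1) := by
  have h := hasSum_config (G := G) hN hlam hU vG (r := pairInsertion x y) (pairInsertion_le x y)
    (fun _ => 1) (fun _ => zero_le_one)
    (a := moment (incident G) lam U vG (insertion N x + insertion N y) fun _ => 1) ?_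
  · simpa only [mul_one, directedFun_eq] using h
  · have h0 : ∀ q : G.edgeSet → Fin N → ℕ, (fun z i => degree (incident G) q z i +
        inserted (pairInsertion x y z) i) =
        degree (incident G) q + (insertion N x + insertion N y) := fun q => by
      funext z i
      simp only [Pi.add_apply, insertion, pairInsertion, inserted]
      split_ifs <;> simp
    simp_rw [h0]
    exact (summable_moment_one (incident G) hlam hU hb _).hasSum

lemma Zloop_eq : Zloop G N lam U vG = moment (N := N) (incident G) lam U vG 0 fun _ => 1 :=
  (hasSum_closedInd hN hlam hU hb).tsum_eq

lemma Zdir_eq (x y : V) : Zdir G N lam U vG x y =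
    moment (incident G) lam U vG (insertion N x + insertion N y) fun _ => 1 :=
  (hasSum_directedFun hN hlam hU hb x y).tsum_eq

lemma avg_count_eq (e : G.edgeSet) (i : Fin N) :
    avg G N lam U vG (fun w => closedInd w * (w.linkCount e i : ℝ)) =
      moment (N := N) (incident G) lam U vG 0 fun q => (q e i : ℝ) :=
  (hasSum_closedInd_count hN hlam hU hb e i).tsum_eq

end

/-! ### Reflection positivity for the two-point function -/

section
open scoped Classical

variable {V : Type*} [Fintype V] {G : SimpleGraph V} {N : ℕ} {lam : ℝ} {U : ℕ → ℝ}
  {vG : V → V → ℝ}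

namespace Reflection
variable (θ : Reflection (incident G))

/-- The vertices of the half with a neighbour outside the half. -/
abbrev Boundary : Type _ := {x : V // θ.half x ∧ G.Adj x (θ.onV x)}

/-- The edge between a boundary vertex and its reflection. -/
def edge (x : θ.Boundary) : G.edgeSet := ⟨s(x.1, θ.onV x.1), x.2.2⟩

lemma incident_edge (x : θ.Boundary) (z : V) :
    incident G z (θ.edge x) ↔ z = x.1 ∨ z = θ.onV x.1 := Sym2.mem_iff

lemma not_half_onV {x : V} (hx : θ.half x) : ¬ θ.half (θ.onV x) := by
  rw [θ.half_iff]
  exact not_not.mpr hx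

lemma ne_onV {x y : V} (hx : θ.half x) (hy : θ.half y) : x ≠ θ.onV y := fun h =>
  θ.not_half_onV hy (h ▸ hx)

lemma onE_edge (x : θ.Boundary) : θ.onE (θ.edge x) = θ.edge x :=
  θ.crossing _ x.1 (θ.onV x.1) x.2.1 (θ.not_half_onV x.2.1)
    ((θ.incident_edge x _).mpr (Or.inl rfl)) ((θ.incident_edge x _).mpr (Or.inr rfl))

lemma meets_edge (x : θ.Boundary) : θ.meets (θ.edge x) :=
  ⟨x.1, x.2.1, (θ.incident_edge x _).mpr (Or.inl rfl)⟩

lemma edge_injective {x y : θ.Boundary} (h : θ.edge x = θ.edge y) : x = y := by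
  have h1 : incident G x.1 (θ.edge y) := h ▸ (θ.incident_edge x _).mpr (Or.inl rfl)
  rcases (θ.incident_edge y _).mp h1 with h2 | h2
  · exact Subtype.ext h2
  · exact absurd h2 (θ.ne_onV x.2.1 y.2.1)

/-- An insertion at a vertex of the half, or the removal of one link of each of the first two
colours on an edge between the halves, on one side. -/
abbrev Move : Type _ := {x : V // θ.half x} ⊕ θ.Boundary

/-- The effect of a move on the numbers of link ends. -/
def shift (j : θ.Move) (k : V → Fin N → ℕ) : V → Fin N → ℕ :=
  Sum.elim (fun x => k + insertion N x.1) (fun x => k - insertion N x.1) j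

/-- The number of choices of a move, where `c₀` and `c₁` are the first two colours. -/
def choices (c₀ c₁ : Fin N) (j : θ.Move) (q : G.edgeSet → Fin N → ℕ) : ℝ :=
  Sum.elim (fun _ => 1) (fun x => (q (θ.edge x) c₀ : ℝ) * (q (θ.edge x) c₁ : ℝ)) j

lemma shift_le (j : θ.Move) (k : V → Fin N → ℕ) (x : V) (i : Fin N) :
    θ.shift j k x i ≤ k x i + 1 := by
  have : ∀ y, insertion N y x i ≤ 1 := fun y => by
    unfold insertion inserted
    split_ifs <;> simp
  rcases j with y | y
  · simpa [shift] using this y.1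
  · simp only [shift, Sum.elim_inr, Pi.sub_apply]
    omega

lemma choices_nonneg (c₀ c₁ : Fin N) (j : θ.Move) (q : G.edgeSet → Fin N → ℕ) :
    0 ≤ θ.choices c₀ c₁ j q := by
  rcases j with y | y <;> simp only [choices, Sum.elim_inl, Sum.elim_inr] <;> positivity

lemma choices_le (c₀ c₁ : Fin N) (j : θ.Move) (q : G.edgeSet → Fin N → ℕ) :
    θ.choices c₀ c₁ j q ≤ 4 ^ totalLinks q := by
  rcases j with y | y
  · exact one_le_pow₀ (by norm_num)
  · have h : (4 : ℝ) ^ totalLinks q = 2 ^ totalLinks q * 2 ^ totalLinks q := by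
      rw [← mul_pow]; norm_num
    rw [h]
    exact mul_le_mul (count_le_two_pow q _ _) (count_le_two_pow q _ _) (by positivity)
      (by positivity)

lemma choices_onE (c₀ c₁ : Fin N) (j : θ.Move) (q : G.edgeSet → Fin N → ℕ) :
    θ.choices c₀ c₁ j (fun e => q (θ.onE e)) = θ.choices c₀ c₁ j q := by
  rcases j with y | y
  · rfl
  · simp only [choices, Sum.elim_inr, θ.onE_edge]

lemma insertion_onV (y x : V) (i : Fin N) :
    insertion N y (θ.onV x) i = insertion N (θ.onV y) x i := by
  have : θ.onV x = y ↔ x = θ.onV y :=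
    ⟨fun h => by rw [← h, θ.onV_onV], fun h => by rw [h, θ.onV_onV]⟩
  simp only [insertion, this]

lemma insertion_eq_zero {x y : V} (h : x ≠ y) (i : Fin N) : insertion N y x i = 0 := by
  simp [insertion, h, inserted]

/-- The joint effect of two moves, the second one being reflected. -/
lemma combine_shift (j j' : θ.Move) (k : V → Fin N → ℕ) :
    θ.combine (θ.shift j k) (θ.shift j' fun x => k (θ.onV x)) =
      match j, j' with
      | .inl x, .inl y => k + (insertion N x.1 + insertion N (θ.onV y.1))
      | .inl x, .inr y => k + insertion N x.1 - insertion N (θ.onV y.1)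
      | .inr x, .inl y => k + insertion N (θ.onV y.1) - insertion N x.1
      | .inr x, .inr y => k - insertion N x.1 - insertion N (θ.onV y.1) := by
  funext z i
  by_cases hz : θ.half z
  · have h2 : ∀ y, θ.half y → insertion N (θ.onV y) z i = 0 := fun y hy =>
      insertion_eq_zero (θ.ne_onV hz hy) i
    rcases j with x | x <;> rcases j' with y | y <;>
      simp [combine, hz, shift, h2 y.1, y.2]
  · have h2 : ∀ x, θ.half x → insertion N x z i = 0 := fun x hx =>
      insertion_eq_zero (fun h : z = x => hz (h ▸ hx)) i
    rcases j with x | x <;> rcases j' with y | y <;>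
      simp [combine, hz, shift, h2 x.1, x.2, θ.onV_onV, θ.insertion_onV]

variable (lam U vG) in
/-- The correlation of two moves, the second one being reflected. -/
def corr (c₀ c₁ : Fin N) (j j' : θ.Move) : ℝ :=
  ∑' q : G.edgeSet → Fin N → ℕ, linkWeight lam q *
    (vertexWeight U vG (θ.combine (θ.shift j (degree (incident G) q))
      (θ.shift j' (fun x => degree (incident G) q (θ.onV x)))) *
      (θ.choices c₀ c₁ j q * θ.choices c₀ c₁ j' (fun e => q (θ.onE e))))

theorem sum_corr_nonneg (hlam : 0 ≤ lam) (hU : ∀ n, 0 ≤ U n) (hb : ExpBounded N U vG)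
    (hv : ∀ x y, vG x y = vG y x) (hθ : ∀ x y, vG (θ.onV x) (θ.onV y) = vG x y)
    (hpos : ∀ a : V → ℝ, 0 ≤ ∑ x, ∑ y, θ.interaction vG x y * a x * a y)
    (c₀ c₁ : Fin N) (γ : θ.Move → ℝ) :
    0 ≤ ∑ j, ∑ j', γ j * γ j' * θ.corr lam U vG c₀ c₁ j j' := by
  refine θ.sum_nonneg hlam U vG hv hθ hpos γ θ.shift ?_ (θ.choices c₀ c₁) ?_ ?_
  · intro j k k' h x hx
    rcases j with y | y <;> funext i <;> simp [shift, h x hx]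
  · intro j q q' h
    rcases j with y | y
    · rfl
    · simp only [choices, Sum.elim_inr, h _ (θ.meets_edge y)]
  · intro j j'
    -- Moves add at most one end for each vertex and colour. Each of the two choice factors is at
    -- most 4 ^ `totalLinks`, being 1 or a product of two link numbers; hence the rate 16.
    refine summable_of_expBounded hlam hU hb _ (Fintype.card V * N) (Fintype.card V)
      (fun q => ?_) _ (fun q => mul_nonneg (θ.choices_nonneg _ _ _ _) (θ.choices_nonneg _ _ _ _))
      1 16 fun q => ?_
    · have h1 : ∀ x i, θ.combine (θ.shift j (degree (incident G) q))
          (θ.shift j' (fun x => degree (incident G) q (θ.onV x))) x i ≤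
          degree (incident G) q x i + 1 := by
        intro x i
        unfold combine
        split_ifs with hx
        · exact θ.shift_le j _ x i
        · refine (θ.shift_le j' _ _ i).trans_eq ?_
          rw [θ.onV_onV]
      refine (Finset.sum_le_sum fun x _ => Finset.sum_le_sum fun i _ => h1 x i).trans ?_
      simp only [Finset.sum_add_distrib]
      have := sum_degree_le (incident G) q
      simp only [Finset.sum_const, Finset.card_univ, Fintype.card_fin, smul_eq_mul, mul_one]
      omega
    · have h : (1 : ℝ) * 16 ^ totalLinks q = 4 ^ totalLinks q * 4 ^ totalLinks q := by
        rw [one_mul, ← mul_pow]; norm_num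
      rw [h, choices_onE]
      exact mul_le_mul (θ.choices_le _ _ _ _) (θ.choices_le _ _ _ _) (θ.choices_nonneg _ _ _ _)
        (by positivity)

variable {c₀ c₁ : Fin N} (h₀ : (c₀ : ℕ) = 0) (h₁ : (c₁ : ℕ) = 1)

lemma corr_inl_inl (x y : {x : V // θ.half x}) :
    θ.corr lam U vG c₀ c₁ (.inl x) (.inl y) =
      moment (incident G) lam U vG (insertion N x.1 + insertion N (θ.onV y.1)) fun _ => 1 := by
  unfold corr moment
  simp_rw [combine_shift, choices_onE]
  simp [choices]

include h₀ h₁ in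
lemma degree_add_edge (x : θ.Boundary) (q : G.edgeSet → Fin N → ℕ) :
    degree (incident G) (q + oneLink (θ.edge x) c₁ + oneLink (θ.edge x) c₀) =
      degree (incident G) q + insertion N x.1 + insertion N (θ.onV x.1) :=
  degree_add_two_links _ (θ.ne_onV x.2.1 x.2.1) (θ.incident_edge x) h₀ h₁ q

include h₀ h₁ in
-- The shift identity puts a pair of links on the edge from y to its mirror image, thus ends at
-- both. The ends at the mirror image are removed by the move, and those at y remain as an
-- insertion.
lemma corr_inl_inr (x : {x : V // θ.half x}) (y : θ.Boundary) :
    θ.corr lam U vG c₀ c₁ (.inl x) (.inr y) = lam ^ 2 *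
      moment (incident G) lam U vG (insertion N x.1 + insertion N y.1) fun _ => 1 := by
  have h01 : c₀ ≠ c₁ := fun h => by simp [h, h₁] at h₀
  unfold corr moment
  simp_rw [combine_shift, choices_onE]
  simp only [choices, Sum.elim_inl, Sum.elim_inr, one_mul]
  rw [tsum_linkWeight_mul_counts lam (θ.edge y) h01]
  simp_rw [θ.degree_add_edge h₀ h₁, mul_one]
  refine congrArg _ (tsum_congr fun q => ?_)
  -- The removed ends are present after the shift, so the truncated subtraction cancels exactly.
  congr 2
  funext z i
  simp only [Pi.add_apply, Pi.sub_apply]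
  omega

include h₀ h₁ in
lemma corr_inr_inl (x : θ.Boundary) (y : {x : V // θ.half x}) :
    θ.corr lam U vG c₀ c₁ (.inr x) (.inl y) = lam ^ 2 *
      moment (incident G) lam U vG (insertion N (θ.onV x.1) + insertion N (θ.onV y.1))
        fun _ => 1 := by
  have h01 : c₀ ≠ c₁ := fun h => by simp [h, h₁] at h₀
  unfold corr moment
  simp_rw [combine_shift, choices_onE]
  simp only [choices, Sum.elim_inl, Sum.elim_inr, mul_one]
  rw [tsum_linkWeight_mul_counts lam (θ.edge x) h01]
  simp_rw [θ.degree_add_edge h₀ h₁]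
  refine congrArg _ (tsum_congr fun q => ?_)
  congr 2
  funext z i
  simp only [Pi.add_apply, Pi.sub_apply]
  omega

include h₀ h₁ in
-- Distinct boundary vertices have distinct edges, so the two shifts do not interfere; each gives λ²
-- and leaves an insertion at the opposite end.
lemma corr_inr_inr_of_ne {x y : θ.Boundary} (hxy : x ≠ y) :
    θ.corr lam U vG c₀ c₁ (.inr x) (.inr y) = lam ^ 4 *
      moment (incident G) lam U vG (insertion N (θ.onV x.1) + insertion N y.1) fun _ => 1 := by
  have h01 : c₀ ≠ c₁ := fun h => by simp [h, h₁] at h₀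
  have he : θ.edge y ≠ θ.edge x := fun h => hxy (θ.edge_injective h).symm
  unfold corr moment
  simp_rw [combine_shift, choices_onE]
  simp only [choices, Sum.elim_inr, mul_one]
  have h2 := tsum_linkWeight_mul_counts lam (θ.edge x) h01 (fun q => vertexWeight U vG
    (degree (incident G) q - insertion N x.1 - insertion N (θ.onV y.1)) *
      ((q (θ.edge y) c₀ : ℝ) * (q (θ.edge y) c₁ : ℝ)))
  refine (tsum_congr fun q => by ring).trans (h2.trans ?_)
  have h3 : ∀ (q : G.edgeSet → Fin N → ℕ) i,
      (q + oneLink (θ.edge x) c₁ + oneLink (θ.edge x) c₀) (θ.edge y) i = q (θ.edge y) i := by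
    intro q i
    simp [oneLink, he]
  simp_rw [h3]
  rw [tsum_linkWeight_mul_counts lam (θ.edge y) h01
    (fun q => vertexWeight U vG (degree (incident G) (q + oneLink (θ.edge x) c₁ +
      oneLink (θ.edge x) c₀) - insertion N x.1 - insertion N (θ.onV y.1)))]
  simp_rw [θ.degree_add_edge h₀ h₁, ← mul_assoc, ← pow_add]
  refine congrArg _ (tsum_congr fun q => ?_)
  congr 2
  funext z i
  simp only [Pi.add_apply, Pi.sub_apply]
  omega

include h₀ h₁ in
-- Both moves choose links on the same edge, so the weight is (q₀ q₁)². One shift absorbs a factor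
-- q₀ q₁, both removals cancel the added ends, and (q₀+1)(q₁+1) remains. Its term q₀ q₁ is shifted
-- again and gives the directed partition function. The terms 1 + q₀ + q₁ give the extra part, since
-- the two colours have equal means.
lemma corr_inr_inr_self (hlam : 0 ≤ lam) (hU : ∀ n, 0 ≤ U n) (hb : ExpBounded N U vG)
    (x : θ.Boundary) :
    θ.corr lam U vG c₀ c₁ (.inr x) (.inr x) = lam ^ 4 *
      moment (incident G) lam U vG (insertion N (θ.onV x.1) + insertion N x.1) (fun _ => 1) +
      lam ^ 2 * (moment (N := N) (incident G) lam U vG 0 (fun _ => 1) +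
        2 * moment (incident G) lam U vG 0 fun q => (q (θ.edge x) c₀ : ℝ)) := by
  have h01 : c₀ ≠ c₁ := fun h => by simp [h, h₁] at h₀
  have hcol : moment (incident G) lam U vG 0 (fun q => (q (θ.edge x) c₁ : ℝ)) =
      moment (incident G) lam U vG 0 fun q => (q (θ.edge x) c₀ : ℝ) := by
    have := moment_colour (incident G) lam U vG (Equiv.swap c₀ c₁) 0
      (fun q => (q (θ.edge x) c₀ : ℝ))
    simp only [Equiv.swap_apply_left] at this
    exact this.symm
  have hprod : ∑' q : G.edgeSet → Fin N → ℕ, linkWeight lam q *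
      (vertexWeight U vG (degree (incident G) q + 0) *
        ((q (θ.edge x) c₀ : ℝ) * (q (θ.edge x) c₁ : ℝ))) = lam ^ 2 *
      moment (incident G) lam U vG (insertion N (θ.onV x.1) + insertion N x.1) (fun _ => 1) := by
    rw [tsum_linkWeight_mul_counts lam (θ.edge x) h01]
    unfold moment
    simp_rw [θ.degree_add_edge h₀ h₁, mul_one]
    refine congrArg _ (tsum_congr fun q => ?_)
    congr 2
    funext z i
    simp only [Pi.add_apply, Pi.zero_apply]
    omega
  have hs1 := summable_moment_one (N := N) (incident G) hlam hU hb 0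
  have hs2 := summable_moment_count (N := N) (incident G) hlam hU hb 0 (θ.edge x) c₀
  have hs3 := summable_moment_count (N := N) (incident G) hlam hU hb 0 (θ.edge x) c₁
  have hs4 := summable_moment (N := N) (incident G) hlam hU hb 0
    (fun q => (q (θ.edge x) c₀ : ℝ) * (q (θ.edge x) c₁ : ℝ)) (fun q => by positivity) 4
    (fun q => θ.choices_le c₀ c₁ (.inr x) q)
  have hsplit : ∑' q : G.edgeSet → Fin N → ℕ, linkWeight lam q *
      (vertexWeight U vG (degree (incident G) q + 0) *
        (((q (θ.edge x) c₀ : ℝ) + 1) * ((q (θ.edge x) c₁ : ℝ) + 1))) =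
      lam ^ 2 * moment (incident G) lam U vG (insertion N (θ.onV x.1) + insertion N x.1)
        (fun _ => 1) + (moment (N := N) (incident G) lam U vG 0 (fun _ => 1) +
        2 * moment (incident G) lam U vG 0 fun q => (q (θ.edge x) c₀ : ℝ)) := by
    rw [← hprod, two_mul]
    nth_rewrite 2 [← hcol]
    unfold moment
    rw [← hs2.tsum_add hs3, ← hs1.tsum_add (hs2.add hs3), ← hs4.tsum_add (hs1.add (hs2.add hs3))]
    refine tsum_congr fun q => ?_
    ring
  have key : θ.corr lam U vG c₀ c₁ (.inr x) (.inr x) = lam ^ 2 *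
      ∑' q : G.edgeSet → Fin N → ℕ, linkWeight lam q *
      (vertexWeight U vG (degree (incident G) q + 0) *
        (((q (θ.edge x) c₀ : ℝ) + 1) * ((q (θ.edge x) c₁ : ℝ) + 1))) := by
    unfold corr
    simp_rw [combine_shift, choices_onE]
    simp only [choices, Sum.elim_inr]
    have h5 := tsum_linkWeight_mul_counts lam (θ.edge x) h01 (fun q => vertexWeight U vG
      (degree (incident G) q - insertion N x.1 - insertion N (θ.onV x.1)) *
        ((q (θ.edge x) c₀ : ℝ) * (q (θ.edge x) c₁ : ℝ)))
    refine (tsum_congr fun q => by ring).trans (h5.trans ?_)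
    congr 1
    refine tsum_congr fun q => ?_
    rw [θ.degree_add_edge h₀ h₁]
    have h6 : degree (incident G) q + insertion N x.1 + insertion N (θ.onV x.1) -
        insertion N x.1 - insertion N (θ.onV x.1) = degree (incident G) q + 0 := by
      funext z i
      simp only [Pi.add_apply, Pi.sub_apply, Pi.zero_apply]
      omega
    rw [h6]
    simp [oneLink, h01, h01.symm]
  rw [key, hsplit]
  ring

end Reflection
end

/-! ### The quadratic form of the key inequality -/

section
open scoped Classical

variable {V : Type*} [Fintype V] {G : SimpleGraph V}

lemma lap_add (u w : V → ℝ) (x : V) : lap G (u + w) x = lap G u x + lap G w x := by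
  unfold lap
  rw [← Finset.sum_add_distrib]
  refine Finset.sum_congr rfl fun y _ => ?_
  split_ifs
  · simp only [Pi.add_apply]; ring
  · simp

lemma lap_comp (σ : V ≃ V) (hσ : ∀ x y, G.Adj (σ x) (σ y) ↔ G.Adj x y) (u : V → ℝ) (x : V) :
    lap G (fun y => u (σ y)) x = lap G u (σ x) := by
  unfold lap
  rw [← σ.sum_comp (fun y => if G.Adj (σ x) y then u y - u (σ x) else 0)]
  simp_rw [hσ]

variable (G) in
/-- The polarisation of the difference of the two sides of the key inequality, for a two-point
function `K` and conductances `c`. -/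
def keyForm (K : V → V → ℝ) (c : Sym2 V → ℝ) (u w : V → ℝ) : ℝ :=
  ∑ x, ∑ y, K x y * lap G u x * lap G w y -
    (∑ x, ∑ y, if G.Adj x y then c s(x, y) * (u y - u x) * (w y - w x) else 0) / 2

variable {K : V → V → ℝ} {c : Sym2 V → ℝ}

lemma keyForm_add_left (u u' w : V → ℝ) :
    keyForm G K c (u + u') w = keyForm G K c u w + keyForm G K c u' w := by
  unfold keyForm
  have h1 : ∑ x, ∑ y, K x y * lap G (u + u') x * lap G w y =
      ∑ x, ∑ y, K x y * lap G u x * lap G w y + ∑ x, ∑ y, K x y * lap G u' x * lap G w y := by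
    simp only [← Finset.sum_add_distrib, lap_add]
    refine Finset.sum_congr rfl fun x _ => Finset.sum_congr rfl fun y _ => by ring
  have h2 : (∑ x, ∑ y, if G.Adj x y then c s(x, y) * ((u + u') y - (u + u') x) * (w y - w x)
      else 0) = (∑ x, ∑ y, if G.Adj x y then c s(x, y) * (u y - u x) * (w y - w x) else 0) +
      ∑ x, ∑ y, if G.Adj x y then c s(x, y) * (u' y - u' x) * (w y - w x) else 0 := by
    simp only [← Finset.sum_add_distrib]
    refine Finset.sum_congr rfl fun x _ => Finset.sum_congr rfl fun y _ => ?_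
    split_ifs
    · simp only [Pi.add_apply]; ring
    · simp
  rw [h1, h2]
  ring

lemma keyForm_symm (hK : ∀ x y, K x y = K y x) (u w : V → ℝ) :
    keyForm G K c u w = keyForm G K c w u := by
  unfold keyForm
  congr 1
  · rw [Finset.sum_comm]
    refine Finset.sum_congr rfl fun x _ => Finset.sum_congr rfl fun y _ => ?_
    rw [hK]; ring
  · congr 1
    refine Finset.sum_congr rfl fun x _ => Finset.sum_congr rfl fun y _ => ?_
    split_ifs <;> ring

lemma keyForm_comp (σ : V ≃ V) (hσ : ∀ x y, G.Adj (σ x) (σ y) ↔ G.Adj x y)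
    (hK : ∀ x y, K (σ x) (σ y) = K x y) (hc : ∀ x y, G.Adj x y → c s(σ x, σ y) = c s(x, y))
    (u w : V → ℝ) :
    keyForm G K c (fun x => u (σ x)) (fun x => w (σ x)) = keyForm G K c u w := by
  unfold keyForm
  simp_rw [lap_comp σ hσ]
  congr 1
  · rw [← σ.sum_comp (fun x => ∑ y, K x y * lap G u x * lap G w y)]
    refine Finset.sum_congr rfl fun x _ => ?_
    rw [← σ.sum_comp (fun y => K (σ x) y * lap G u (σ x) * lap G w y)]
    simp_rw [hK]
  · congr 1
    rw [← σ.sum_comp (fun x => ∑ y, if G.Adj x y then c s(x, y) * (u y - u x) * (w y - w x) else 0)]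
    refine Finset.sum_congr rfl fun x _ => ?_
    rw [← σ.sum_comp (fun y => if G.Adj (σ x) y then
      c s(σ x, y) * (u y - u (σ x)) * (w y - w (σ x)) else 0)]
    refine Finset.sum_congr rfl fun y _ => ?_
    simp only [hσ]
    split_ifs with h
    · rw [hc x y h]
    · rfl

/-- The fold onto one of the sides of a reflection. -/
def fold (θ : V → V) (half : V → Prop) (x : V) : V := if half x then x else θ x

/-- A form that is positive on the pairs of a function on one half and its reflection increases
on average under folds. -/
lemma two_mul_le_fold (θ : V ≃ V) (hθ : ∀ x, θ (θ x) = x) (half : V → Prop)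
    (hhalf : ∀ x, half (θ x) ↔ ¬ half x) (B : (V → ℝ) → (V → ℝ) → ℝ)
    (hadd : ∀ u u' w, B (u + u') w = B u w + B u' w) (hsymm : ∀ u w, B u w = B w u)
    (hinv : ∀ u w, B (fun x => u (θ x)) (fun x => w (θ x)) = B u w)
    (hpos : ∀ a : V → ℝ, (∀ x, ¬ half x → a x = 0) → 0 ≤ B a (fun x => a (θ x))) (v : V → ℝ) :
    2 * B v v ≤ B (fun x => v (fold θ half x)) (fun x => v (fold θ half x)) +
      B (fun x => v (fold θ (fun x => ¬ half x) x)) (fun x => v (fold θ (fun x => ¬ half x) x)) := by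
  set a : V → ℝ := fun x => if half x then v x else 0 with ha
  set b : V → ℝ := fun x => if half x then v (θ x) else 0 with hb
  set ra : V → ℝ := fun x => a (θ x) with hra
  set rb : V → ℝ := fun x => b (θ x) with hrb
  have hadd' : ∀ u w w', B u (w + w') = B u w + B u w' := fun u w w' => by
    rw [hsymm, hadd, hsymm w, hsymm w']
  have h1 : v = a + rb := by
    funext x
    by_cases hx : half x <;> simp [ha, hb, hrb, hx, hhalf, hθ]
  have h2 : (fun x => v (fold θ half x)) = a + ra := by
    funext x
    by_cases hx : half x <;> simp [ha, hra, hx, hhalf, fold]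
  have h3 : (fun x => v (fold θ (fun x => ¬ half x) x)) = b + rb := by
    funext x
    by_cases hx : half x <;> simp [hb, hrb, hx, hhalf, hθ, fold]
  -- Here v = a + θb, and the folds are a + θa and b + θb. The difference of the two sides of the
  -- claim is 2 B(a - b, θ(a - b)).
  have h0 := hpos (a - b) fun x hx => by simp [ha, hb, hx]
  have h4 : (fun x => (a - b) (θ x)) = ra - rb := rfl
  rw [h4] at h0
  have hneg : ∀ u w, B (u - w) = fun z => B u z - B w z := fun u w => by
    funext z
    have := hadd (u - w) w z
    rw [sub_add_cancel] at this
    linarith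
  have hneg' : ∀ u w z, B z (u - w) = B z u - B z w := fun u w z => by
    rw [hsymm, hneg, hsymm z u, hsymm z w]
  rw [hneg] at h0
  simp only [hneg'] at h0
  have e1 : B ra ra = B a a := hinv a a
  have e2 : B rb rb = B b b := hinv b b
  have e3 : B ra b = B a rb := by
    rw [← hinv]
    congr 1
    funext x
    simp [hra, hθ]
  rw [h2, h3]
  have e4 : B v v = B a a + 2 * B a rb + B b b := by
    rw [h1, hadd, hadd', hadd', e2, hsymm rb a]; ring
  rw [e4, hadd, hadd', hadd', hadd, hadd', hadd', e1, e2, hsymm ra a, hsymm rb b]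
  have e5 : B b ra = B a rb := by rw [hsymm, e3]
  linarith

end

/-! ### Reflection positivity of the quadratic form. -/

section
open scoped Classical

variable {V : Type*} [Fintype V] {G : SimpleGraph V} {N : ℕ} {lam : ℝ} {U : ℕ → ℝ}
  {vG : V → V → ℝ}

namespace Reflection
variable (θ : Reflection (incident G))

lemma eq_onV_of_adj {x y : V} (hx : θ.half x) (hy : ¬ θ.half y) (h : G.Adj x y) :
    y = θ.onV x := by
  have hin : incident G x ⟨s(x, y), h⟩ := Sym2.mem_mk_left _ _
  have hin' : incident G y ⟨s(x, y), h⟩ := Sym2.mem_mk_right _ _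
  have h1 := θ.crossing ⟨s(x, y), h⟩ x y hx hy hin hin'
  have h2 := (θ.inc_iff x ⟨s(x, y), h⟩).mpr hin
  rw [h1] at h2
  rcases Sym2.mem_iff.mp h2 with h3 | h3
  · exact absurd h3.symm (θ.ne_onV hx hx)
  · exact h3.symm

lemma onE_mk {x y : V} (h : G.Adj x y) :
    ((θ.onE ⟨s(x, y), h⟩ : G.edgeSet) : Sym2 V) = s(θ.onV x, θ.onV y) := by
  have h1 := (θ.inc_iff x ⟨s(x, y), h⟩).mpr (Sym2.mem_mk_left _ _)
  have h2 := (θ.inc_iff y ⟨s(x, y), h⟩).mpr (Sym2.mem_mk_right _ _)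
  exact (Sym2.mem_and_mem_iff (θ.equivV.injective.ne h.ne)).mp ⟨h1, h2⟩

lemma sum_subtype_eq_ite (p : V → Prop) [Fintype {x // p x}] (f : V → ℝ) :
    ∑ x : {x // p x}, f x.1 = ∑ x, if p x then f x else 0 := by
  rw [← Finset.sum_filter]
  exact (Finset.sum_subtype _ (by simp) f).symm

lemma sum_halves (f : V → ℝ) :
    ∑ x, f x = ∑ x : {x // θ.half x}, (f x.1 + f (θ.onV x.1)) := by
  rw [sum_subtype_eq_ite θ.half (fun x => f x + f (θ.onV x))]
  have h1 : ∀ x, (if θ.half x then f x + f (θ.onV x) else 0) =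
      (if θ.half x then f x else 0) + if θ.half x then f (θ.onV x) else 0 := fun x => by
    split_ifs <;> simp
  simp_rw [h1]
  rw [Finset.sum_add_distrib, ← θ.equivV.sum_comp (fun x => if θ.half x then f (θ.onV x) else 0),
    ← Finset.sum_add_distrib]
  refine Finset.sum_congr rfl fun x _ => ?_
  have h0 : θ.equivV x = θ.onV x := rfl
  rw [h0, θ.onV_onV]
  by_cases hx : θ.half x <;> simp [hx, θ.half_iff]

section
variable (hadj : ∀ x y, G.Adj (θ.onV x) (θ.onV y) ↔ G.Adj x y) {a : V → ℝ}
  (ha : ∀ x, ¬ θ.half x → a x = 0)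
include ha

/-- The only possible neighbour of the mirror image of x inside the half is x, so beyond the plane
the Laplacian sees `a` only through crossing edges. -/
lemma lap_onV {x : V} (hx : θ.half x) :
    lap G a (θ.onV x) = if G.Adj x (θ.onV x) then a x else 0 := by
  unfold lap
  rw [ha _ (θ.not_half_onV hx), Finset.sum_eq_single x]
  · simp [G.adj_comm]
  · intro y _ hy
    split_ifs with h
    · by_cases hy' : θ.half y
      · have := θ.eq_onV_of_adj hy' (θ.not_half_onV hx) h.symm
        exact absurd (θ.equivV.injective this).symm hy
      · rw [ha y hy', sub_zero]
    · rfl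
  · simp

lemma sum_boundary (f : V → ℝ) : ∑ x : θ.Boundary, f x.1 * a x.1 =
    ∑ x : {x // θ.half x}, f x.1 * lap G a (θ.onV x.1) := by
  have h1 : ∀ x : {x // θ.half x}, f x.1 * lap G a (θ.onV x.1) =
      f x.1 * (if G.Adj x.1 (θ.onV x.1) then a x.1 else 0) := fun x => by rw [θ.lap_onV ha x.2]
  simp_rw [h1]
  rw [sum_subtype_eq_ite (fun x => θ.half x ∧ G.Adj x (θ.onV x)) (fun x => f x * a x),
    sum_subtype_eq_ite θ.half (fun x => f x * (if G.Adj x (θ.onV x) then a x else 0))]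
  refine Finset.sum_congr rfl fun x _ => ?_
  by_cases h2 : θ.half x <;> by_cases h3 : G.Adj x (θ.onV x) <;> simp [h2, h3]

include hadj in
-- Each of x and y lies in one of the two halves; where a function is differentiated beyond its
-- support, `lap_onV` replaces the Laplacian by a boundary value. The four sums match the four kinds
-- of pairs of moves.
lemma sum_lap_reflected (W : V → V → ℝ) :
    ∑ x, ∑ y, W x y * lap G a x * lap G (fun x => a (θ.onV x)) y =
      ∑ x : {x // θ.half x}, ∑ y : {x // θ.half x}, W x.1 (θ.onV y.1) * lap G a x.1 * lap G a y.1 +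
      ∑ x : {x // θ.half x}, ∑ y : θ.Boundary, W x.1 y.1 * lap G a x.1 * a y.1 +
      (∑ x : θ.Boundary, ∑ y : {x // θ.half x},
        W (θ.onV x.1) (θ.onV y.1) * a x.1 * lap G a y.1 +
      ∑ x : θ.Boundary, ∑ y : θ.Boundary, W (θ.onV x.1) y.1 * a x.1 * a y.1) := by
  have hl : ∀ y, lap G (fun x => a (θ.onV x)) y = lap G a (θ.onV y) :=
    fun y => lap_comp θ.equivV hadj a y
  simp_rw [hl]
  have h1 : ∑ x : θ.Boundary, ∑ y : {x // θ.half x},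
        W (θ.onV x.1) (θ.onV y.1) * a x.1 * lap G a y.1 = ∑ x : {x // θ.half x},
        ∑ y : {x // θ.half x}, W (θ.onV x.1) (θ.onV y.1) * lap G a (θ.onV x.1) * lap G a y.1 := by
    refine Finset.sum_comm.trans ((Finset.sum_congr rfl fun y _ => ?_).trans Finset.sum_comm)
    have := θ.sum_boundary ha (fun x => W (θ.onV x) (θ.onV y.1) * lap G a y.1)
    convert this using 2 <;> ring
  have h2 : ∀ (x : V) (t : ℝ), ∑ y : θ.Boundary, W x y.1 * t * a y.1 =
      ∑ y : {x // θ.half x}, W x y.1 * t * lap G a (θ.onV y.1) := fun x t =>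
    θ.sum_boundary ha (fun y => W x y * t)
  have h3 : ∑ x : θ.Boundary, ∑ y : {x // θ.half x}, W (θ.onV x.1) y.1 * a x.1 *
        lap G a (θ.onV y.1) = ∑ x : {x // θ.half x}, ∑ y : {x // θ.half x},
        W (θ.onV x.1) y.1 * lap G a (θ.onV x.1) * lap G a (θ.onV y.1) := by
    refine Finset.sum_comm.trans ((Finset.sum_congr rfl fun y _ => ?_).trans Finset.sum_comm)
    have := θ.sum_boundary ha (fun x => W (θ.onV x) y.1 * lap G a (θ.onV y.1))
    convert this using 2 <;> ring
  simp_rw [h2]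
  rw [h1, h3, θ.sum_halves]
  simp_rw [θ.sum_halves (fun y => W _ y * _ * lap G a (θ.onV y)), θ.onV_onV]
  simp only [← Finset.sum_add_distrib]
  refine Finset.sum_congr rfl fun x _ => ?_
  refine Finset.sum_congr rfl fun y _ => ?_
  ring

/-- On an edge inside a half, either `a` or its reflection vanishes at both ends. A crossing edge
contributes -c a², once for each orientation. -/
lemma sum_grad_reflected (c : Sym2 V → ℝ) :
    ∑ x, ∑ y, (if G.Adj x y then c s(x, y) * (a y - a x) * (a (θ.onV y) - a (θ.onV x)) else 0) =
      -2 * ∑ x : θ.Boundary, c s(x.1, θ.onV x.1) * a x.1 ^ 2 := by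
  let D : V → Prop := fun x => θ.half x ∧ G.Adj x (θ.onV x)
  let g : V → ℝ := fun x => if D x then -(c s(x, θ.onV x) * a x ^ 2) else 0
  have h1 : ∀ x y, (if G.Adj x y then c s(x, y) * (a y - a x) * (a (θ.onV y) - a (θ.onV x))
      else 0) = (if y = θ.onV x then g x else 0) + if x = θ.onV y then g y else 0 := by
    intro x y
    by_cases hxy : y = θ.onV x
    · subst hxy
      rw [θ.onV_onV, if_pos rfl, if_pos rfl]
      by_cases hx : θ.half x
      · have h2 := ha _ (θ.not_half_onV hx)
        by_cases h3 : G.Adj x (θ.onV x)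
        · simp [g, D, h2, h3, hx, θ.not_half_onV hx]
          ring
        · simp [g, D, h3, θ.onV_onV, G.adj_comm (θ.onV x) x]
      · have h2 := ha _ hx
        have h4 : θ.half (θ.onV x) := (θ.half_iff x).mpr hx
        by_cases h3 : G.Adj x (θ.onV x)
        · simp [g, D, h2, h3, hx, h4, θ.onV_onV, h3.symm, Sym2.eq_swap (a := θ.onV x)]
          ring
        · simp [g, D, h3, θ.onV_onV, G.adj_comm (θ.onV x) x]
    · have hyx : ¬ x = θ.onV y := fun h => hxy (by rw [h, θ.onV_onV])
      rw [if_neg hxy, if_neg hyx, add_zero]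
      split_ifs with h
      · by_cases hx : θ.half x
        · have hy : θ.half y := by
            by_contra hy
            exact hxy (θ.eq_onV_of_adj hx hy h)
          rw [ha _ (θ.not_half_onV hx), ha _ (θ.not_half_onV hy)]
          ring
        · have hy : ¬ θ.half y := fun hy => hyx (θ.eq_onV_of_adj hy hx h.symm)
          rw [ha _ hx, ha _ hy]
          ring
      · rfl
  simp_rw [h1, Finset.sum_add_distrib]
  have h2 : ∑ x, ∑ y, (if x = θ.onV y then g y else 0) = ∑ x, g x := by
    rw [Finset.sum_comm]
    simp
  rw [h2]
  simp only [Finset.sum_ite_eq', Finset.mem_univ, if_true]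
  have h3 : ∑ x, g x = -∑ x : θ.Boundary, c s(x.1, θ.onV x.1) * a x.1 ^ 2 := by
    rw [sum_subtype_eq_ite D (fun x => c s(x, θ.onV x) * a x ^ 2), ← Finset.sum_neg_distrib]
    refine Finset.sum_congr rfl fun x _ => ?_
    simp only [g]
    split_ifs <;> simp
  rw [h3]
  ring

end

variable (hN : 2 ≤ N) (hlam : 0 < lam) (hU : ∀ n, 0 ≤ U n) (hb : ExpBounded N U vG)
  (hv : ∀ x y, vG x y = vG y x) (hθ : ∀ x y, vG (θ.onV x) (θ.onV y) = vG x y)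
  (hadj : ∀ x y, G.Adj (θ.onV x) (θ.onV y) ↔ G.Adj x y) {c₀ : Fin N} (h₀ : (c₀ : ℕ) = 0)
include hN hlam hU hb hθ

lemma twoPoint_onV (x y : V) :
    twoPoint G N lam U vG (θ.onV x) (θ.onV y) = twoPoint G N lam U vG x y := by
  have h : Zdir G N lam U vG (θ.onV x) (θ.onV y) = Zdir G N lam U vG x y := by
    rw [Zdir_eq hN hlam.le hU hb, Zdir_eq hN hlam.le hU hb]
    refine Eq.trans ?_ (moment_comp (incident G) lam U vG θ.equivV θ.equivE θ.inc_iff hθ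
      (insertion N x + insertion N y) fun _ => 1)
    congr 1
    funext z i
    have h0 : θ.equivV z = θ.onV z := rfl
    simp only [Pi.add_apply, h0, θ.insertion_onV, θ.onV_onV]
  unfold twoPoint
  rw [h]

lemma expect_count_onV {x y : V} (h : G.Adj x y) (i : Fin N) :
    expect G N lam U vG (fun w => (w.linkCount s(θ.onV x, θ.onV y) i : ℝ)) =
      expect G N lam U vG (fun w => (w.linkCount s(x, y) i : ℝ)) := by
  unfold expect
  congr 1
  have h1 := avg_count_eq hN hlam.le hU hb (⟨s(x, y), h⟩ : G.edgeSet) i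
  have h2 := avg_count_eq hN hlam.le hU hb (θ.onE ⟨s(x, y), h⟩) i
  rw [θ.onE_mk h] at h2
  rw [h1, h2]
  exact (moment_comp (incident G) lam U vG θ.equivV θ.equivE θ.inc_iff hθ 0
    (fun q => (q ⟨s(x, y), h⟩ i : ℝ))).symm

include hv hadj h₀ in
/-- Reflection positivity of the form in the key inequality. -/
theorem keyForm_nonneg (hpos : ∀ a : V → ℝ, 0 ≤ ∑ x, ∑ y, θ.interaction vG x y * a x * a y)
    (hZ : 0 < Zloop G N lam U vG) (a : V → ℝ) (ha : ∀ x, ¬ θ.half x → a x = 0) :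
    0 ≤ keyForm G (twoPoint G N lam U vG)
      (fun e => 1 + 2 * expect G N lam U vG fun w => (w.linkCount e c₀ : ℝ)) a
      (fun x => a (θ.onV x)) := by
  set Z := Zloop G N lam U vG with hZdef
  set W := Zdir G N lam U vG with hW
  set M : Sym2 V → ℝ := fun e => avg G N lam U vG (fun w => closedInd w * (w.linkCount e c₀ : ℝ))
    with hM
  -- A removal carries λ² relative to an insertion, so the coefficients λ Δa and a/λ give all four
  -- kinds of directed terms the common factor λ², and the extra diagonal term the factor a².
  have hrp := θ.sum_corr_nonneg hlam.le hU hb hv hθ hpos c₀ ⟨1, hN⟩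
    (Sum.elim (fun x => lam * lap G a x.1) (fun x => a x.1 / lam))
  have hc1 : ∀ x y, θ.corr lam U vG c₀ ⟨1, hN⟩ (.inl x) (.inl y) = W x.1 (θ.onV y.1) :=
    fun x y => by rw [θ.corr_inl_inl, hW, Zdir_eq hN hlam.le hU hb]
  have hc2 : ∀ x y, θ.corr lam U vG c₀ ⟨1, hN⟩ (.inl x) (.inr y) = lam ^ 2 * W x.1 y.1 :=
    fun x y => by rw [θ.corr_inl_inr h₀ rfl, hW, Zdir_eq hN hlam.le hU hb]
  have hc3 : ∀ x y, θ.corr lam U vG c₀ ⟨1, hN⟩ (.inr x) (.inl y) =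
      lam ^ 2 * W (θ.onV x.1) (θ.onV y.1) :=
    fun x y => by rw [θ.corr_inr_inl h₀ rfl, hW, Zdir_eq hN hlam.le hU hb]
  have hc4 : ∀ x y, θ.corr lam U vG c₀ ⟨1, hN⟩ (.inr x) (.inr y) =
      lam ^ 4 * W (θ.onV x.1) y.1 +
        if x = y then lam ^ 2 * (Z + 2 * M s(x.1, θ.onV x.1)) else 0 := by
    intro x y
    by_cases hxy : x = y
    · subst hxy
      rw [θ.corr_inr_inr_self h₀ rfl hlam.le hU hb, hW, Zdir_eq hN hlam.le hU hb, if_pos rfl,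
        hZdef, Zloop_eq hN hlam.le hU hb, ← avg_count_eq hN hlam.le hU hb]
      rfl
    · rw [θ.corr_inr_inr_of_ne h₀ rfl hxy, hW, Zdir_eq hN hlam.le hU hb, if_neg hxy, add_zero]
  have key : ∑ j, ∑ j', (Sum.elim (fun x => lam * lap G a x.1) (fun x => a x.1 / lam) : θ.Move → ℝ) j *
      (Sum.elim (fun x => lam * lap G a x.1) (fun x => a x.1 / lam) : θ.Move → ℝ) j' *
        θ.corr lam U vG c₀ ⟨1, hN⟩ j j' =
      lam ^ 2 * ∑ x, ∑ y, W x y * lap G a x * lap G (fun x => a (θ.onV x)) y +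
        ∑ x : θ.Boundary, (Z + 2 * M s(x.1, θ.onV x.1)) * a x.1 ^ 2 := by
    rw [θ.sum_lap_reflected hadj ha]
    simp only [Fintype.sum_sum_type, Sum.elim_inl, Sum.elim_inr, hc1, hc2, hc3, hc4, mul_add,
      Finset.sum_add_distrib, mul_ite, mul_zero, Finset.sum_ite_eq, Finset.mem_univ, if_true,
      Finset.mul_sum]
    have hl : lam ≠ 0 := hlam.ne'
    have t1 : ∀ p q w : ℝ, lam * p * (lam * q) * w = lam ^ 2 * (w * p * q) := fun p q w => by ring
    have t2 : ∀ p q w : ℝ, lam * p * (q / lam) * (lam ^ 2 * w) = lam ^ 2 * (w * p * q) :=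
      fun p q w => by field_simp
    have t3 : ∀ p q w : ℝ, p / lam * (lam * q) * (lam ^ 2 * w) = lam ^ 2 * (w * p * q) :=
      fun p q w => by field_simp
    have t4 : ∀ p q w : ℝ, p / lam * (q / lam) * (lam ^ 4 * w) = lam ^ 2 * (w * p * q) :=
      fun p q w => by field_simp
    have t5 : ∀ p w : ℝ, p / lam * (p / lam) * (lam ^ 2 * w) = w * p ^ 2 :=
      fun p w => by field_simp
    simp only [t1, t2, t3, t4, t5, add_mul, Finset.sum_add_distrib]
    ring
  rw [key] at hrp
  have hform : Z * keyForm G (twoPoint G N lam U vG)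
      (fun e => 1 + 2 * expect G N lam U vG fun w => (w.linkCount e c₀ : ℝ)) a
      (fun x => a (θ.onV x)) =
      lam ^ 2 * ∑ x, ∑ y, W x y * lap G a x * lap G (fun x => a (θ.onV x)) y +
        ∑ x : θ.Boundary, (Z + 2 * M s(x.1, θ.onV x.1)) * a x.1 ^ 2 := by
    unfold keyForm
    rw [θ.sum_grad_reflected ha (fun e => 1 + 2 * expect G N lam U vG
      fun w => (w.linkCount e c₀ : ℝ)), mul_sub]
    have e1 : Z * ∑ x, ∑ y, twoPoint G N lam U vG x y * lap G a x *
        lap G (fun x => a (θ.onV x)) y =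
        lam ^ 2 * ∑ x, ∑ y, W x y * lap G a x * lap G (fun x => a (θ.onV x)) y := by
      simp only [Finset.mul_sum]
      refine Finset.sum_congr rfl fun x _ => Finset.sum_congr rfl fun y _ => ?_
      unfold twoPoint
      rw [← hZdef, ← hW]
      field_simp
    have e2 : Z * (-2 * (∑ x : θ.Boundary, (1 + 2 * expect G N lam U vG
        fun w => (w.linkCount s(x.1, θ.onV x.1) c₀ : ℝ)) * a x.1 ^ 2) / 2) =
        -∑ x : θ.Boundary, (Z + 2 * M s(x.1, θ.onV x.1)) * a x.1 ^ 2 := by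
      have : ∀ S : ℝ, Z * (-2 * S / 2) = -(Z * S) := fun S => by ring
      rw [this, Finset.mul_sum]
      congr 1
      refine Finset.sum_congr rfl fun x _ => ?_
      unfold expect
      rw [← hZdef]
      simp only [hM]
      field_simp
    rw [e1, e2]
    ring
  rw [← hform] at hrp
  exact nonneg_of_mul_nonneg_right hrp hZ

include hv hadj h₀ in
/-- The form in the key inequality increases on average under the folds of a reflection. -/
theorem two_mul_keyForm_le (hpos : ∀ a : V → ℝ, 0 ≤ ∑ x, ∑ y, θ.interaction vG x y * a x * a y)
    (hZ : 0 < Zloop G N lam U vG) (ψ : V → ℝ) (B : (V → ℝ) → (V → ℝ) → ℝ)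
    (hB : B = keyForm G (twoPoint G N lam U vG)
      (fun e => 1 + 2 * expect G N lam U vG fun w => (w.linkCount e c₀ : ℝ))) :
    2 * B ψ ψ ≤ B (fun x => ψ (fold θ.onV θ.half x)) (fun x => ψ (fold θ.onV θ.half x)) +
      B (fun x => ψ (fold θ.onV (fun x => ¬ θ.half x) x))
        (fun x => ψ (fold θ.onV (fun x => ¬ θ.half x) x)) := by
  subst hB
  refine two_mul_le_fold θ.equivV θ.onV_onV θ.half θ.half_iff _ keyForm_add_left ?_ ?_ ?_ ψ
  · refine keyForm_symm fun x y => ?_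
    unfold twoPoint
    rw [Zdir_eq hN hlam.le hU hb, Zdir_eq hN hlam.le hU hb, add_comm]
  · refine keyForm_comp θ.equivV hadj (θ.twoPoint_onV hN hlam hU hb hθ) fun x y h => ?_
    have := θ.expect_count_onV hN hlam hU hb hθ h c₀
    change 1 + 2 * expect G N lam U vG (fun w => (w.linkCount s(θ.onV x, θ.onV y) c₀ : ℝ)) = _
    rw [this]
  · exact θ.keyForm_nonneg hN hlam hU hb hv hθ hadj h₀ hpos hZ

end Reflection
end

/-! ### The periodised potential and the reflections of the torus -/

section
open scoped Classical

variable {V : Type*} [Fintype V] {G : SimpleGraph V}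

/-- The reflection of a graph given by an involution and one of its halves. -/
def Reflection.ofGraph (θ : V → V) (half : V → Prop) (hθ : ∀ x, θ (θ x) = x)
    (hadj : ∀ x y, G.Adj (θ x) (θ y) ↔ G.Adj x y) (hhalf : ∀ x, half (θ x) ↔ ¬ half x)
    (hcross : ∀ x y, half x → ¬ half y → G.Adj x y → y = θ x) : Reflection (incident G) where
  onV := θ
  onE e := ⟨Sym2.map θ e.1, by
    obtain ⟨e, he⟩ := e
    induction e with
    | _ x y => exact (hadj x y).mpr he⟩
  half := half
  onV_onV := hθ
  onE_onE := by
    rintro ⟨e, he⟩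
    induction e with
    | _ x y => exact Subtype.ext (by simp [hθ])
  inc_iff := by
    rintro z ⟨e, he⟩
    induction e with
    | _ x y =>
      have hinj : ∀ x y, θ x = θ y ↔ x = y := fun x y =>
        ⟨fun h => by rw [← hθ x, h, hθ], fun h => by rw [h]⟩
      simp [incident, hinj]
  half_iff := hhalf
  exists_inc := by
    rintro ⟨e, he⟩
    induction e with
    | _ x y => exact ⟨x, Sym2.mem_mk_left x y⟩
  crossing := by
    rintro ⟨e, he⟩ x y hx hy hxe hye
    have hne : x ≠ y := fun h => hy (h ▸ hx)
    have hxy : e = s(x, y) := (Sym2.mem_and_mem_iff hne).mp ⟨hxe, hye⟩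
    subst hxy
    have := hcross x y hx hy he
    subst this
    exact Subtype.ext (by simp [hθ, Sym2.eq_swap])

end

section Torus

variable {d L : ℕ}

lemma torusGraph_adj (x y : Torus d L) : (torusGraph d L).Adj x y ↔
    x ≠ y ∧ ∃ i, y = x + Pi.single i 1 ∨ x = y + Pi.single i 1 := by
  rw [torusGraph, SimpleGraph.fromRel_adj, exists_or]

lemma torusGraph_adj_add (a x y : Torus d L) :
    (torusGraph d L).Adj (x + a) (y + a) ↔ (torusGraph d L).Adj x y := by
  simp only [torusGraph_adj, ne_eq, add_left_inj]
  refine and_congr_right fun _ => exists_congr fun i => ?_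
  rw [add_right_comm x a, add_right_comm y a, add_left_inj, add_left_inj]

/-- The permutation of the coordinates of the torus. -/
def permute (σ : Equiv.Perm (Fin d)) : Torus d L ≃ Torus d L := Equiv.arrowCongr σ.symm (Equiv.refl _)

lemma permute_apply (σ : Equiv.Perm (Fin d)) (x : Torus d L) : permute σ x = x ∘ σ := by
  funext i; simp [permute]

lemma permute_single (σ : Equiv.Perm (Fin d)) (i : Fin d) (c : ZMod L) :
    permute σ (Pi.single i c) = Pi.single (σ.symm i) c := by
  rw [permute_apply]
  funext j
  by_cases h : σ j = i
  · have : j = σ.symm i := by rw [← h]; simp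
    simp [this]
  · have : j ≠ σ.symm i := fun h' => h (by rw [h']; simp)
    simp [h, this]

lemma torusGraph_adj_permute (σ : Equiv.Perm (Fin d)) (x y : Torus d L) :
    (torusGraph d L).Adj (permute σ x) (permute σ y) ↔ (torusGraph d L).Adj x y := by
  simp only [torusGraph_adj, ne_eq, (permute σ).injective.eq_iff]
  refine and_congr_right fun _ => ?_
  have h : ∀ (x y : Torus d L) i, permute σ y = permute σ x + Pi.single (σ.symm i) 1 ↔
      y = x + Pi.single i 1 := fun x y i => by
    rw [← permute_single]
    exact (permute σ).injective.eq_iff (a := y) (b := x + Pi.single i 1)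
  constructor
  · rintro ⟨i, hi⟩
    refine ⟨σ i, ?_⟩
    have h1 := h x y (σ i)
    have h2 := h y x (σ i)
    rw [Equiv.symm_apply_apply] at h1 h2
    rwa [← h1, ← h2]
  · rintro ⟨i, hi⟩
    refine ⟨σ.symm i, ?_⟩
    rwa [h, h]

/-- The reflection of the torus in direction `i` that exchanges `a` and `a + 1`. -/
def reflectAt (i : Fin d) (a : ZMod L) (x : Torus d L) : Torus d L :=
  Function.update x i (2 * a + 1 - x i)

lemma reflectAt_reflectAt (i : Fin d) (a : ZMod L) (x : Torus d L) :
    reflectAt i a (reflectAt i a x) = x := by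
  simp [reflectAt]

lemma reflectAt_zero (i : Fin d) (x : Torus d L) : reflectAt i 0 x = reflect i x := by
  simp [reflectAt, reflect]

lemma reflectAt_eq (i : Fin d) (a : ZMod L) (x : Torus d L) :
    reflectAt i a x = x + Pi.single i (2 * a + 1 - 2 * x i) := by
  funext j
  by_cases h : j = i
  · subst h; simp [reflectAt]; ring
  · simp [reflectAt, h]

lemma torusGraph_adj_reflectAt (i : Fin d) (a : ZMod L) (x y : Torus d L) :
    (torusGraph d L).Adj (reflectAt i a x) (reflectAt i a y) ↔ (torusGraph d L).Adj x y := by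
  have hinj : Function.Injective (reflectAt (L := L) i a) := fun x y h => by
    rw [← reflectAt_reflectAt i a x, h, reflectAt_reflectAt]
  simp only [torusGraph_adj, ne_eq, hinj.eq_iff]
  refine and_congr_right fun _ => exists_congr fun j => ?_
  have key : ∀ x y : Torus d L, y = x + Pi.single j 1 →
      (reflectAt i a y = reflectAt i a x + Pi.single j 1 ∨
        reflectAt i a x = reflectAt i a y + Pi.single j 1) := by
    rintro x _ rfl
    by_cases h : i = j
    · right
      subst h
      simp only [reflectAt_eq]
      funext k
      by_cases hk : k = i
      · subst hk; simp; ring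
      · simp [hk]
    · left
      simp only [reflectAt_eq]
      funext k
      by_cases hk : k = i
      · subst hk; simp [h]
      · simp [hk]
  constructor
  · rintro (h | h)
    · have := key _ _ h
      simpa only [reflectAt_reflectAt] using this
    · have := key _ _ h
      simp only [reflectAt_reflectAt] at this
      exact this.symm
  · rintro (h | h)
    · exact key _ _ h
    · exact (key _ _ h).symm

/-- The half of the torus between `a` and `a + L / 2` in direction `i`. -/
def halfAt (i : Fin d) (a : ZMod L) (x : Torus d L) : Prop := 0 < (x i - a).valMinAbs

variable [NeZero L]

lemma valMinAbs_eq {n : ℤ} {h : ℕ} (hL : L = 2 * h) (h1 : -(h : ℤ) < n) (h2 : n ≤ h) :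
    ((n : ZMod L)).valMinAbs = n := by
  rw [ZMod.valMinAbs_spec]
  refine ⟨rfl, ?_, ?_⟩ <;> push_cast [hL] <;> linarith

lemma valMinAbs_bounds {h : ℕ} (hL : L = 2 * h) (t : ZMod L) :
    -(h : ℤ) < t.valMinAbs ∧ t.valMinAbs ≤ h := by
  have := t.valMinAbs_mem_Ioc
  rw [Set.mem_Ioc] at this
  push_cast [hL] at this
  constructor <;> linarith [this.1, this.2]

/-- For even L the interval (-L/2, L/2] of representatives is stable under t ↦ 1 - t. -/
lemma valMinAbs_one_sub (hL : Even L) (t : ZMod L) : (1 - t).valMinAbs = 1 - t.valMinAbs := by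
  obtain ⟨h, hh⟩ := hL
  have hL : L = 2 * h := by omega
  have h1 := valMinAbs_bounds hL t
  rw [← valMinAbs_eq hL (n := 1 - t.valMinAbs) (by omega) (by omega)]
  rw [Int.cast_sub, Int.cast_one, ZMod.coe_valMinAbs]

lemma halfAt_reflectAt (hL : Even L) (i : Fin d) (a : ZMod L) (x : Torus d L) :
    halfAt i a (reflectAt i a x) ↔ ¬ halfAt i a x := by
  unfold halfAt
  have h : reflectAt i a x i - a = 1 - (x i - a) := by simp [reflectAt]; ring
  rw [h, valMinAbs_one_sub hL]
  omega

/-- On the torus the half has two walls, between a and a + 1 and between a + L/2 and a + L/2 + 1.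
The reflection exchanges the two sides of both walls. -/
lemma eq_reflectAt_of_adj (hL : Even L) (i : Fin d) (a : ZMod L) (x y : Torus d L)
    (hx : halfAt i a x) (hy : ¬ halfAt i a y) (hxy : (torusGraph d L).Adj x y) :
    y = reflectAt i a x := by
  obtain ⟨h, hh⟩ := hL
  have hL : L = 2 * h := by omega
  have hL0 : L ≠ 0 := NeZero.ne L
  obtain ⟨-, j, hj⟩ := (torusGraph_adj x y).mp hxy
  unfold halfAt at hx hy
  have hji : j = i := by
    by_contra hne
    have : y i = x i := by
      rcases hj with rfl | rfl <;> simp [Ne.symm hne]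
    rw [this] at hy
    exact hy hx
  subst hji
  set t := x j - a with ht
  have hb := valMinAbs_bounds hL t
  have hcast : ((t.valMinAbs : ℤ) : ZMod L) = t := ZMod.coe_valMinAbs t
  have hother : ∀ k, k ≠ j → y k = x k := by
    intro k hk
    rcases hj with rfl | rfl <;> simp [hk]
  suffices hyj : y j = 2 * a + 1 - x j by
    funext k
    by_cases hk : k = j
    · subst hk; simp [reflectAt, hyj]
    · simp [reflectAt, hk, hother k hk]
  have hLz : (L : ZMod L) = 0 := ZMod.natCast_self L
  rcases hj with hj | hj
  · have hy1 : y j = x j + 1 := by rw [hj]; simp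
    have hy2 : y j - a = ((t.valMinAbs + 1 : ℤ) : ZMod L) := by
      push_cast; rw [hy1, ht]; ring
    by_cases hlt : t.valMinAbs < h
    · rw [hy2, valMinAbs_eq hL (by omega) (by omega)] at hy
      omega
    -- The wall at a + L/2: here t = L/2, so 2t = 0 modulo L.
    · have h3 : t.valMinAbs = h := by omega
      have h4 : t = (h : ZMod L) := by rw [← hcast, h3]; simp
      have h5 : t + t = 0 := by
        rw [h4, ← Nat.cast_add, ← hh, ZMod.natCast_self]
      rw [hy1]
      have h6 : x j = t + a := by rw [ht]; ring
      rw [h6]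
      linear_combination h5
  · have hx1 : x j = y j + 1 := by rw [hj]; simp
    have hy2 : y j - a = ((t.valMinAbs - 1 : ℤ) : ZMod L) := by
      push_cast; rw [ht, hx1]; ring
    -- The wall at a: a downward step leaves the half only from the layer t = 1.
    by_cases hlt : t.valMinAbs = 1
    · have h4 : t = 1 := by rw [← hcast, hlt]; simp
      have h6 : x j = t + a := by rw [ht]; ring
      rw [h6, h4]
      have : y j = x j - 1 := by rw [hx1]; ring
      rw [this, h6, h4]
      ring
    · rw [hy2, valMinAbs_eq hL (by omega) (by omega)] at hy
      omega

/-! ### Symmetries of the periodised potential. -/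

variable (v : (Fin d → ℤ) → ℝ)

lemma periodic_eq (X Y : Fin d → ℤ) :
    periodic L v (fun i => (X i : ZMod L)) (fun i => (Y i : ZMod L)) =
      ∑' z : Fin d → ℤ, v (fun i => Y i + L * z i - X i) := by
  have h : ∀ (X : Fin d → ℤ) i, ∃ c : ℤ,
      rep (fun i => (X i : ZMod L)) i = X i + L * c := by
    intro X i
    have h1 : ((rep (fun i => (X i : ZMod L)) i : ℤ) : ZMod L) = (X i : ZMod L) :=
      ZMod.coe_valMinAbs _
    obtain ⟨c, hc⟩ := (ZMod.intCast_eq_intCast_iff_dvd_sub _ _ L).mp h1.symm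
    exact ⟨c, by linarith⟩
  choose cX hcX using h X
  choose cY hcY using h Y
  unfold periodic
  rw [← (Equiv.addRight (fun i => cX i - cY i)).tsum_eq]
  refine tsum_congr fun z => ?_
  congr 1
  funext i
  rw [hcX, hcY]
  simp only [Equiv.coe_addRight, Pi.add_apply]
  ring

lemma coe_rep (x : Torus d L) : (fun i => ((rep x i : ℤ) : ZMod L)) = x :=
  funext fun _ => ZMod.coe_valMinAbs _

lemma periodic_add (a x y : Torus d L) : periodic L v (x + a) (y + a) = periodic L v x y := by
  have h : ∀ x : Torus d L, x + a = fun i => ((rep x i + rep a i : ℤ) : ZMod L) := by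
    intro x
    funext i
    rw [Int.cast_add]
    exact (congrArg₂ (· + ·) (congrFun (coe_rep x) i) (congrFun (coe_rep a) i)).symm
  rw [h x, h y, periodic_eq]
  unfold periodic
  refine tsum_congr fun z => ?_
  congr 1
  funext i
  ring

lemma periodic_symm (hv : ∀ x, v (-x) = v x) (x y : Torus d L) :
    periodic L v x y = periodic L v y x := by
  unfold periodic
  rw [← (Equiv.neg (Fin d → ℤ)).tsum_eq]
  refine tsum_congr fun z => ?_
  rw [← hv]
  congr 1
  funext i
  simp only [Equiv.neg_apply, Pi.neg_apply]
  ring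

lemma periodic_permute (hv : ∀ (σ : Equiv.Perm (Fin d)) (x : Fin d → ℤ), v (x ∘ σ) = v x)
    (σ : Equiv.Perm (Fin d)) (x y : Torus d L) :
    periodic L v (permute σ x) (permute σ y) = periodic L v x y := by
  rw [permute_apply, permute_apply]
  unfold periodic
  rw [← (Equiv.arrowCongr σ.symm (Equiv.refl ℤ)).tsum_eq]
  refine tsum_congr fun z => ?_
  rw [← hv σ (fun i => rep y i + L * z i - rep x i)]
  congr 1

/-- Reflection invariance comes from separability: the integrand for the pair (θy, θx) is the
conjugate of that for (x, y), and the potential is real. Evenness of v then exchanges the arguments.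
-/
lemma periodic_reflect_of_half {i : Fin d} (hv : ∀ x, v (-x) = v x) (hsep : SeparableDir L v i)
    (hL : Even L) {x y : Torus d L} (hx : 0 < rep x i) (hy : rep y i ≤ 0) :
    periodic L v (reflect i x) (reflect i y) = periodic L v x y := by
  obtain ⟨k, T, _, ν, α, α', hfin, -, -, -, hint, hae⟩ := hsep
  have hr : ∀ x : Torus d L, rep (reflect i x) i = 1 - rep x i := fun x => by
    unfold rep reflect
    rw [Function.update_self, valMinAbs_one_sub hL]
  have hrr : ∀ x : Torus d L, reflect i (reflect i x) = x := fun x => by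
    rw [← reflectAt_zero, ← reflectAt_zero, reflectAt_reflectAt]
  have h1 := hint x y hx hy
  have h2 := hint (reflect i y) (reflect i x) (by rw [hr]; omega) (by rw [hr]; omega)
  have h3 : ∫ t, ∑ j, α t (reflect i y) j * α' t (reflect i x) j ∂ν =
      starRingEnd ℂ (∫ t, ∑ j, α t x j * α' t y j ∂ν) := by
    rw [← integral_conj]
    refine MeasureTheory.integral_congr_ae ?_
    filter_upwards [hae y, hae (reflect i x)] with t ht1 ht2
    rw [map_sum]
    refine Finset.sum_congr rfl fun j _ => ?_
    rw [ht1, ht2, hrr, map_mul, Complex.conj_conj, mul_comm]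
  rw [← h1, ← h2, Complex.conj_ofReal] at h3
  have h4 : periodic L v (reflect i y) (reflect i x) = periodic L v x y := by
    have := Complex.ofReal_injective h3
    linarith
  rw [periodic_symm v hv, h4]

/-- If the i-th coordinates agree, the reflection moves both points by the same translation.
Otherwise a translation first brings the points to opposite sides of the reference plane. -/
lemma periodic_reflectAt {i : Fin d} (hv : ∀ x, v (-x) = v x) (hsep : SeparableDir L v i)
    (hL : Even L) (a : ZMod L) (x y : Torus d L) :
    periodic L v (reflectAt i a x) (reflectAt i a y) = periodic L v x y := by
  by_cases hxy : x i = y i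
  · rw [reflectAt_eq, reflectAt_eq, hxy, periodic_add]
  obtain ⟨h, hh⟩ := id hL
  have hL' : L = 2 * h := by omega
  have hL0 : L ≠ 0 := NeZero.ne L
  have hD := valMinAbs_bounds hL' (y i - x i)
  have hD0 : (y i - x i).valMinAbs ≠ 0 := by
    rw [Ne, ZMod.valMinAbs_eq_zero]
    exact sub_ne_zero.mpr (Ne.symm hxy)
  have hcast : (((y i - x i).valMinAbs : ℤ) : ZMod L) = y i - x i := ZMod.coe_valMinAbs _
  have hLz : (L : ZMod L) = 0 := ZMod.natCast_self L
  -- The translation moves x to the first layer 1 of the half if y is behind it, and to the last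
  -- layer L/2 if y is ahead of it.
  obtain ⟨t, ht1, ht2⟩ : ∃ t : ZMod L, 0 < (x i + t).valMinAbs ∧ (y i + t).valMinAbs ≤ 0 := by
    rcases lt_or_gt_of_ne hD0 with hneg | hpos
    · refine ⟨1 - x i, ?_, ?_⟩
      · have : x i + (1 - x i) = ((1 : ℤ) : ZMod L) := by push_cast; ring
        rw [this, valMinAbs_eq hL' (by omega) (by omega)]
        norm_num
      · have : y i + (1 - x i) = ((1 + (y i - x i).valMinAbs : ℤ) : ZMod L) := by
          push_cast; ring
        rw [this, valMinAbs_eq hL' (by omega) (by omega)]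
        omega
    · refine ⟨(h : ZMod L) - x i, ?_, ?_⟩
      · have : x i + ((h : ZMod L) - x i) = ((h : ℤ) : ZMod L) := by push_cast; ring
        rw [this, valMinAbs_eq hL' (by omega) (by omega)]
        omega
      · have : y i + ((h : ZMod L) - x i) = (((y i - x i).valMinAbs - h : ℤ) : ZMod L) := by
          push_cast
          have h2 : (h : ZMod L) + h = 0 := by
            rw [← Nat.cast_add, ← hh, ZMod.natCast_self]
          linear_combination h2
        rw [this, valMinAbs_eq hL' (by omega) (by omega)]
        omega
  have key : ∀ x : Torus d L, reflectAt i a x =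
      reflect i (x + Pi.single i t) + Pi.single i (2 * a + t) := by
    intro x
    funext j
    by_cases hj : j = i
    · subst hj; simp [reflectAt, reflect]; ring
    · simp [reflectAt, reflect, hj]
  rw [key, key, periodic_add, periodic_reflect_of_half v hv hsep hL, periodic_add]
  · simpa [rep] using ht1
  · simpa [rep] using ht2

end Torus

/-! ### The key inequality on the torus, given an exponential bound -/

section
open scoped Classical

variable {d L : ℕ} [NeZero L] {v : (Fin d → ℤ) → ℝ}

/-- The form equals the integral of ∑_j |∑_x b_x α_j(t,x)|², since α' at a reflected point is the
conjugate of α. -/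
lemma sum_separable_nonneg {i : Fin d} (hsep : SeparableDir L v i) (hL : Even L)
    (s : Finset (Torus d L)) (hs : ∀ x ∈ s, 0 < rep x i) (b : Torus d L → ℝ) :
    0 ≤ ∑ x ∈ s, ∑ y ∈ s, -periodic L v x (reflect i y) * b x * b y := by
  obtain ⟨k, T, _, ν, α, α', hfin, hα, hα', ⟨C, hC⟩, hint, hae⟩ := hsep
  have hr : ∀ x : Torus d L, rep (reflect i x) i = 1 - rep x i := fun x => by
    unfold rep reflect
    rw [Function.update_self, valMinAbs_one_sub hL]
  have hrr : ∀ x : Torus d L, reflect i (reflect i x) = x := fun x => by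
    rw [← reflectAt_zero, ← reflectAt_zero, reflectAt_reflectAt]
  have hI : ∀ x y, MeasureTheory.Integrable (fun t => ∑ j, α t x j * α' t (reflect i y) j) ν := by
    intro x y
    refine MeasureTheory.integrable_finsetSum _ fun j _ => ?_
    refine MeasureTheory.Integrable.of_bound
      ((hα x j).mul (hα' _ j)).aestronglyMeasurable (C * C) (Filter.Eventually.of_forall fun t => ?_)
    rw [norm_mul]
    exact mul_le_mul (hC t x j).1 (hC t _ j).2 (norm_nonneg _)
      ((norm_nonneg _).trans (hC t x j).1)
  have key : ((∑ x ∈ s, ∑ y ∈ s, -periodic L v x (reflect i y) * b x * b y : ℝ) : ℂ) =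
      ((∫ t, ∑ j, ‖∑ x ∈ s, (b x : ℂ) * α t x j‖ ^ 2 ∂ν : ℝ) : ℂ) := by
    rw [← integral_complex_ofReal]
    have h1 : ((∑ x ∈ s, ∑ y ∈ s, -periodic L v x (reflect i y) * b x * b y : ℝ) : ℂ) =
        ∑ x ∈ s, ∑ y ∈ s, ∫ t, ((b x * b y : ℝ) : ℂ) *
          ∑ j, α t x j * α' t (reflect i y) j ∂ν := by
      push_cast
      refine Finset.sum_congr rfl fun x hx => Finset.sum_congr rfl fun y hy => ?_
      have h2 := hint x (reflect i y) (hs x hx) (by rw [hr]; have := hs y hy; omega)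
      rw [MeasureTheory.integral_const_mul, ← h2]
      push_cast
      ring
    rw [h1]
    have h3 : ∀ x ∈ s, ∑ y ∈ s, ∫ t, ((b x * b y : ℝ) : ℂ) *
        ∑ j, α t x j * α' t (reflect i y) j ∂ν = ∫ t, ∑ y ∈ s, ((b x * b y : ℝ) : ℂ) *
        ∑ j, α t x j * α' t (reflect i y) j ∂ν := fun x _ =>
      (MeasureTheory.integral_finsetSum _ fun y _ => (hI x y).const_mul _).symm
    rw [Finset.sum_congr rfl h3, ← MeasureTheory.integral_finsetSum _ fun x _ =>
      MeasureTheory.integrable_finsetSum _ fun y _ => (hI x y).const_mul _]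
    refine MeasureTheory.integral_congr_ae ?_
    have hall : ∀ᵐ t ∂ν, ∀ y j, α' t y j = starRingEnd ℂ (α t (reflect i y) j) :=
      MeasureTheory.ae_all_iff.mpr hae
    filter_upwards [hall] with t ht
    simp only [ht, hrr]
    have h4 : ∀ z : ℂ, ((‖z‖ ^ 2 : ℝ) : ℂ) = z * starRingEnd ℂ z := fun z => by
      rw [Complex.mul_conj, Complex.normSq_eq_norm_sq]
    change _ = ((∑ j, ‖∑ x ∈ s, (b x : ℂ) * α t x j‖ ^ 2 : ℝ) : ℂ)
    rw [Complex.ofReal_sum]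
    simp_rw [h4, map_sum, map_mul, Complex.conj_ofReal, Finset.sum_mul_sum, Finset.mul_sum]
    symm
    rw [Finset.sum_comm]
    refine Finset.sum_congr rfl fun x _ => ?_
    rw [Finset.sum_comm]
    refine Finset.sum_congr rfl fun y _ => Finset.sum_congr rfl fun j _ => ?_
    push_cast
    ring
  have := Complex.ofReal_injective key
  rw [this]
  exact MeasureTheory.integral_nonneg fun t => Finset.sum_nonneg fun j _ => sq_nonneg _

/-- The reflection of the torus graph in direction `i` that exchanges `a` and `a + 1`. -/
def torusReflection (d : ℕ) (hL : Even L) (i : Fin d) (a : ZMod L) :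
    Reflection (incident (torusGraph d L)) :=
  Reflection.ofGraph (reflectAt i a) (halfAt i a) (reflectAt_reflectAt i a)
    (torusGraph_adj_reflectAt i a) (halfAt_reflectAt hL i a) (eq_reflectAt_of_adj hL i a)

lemma torusReflection_interaction_nonneg (hL : Even L) {i : Fin d} (hsep : SeparableDir L v i)
    (a : ZMod L) (b : Torus d L → ℝ) :
    0 ≤ ∑ x, ∑ y, (torusReflection d hL i a).interaction (periodic L v) x y * b x * b y := by
  have hrefl : ∀ y : Torus d L,
      reflectAt i a (y + Pi.single i a) = reflect i y + Pi.single i a := by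
    intro y
    funext j
    by_cases hj : j = i
    · subst hj; simp [reflectAt, reflect]; ring
    · simp [reflectAt, reflect, hj]
  have hhalf : ∀ y : Torus d L, halfAt i a (y + Pi.single i a) ↔ 0 < rep y i := by
    intro y; simp [halfAt, rep]
  set c : Torus d L → ℝ := fun x => b (x + Pi.single i a)
  have h := sum_separable_nonneg hsep hL (Finset.univ.filter fun x => 0 < rep x i) (by simp) c
  have h2 : ∑ x, ∑ y, (torusReflection d hL i a).interaction (periodic L v) x y * b x * b y =
      2 * ∑ x ∈ Finset.univ.filter (fun x : Torus d L => 0 < rep x i),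
        ∑ y ∈ Finset.univ.filter (fun x : Torus d L => 0 < rep x i),
          -periodic L v x (reflect i y) * c x * c y := by
    rw [Finset.sum_filter, Finset.mul_sum, ← Equiv.sum_comp (Equiv.addRight (Pi.single i a))]
    refine Finset.sum_congr rfl fun x _ => ?_
    rw [Finset.sum_filter, ← Equiv.sum_comp (Equiv.addRight (Pi.single i a))]
    by_cases hx : 0 < rep x i
    · rw [if_pos hx, Finset.mul_sum]
      refine Finset.sum_congr rfl fun y _ => ?_
      change (if halfAt i a (x + Pi.single i a) ∧ halfAt i a (y + Pi.single i a) then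
        2 * -periodic L v (x + Pi.single i a) (reflectAt i a (y + Pi.single i a)) else 0) * c x *
          c y = _
      rw [hhalf, hhalf, hrefl, periodic_add]
      by_cases hy : 0 < rep y i
      · rw [if_pos ⟨hx, hy⟩, if_pos hy]; ring
      · rw [if_neg (fun h => hy h.2), if_neg hy]; ring
    · rw [if_neg hx, mul_zero]
      refine Finset.sum_eq_zero fun y _ => ?_
      change (if halfAt i a (x + Pi.single i a) ∧ halfAt i a (y + Pi.single i a) then
        2 * -periodic L v (x + Pi.single i a) (reflectAt i a (y + Pi.single i a)) else 0) * c x *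
          c y = _
      rw [hhalf, if_neg (fun h => hx h.1)]
      ring
  rw [h2]
  exact mul_nonneg zero_le_two h

/-- The folds of the torus can be composed to a constant map. -/
lemma exists_const_of_fold (hL : Even L) (P : (Torus d L → Torus d L) → Prop)
    (hP : ∀ i a F, P F → P (fun x => F (fold (reflectAt i a) (halfAt i a) x)))
    {F : Torus d L → Torus d L} (hF : P F) : ∃ c, P fun _ => c := by
  obtain ⟨h, hh⟩ := hL
  have hL : L = 2 * h := by omega
  have hL0 : L ≠ 0 := NeZero.ne L
  let M : (Torus d L → Torus d L) → Prop := fun g => ∀ F, P F → P fun x => F (g x)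
  have hcomp : ∀ g₁ g₂, M g₁ → M g₂ → M fun x => g₁ (g₂ x) := fun g₁ g₂ h₁ h₂ F hF =>
    h₂ _ (h₁ F hF)
  have hother : ∀ i a (x : Torus d L) j, j ≠ i →
      fold (reflectAt i a) (halfAt i a) x j = x j := by
    intro i a x j hj
    unfold fold
    split_ifs
    · rfl
    · simp [reflectAt, hj]
  -- The folds at 0, …, k - 1 push the i-th coordinate into [k, L/2]: once it is at least k, the
  -- fold at k moves only the layer k, to k + 1. For k = L/2 a single layer is left.
  have hdir : ∀ i (k : ℕ), 1 ≤ k → k ≤ h → ∃ g, M g ∧ (∀ x j, j ≠ i → g x j = x j) ∧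
      ∀ x, (k : ℤ) ≤ (g x i).valMinAbs := by
    intro i k hk
    induction k, hk using Nat.le_induction with
    | base =>
      intro _
      refine ⟨fold (reflectAt i 0) (halfAt i 0), fun F hF => hP i 0 F hF, hother i 0, fun x => ?_⟩
      unfold fold
      split_ifs with hx
      · have : 0 < (x i - 0).valMinAbs := hx
        rw [sub_zero] at this
        exact_mod_cast this
      · have : halfAt i 0 (reflectAt i 0 x) := (halfAt_reflectAt ⟨h, hh⟩ i 0 x).mpr hx
        have : 0 < (reflectAt i 0 x i - 0).valMinAbs := this
        rw [sub_zero] at this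
        exact_mod_cast this
    | succ k hk ih =>
      intro hkh
      obtain ⟨g, hg, hgo, hgi⟩ := ih (by omega)
      refine ⟨fun x => fold (reflectAt i k) (halfAt i k) (g x),
        hcomp _ _ (fun F hF => hP i k F hF) hg,
        fun x j hj => (hother i _ _ j hj).trans (hgo x j hj), fun x => ?_⟩
      have hb := valMinAbs_bounds hL (g x i)
      have hgx := hgi x
      have hsub : (g x i - (k : ZMod L)).valMinAbs = (g x i).valMinAbs - k := by
        rw [← valMinAbs_eq hL (n := (g x i).valMinAbs - k) (by omega) (by omega)]
        rw [Int.cast_sub, ZMod.coe_valMinAbs, Int.cast_natCast]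
      simp only [fold]
      split_ifs with hx
      · have : 0 < (g x i - (k : ZMod L)).valMinAbs := hx
        rw [hsub] at this
        push_cast
        omega
      · have h1 : ¬ 0 < (g x i - (k : ZMod L)).valMinAbs := hx
        rw [hsub] at h1
        have h2 : (g x i).valMinAbs = k := by omega
        have h3 : g x i = (k : ZMod L) := by
          rw [← ZMod.coe_valMinAbs (g x i), h2, Int.cast_natCast]
        have h4 : reflectAt i (k : ZMod L) (g x) i = (((k + 1 : ℕ) : ℤ) : ZMod L) := by
          simp only [reflectAt, Function.update_self, h3]
          push_cast
          ring
        rw [h4, valMinAbs_eq hL (by omega) (by omega)]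
  have hset : ∀ s : Finset (Fin d), ∃ g, M g ∧ ∀ x, ∀ i ∈ s, g x i = (h : ZMod L) := by
    intro s
    induction s using Finset.induction_on with
    | empty => exact ⟨id, fun F hF => hF, by simp⟩
    | insert i s _ ih =>
      obtain ⟨g, hg, hgs⟩ := ih
      obtain ⟨g', hg', hgo, hgi⟩ := hdir i h (by omega) le_rfl
      refine ⟨fun x => g' (g x), hcomp _ _ hg' hg, fun x j hj => ?_⟩
      by_cases hji : j = i
      · subst hji
        have h1 := hgi (g x)
        have h2 := (valMinAbs_bounds hL (g' (g x) j)).2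
        change g' (g x) j = _
        rw [← ZMod.coe_valMinAbs (g' (g x) j), le_antisymm h2 h1, Int.cast_natCast]
      · exact (hgo _ _ hji).trans (hgs x j ((Finset.mem_insert.mp hj).resolve_left hji))
  obtain ⟨g, hg, hgc⟩ := hset Finset.univ
  refine ⟨F fun _ => (h : ZMod L), ?_⟩
  have h1 := hg F hF
  have h2 : (fun x => F (g x)) = fun _ => F fun _ => (h : ZMod L) := by
    funext x
    congr 1
    funext i
    exact hgc x i (Finset.mem_univ i)
  rwa [h2] at h1

lemma keyForm_const {V : Type*} [Fintype V] (G : SimpleGraph V) (K : V → V → ℝ) (c : Sym2 V → ℝ)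
    (r : ℝ) : keyForm G K c (fun _ => r) (fun _ => r) = 0 := by
  simp [keyForm, lap]

theorem torus_keyForm_nonpos {N : ℕ} {lam : ℝ} {U : ℕ → ℝ} (hN : 2 ≤ N) (hL : Even L)
    (hlam : 0 < lam) (hv : ∀ x, v (-x) = v x) (hsep : Separable L v) (hU : ∀ n, 0 ≤ U n)
    (hb : ExpBounded N U (periodic (d := d) L v))
    (hZ : 0 < Zloop (torusGraph d L) N lam U (periodic L v)) {c₀ : Fin N} (h₀ : (c₀ : ℕ) = 0)
    (ψ : Torus d L → ℝ) :
    keyForm (torusGraph d L) (twoPoint (torusGraph d L) N lam U (periodic L v))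
      (fun e => 1 + 2 * expect (torusGraph d L) N lam U (periodic L v)
        fun w => (w.linkCount e c₀ : ℝ)) ψ ψ ≤ 0 := by
  set B := keyForm (torusGraph d L) (twoPoint (torusGraph d L) N lam U (periodic L v))
      (fun e => 1 + 2 * expect (torusGraph d L) N lam U (periodic L v)
        fun w => (w.linkCount e c₀ : ℝ)) with hB
  let Q : (Torus d L → Torus d L) → ℝ := fun F => B (fun x => ψ (F x)) (fun x => ψ (F x))
  -- Maximality survives folding: 2 Q(F) ≤ Q(F₊) + Q(F₋) ≤ Q(F₊) + Q(F) for the two folds of a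
  -- maximiser F.
  obtain ⟨F₀, hF₀⟩ := Finite.exists_max Q
  obtain ⟨c, hc⟩ := exists_const_of_fold hL (fun F => ∀ F', Q F' ≤ Q F) (by
    intro i a F hF F'
    have h1 := (torusReflection d hL i a).two_mul_keyForm_le hN hlam hU hb (periodic_symm v hv)
      (periodic_reflectAt v hv (hsep i) hL a) (torusGraph_adj_reflectAt i a) h₀
      (torusReflection_interaction_nonneg hL (hsep i) a) hZ (fun x => ψ (F x)) B hB
    have h2 := hF fun x => F (fold (reflectAt i a) (fun x => ¬ halfAt i a x) x)
    have h3 := hF F'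
    change 2 * Q F ≤ Q (fun x => F (fold (reflectAt i a) (halfAt i a) x)) +
      Q (fun x => F (fold (reflectAt i a) (fun x => ¬ halfAt i a x) x)) at h1
    linarith) hF₀
  have h1 := hc id
  have h2 : Q (fun _ => c) = 0 := keyForm_const _ _ _ _
  rw [h2] at h1
  exact h1

end

/-! ### Tempered potentials and good weight functions -/

section
open scoped Classical

variable {d L : ℕ} [NeZero L] {v : (Fin d → ℤ) → ℝ}

lemma bijective_lattice_shift (x : Torus d L) : Function.Bijective
    fun p : Torus d L × (Fin d → ℤ) => fun i => rep p.1 i + L * p.2 i - rep x i := by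
  have hL : (L : ℤ) ≠ 0 := by exact_mod_cast NeZero.ne L
  constructor
  · rintro ⟨y, z⟩ ⟨y', z'⟩ h
    have h1 : ∀ i, rep y i + L * z i = rep y' i + L * z' i := fun i => by
      have := congrFun h i
      simp only at this
      linarith
    have hy : y = y' := by
      funext i
      have h2 := congrArg (fun n : ℤ => (n : ZMod L)) (h1 i)
      simp only [Int.cast_add, Int.cast_mul, Int.cast_natCast, ZMod.natCast_self, zero_mul,
        add_zero] at h2
      rwa [congrFun (coe_rep y) i, congrFun (coe_rep y') i] at h2
    subst hy
    refine Prod.ext rfl (funext fun i => ?_)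
    exact mul_left_cancel₀ hL (add_left_cancel (h1 i))
  · intro w
    have h : ∀ i, ∃ c : ℤ, rep (fun i => ((w i + rep x i : ℤ) : ZMod L)) i + L * c =
        w i + rep x i := by
      intro i
      have h1 : ((rep (fun i => ((w i + rep x i : ℤ) : ZMod L)) i : ℤ) : ZMod L) =
          ((w i + rep x i : ℤ) : ZMod L) := ZMod.coe_valMinAbs _
      obtain ⟨c, hc⟩ := (ZMod.intCast_eq_intCast_iff_dvd_sub _ _ L).mp h1
      exact ⟨c, by linarith⟩
    choose c hc using h
    refine ⟨(fun i => ((w i + rep x i : ℤ) : ZMod L), c), funext fun i => ?_⟩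
    have := hc i
    simp only
    linarith

lemma summable_periodic {u : (Fin d → ℤ) → ℝ} (hu : Summable u) (x y : Torus d L) :
    Summable fun z : Fin d → ℤ => u (fun i => rep y i + L * z i - rep x i) := by
  refine hu.comp_injective (i := fun z : Fin d → ℤ => fun i => rep y i + L * z i - rep x i) ?_
  intro z z' h
  have := (bijective_lattice_shift x).1 (a₁ := (y, z)) (a₂ := (y, z')) h
  exact (Prod.ext_iff.mp this).2

lemma sum_periodic {u : (Fin d → ℤ) → ℝ} (hu : Summable u) (x : Torus d L) :
    ∑ y, periodic L u x y = ∑' w, u w := by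
  let e := Equiv.ofBijective _ (bijective_lattice_shift x)
  have hs : Summable fun p => u (e p) := e.summable_iff.mpr hu
  rw [← e.tsum_eq, hs.tsum_prod, tsum_fintype]
  rfl

/-- Replace v by the smaller potential u that keeps v(0) and the negative values only. Off the
diagonal its periodisation is nonpositive, so n_x n_y ≤ (n_x² + n_y²)/2 can be used there, and every
row sums to v̄. -/
lemma vbar_mul_le (hv : ∀ x, v (-x) = v x) (ht : Tempered v) (n : Torus d L → ℝ)
    (hn : ∀ x, 0 ≤ n x) :
    vbar v * ∑ x, n x ^ 2 ≤ ∑ x, ∑ y, periodic L v x y * n x * n y := by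
  obtain ⟨hbar, habs⟩ := ht
  have hvs : Summable v := habs.of_abs
  have hneg : Summable fun x => if v x < 0 then v x else 0 := by
    refine Summable.of_norm_bounded habs fun x => ?_
    split_ifs
    · exact le_rfl
    · simp
  have hv0 : 0 ≤ v 0 := by
    have h1 : ∑' x, (if v x < 0 then v x else 0) ≤ 0 := tsum_nonpos fun x => by
      split_ifs with h
      · exact h.le
      · exact le_rfl
    unfold vbar at hbar
    linarith
  let u : (Fin d → ℤ) → ℝ := fun x => (if x = 0 then v 0 else 0) + if v x < 0 then v x else 0
  have h0s : HasSum (fun x : Fin d → ℤ => if x = 0 then v 0 else 0) (v 0) := hasSum_ite_eq 0 (v 0)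
  have hus : Summable u := h0s.summable.add hneg
  have husum : ∑' x, u x = vbar v := by
    rw [h0s.summable.tsum_add hneg, h0s.tsum_eq]
    rfl
  have huv : ∀ x, u x ≤ v x := by
    intro x
    by_cases hx : x = 0
    · subst hx; simp [u, not_lt.mpr hv0]
    · simp only [u, if_neg hx, zero_add]
      split_ifs with h
      · exact le_rfl
      · exact not_lt.mp h
  have hu_even : ∀ x, u (-x) = u x := fun x => by simp [u, hv]
  have hu_le : ∀ x y : Torus d L, periodic L u x y ≤ periodic L v x y := fun x y =>
    (summable_periodic hus x y).tsum_le_tsum (fun z => huv _) (summable_periodic hvs x y)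
  have hu_nonpos : ∀ x y : Torus d L, x ≠ y → periodic L u x y ≤ 0 := by
    intro x y hxy
    refine tsum_nonpos fun z => ?_
    have hne : (fun i => rep y i + L * z i - rep x i) ≠ 0 := by
      intro h
      have := (bijective_lattice_shift x).1 (a₁ := (y, z)) (a₂ := (x, 0)) (by
        simp only at h ⊢
        rw [h]
        funext i
        simp)
      exact hxy (Prod.ext_iff.mp this).1.symm
    simp only [u, if_neg hne, zero_add]
    split_ifs with h
    · exact h.le
    · exact le_rfl
  have h1 : vbar v * ∑ x, n x ^ 2 = ∑ x : Torus d L, ∑ y, periodic L u x y * n x ^ 2 := by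
    rw [Finset.mul_sum]
    refine Finset.sum_congr rfl fun x _ => ?_
    rw [← Finset.sum_mul, sum_periodic hus, husum]
  have h2 : vbar v * ∑ x, n x ^ 2 = ∑ x : Torus d L, ∑ y, periodic L u x y * n y ^ 2 := by
    rw [h1, Finset.sum_comm]
    refine Finset.sum_congr rfl fun y _ => Finset.sum_congr rfl fun x _ => ?_
    rw [periodic_symm u hu_even]
  have h3 : vbar v * ∑ x, n x ^ 2 =
      ∑ x : Torus d L, ∑ y, periodic L u x y * ((n x ^ 2 + n y ^ 2) / 2) := by
    have : ∀ x y : Torus d L, periodic L u x y * ((n x ^ 2 + n y ^ 2) / 2) =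
        (periodic L u x y * n x ^ 2 + periodic L u x y * n y ^ 2) / 2 := fun x y => by ring
    simp_rw [this, ← Finset.sum_div, Finset.sum_add_distrib]
    rw [← h1, ← h2]
    ring
  rw [h3]
  refine Finset.sum_le_sum fun x _ => Finset.sum_le_sum fun y _ => ?_
  have h4 : periodic L u x y * ((n x ^ 2 + n y ^ 2) / 2) ≤ periodic L u x y * (n x * n y) := by
    by_cases hxy : x = y
    · subst hxy
      exact le_of_eq (by ring)
    · refine mul_le_mul_of_nonpos_left ?_ (hu_nonpos x y hxy)
      nlinarith [sq_nonneg (n x - n y)]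
  refine h4.trans ?_
  rw [mul_assoc]
  exact mul_le_mul_of_nonneg_right (hu_le x y) (mul_nonneg (hn x) (hn y))

/-! ### Growth of matching numbers against good weight functions. -/

lemma matchings_two_mul_pos (p : ℕ) : 0 < matchings (2 * p) := by
  have h := matchings_two_mul p
  have h1 := Nat.factorial_pos (2 * p)
  rw [← h] at h1
  exact pos_of_mul_pos_left h1 (Nat.zero_le _)

/-- Since (2p)! is the left side times 2^p p!, the bound amounts to the estimate 4^p for the central
binomial coefficient. -/
lemma matchings_two_mul_le (p : ℕ) : matchings (2 * p) ≤ 2 ^ p * p.factorial := by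
  have h := matchings_two_mul p
  have h1 : (2 * p).factorial ≤ (2 ^ p * p.factorial) * (2 ^ p * p.factorial) := by
    have h2 : (2 * p).factorial = Nat.centralBinom p * p.factorial * p.factorial := by
      have := Nat.choose_mul_factorial_mul_factorial (show p ≤ 2 * p by omega)
      rw [← this, Nat.centralBinom, show 2 * p - p = p by omega]
    have h3 : Nat.centralBinom p ≤ 4 ^ p := by
      have := Nat.choose_le_two_pow (2 * p) p
      rwa [pow_mul] at this
    rw [h2, show (4 : ℕ) = 2 * 2 from rfl, mul_pow] at *
    calc _ ≤ 2 ^ p * 2 ^ p * p.factorial * p.factorial := by gcongr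
      _ = _ := by ring
  rw [← h] at h1
  exact Nat.le_of_mul_le_mul_right h1 (by positivity)

lemma prod_matchings_le {N : ℕ} (k : Fin N → ℕ) (hk : ∀ i, Even (k i)) :
    ∏ i, matchings (k i) ≤ 2 ^ ((∑ i, k i) / 2) * ((∑ i, k i) / 2).factorial := by
  choose p hp using fun i => (hk i).exists_two_nsmul
  simp only [smul_eq_mul] at hp
  have h1 : (∑ i, k i) / 2 = ∑ i, p i := by
    simp_rw [hp, ← Finset.mul_sum]
    omega
  rw [h1]
  calc ∏ i, matchings (k i) ≤ ∏ i, (2 ^ p i * (p i).factorial) :=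
        Finset.prod_le_prod' fun i _ => by rw [hp]; exact matchings_two_mul_le _
    _ = 2 ^ (∑ i, p i) * ∏ i, (p i).factorial := by
        rw [Finset.prod_mul_distrib, Finset.prod_pow_eq_pow_sum]
    _ ≤ _ := Nat.mul_le_mul_left _ (Nat.le_of_dvd (Nat.factorial_pos _)
        (Nat.prod_factorial_dvd_factorial_sum _ _))

/-- The iteration starts at n = 1, because goodness says nothing for n = 0. It controls n! Ū(n+1),
and the missing factor n + 1 is absorbed into 2^(n+1). -/
lemma Good.exists_factorial_mul_le {U : ℕ → ℝ} (hU : ∀ n, 0 ≤ U n) (hg : Good v U) :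
    ∃ C ρ : ℝ, 1 ≤ C ∧ 1 ≤ ρ ∧ ∀ n : ℕ,
      (n.factorial : ℝ) * (U n * Real.exp (-vbar v * (n : ℝ) ^ 2)) ≤ C * ρ ^ n := by
  obtain ⟨M, hM⟩ := hg
  set W : ℕ → ℝ := fun n => U n * Real.exp (-vbar v * (n : ℝ) ^ 2) with hW
  have hW0 : ∀ n, 0 ≤ W n := fun n => mul_nonneg (hU n) (Real.exp_nonneg _)
  set R := max M 1
  have hR1 : 1 ≤ R := le_max_right _ _
  have hMW : ∀ n : ℕ, (n : ℝ) * W (n + 1) ≤ R * W n := fun n =>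
    (hM n).trans (mul_le_mul_of_nonneg_right (le_max_left _ _) (hW0 n))
  have h1 : ∀ n : ℕ, (n.factorial : ℝ) * W (n + 1) ≤ R ^ n * W 1 := by
    intro n
    induction n with
    | zero => simp
    | succ n ih =>
      rw [Nat.factorial_succ, pow_succ]
      push_cast
      have h2 := hMW (n + 1)
      push_cast at h2
      calc ((n : ℝ) + 1) * n.factorial * W (n + 1 + 1)
          = n.factorial * (((n : ℝ) + 1) * W (n + 1 + 1)) := by ring
        _ ≤ n.factorial * (R * W (n + 1)) := by gcongr
        _ = R * (n.factorial * W (n + 1)) := by ring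
        _ ≤ R * (R ^ n * W 1) := by gcongr
        _ = _ := by ring
  have hW00 := hW0 0
  have hW01 := hW0 1
  refine ⟨W 0 + W 1 + 1, 2 * R, by linarith, by linarith, fun n => ?_⟩
  change (n.factorial : ℝ) * W n ≤ _
  cases n with
  | zero => simp only [Nat.factorial_zero, Nat.cast_one, one_mul, pow_zero, mul_one]; linarith
  | succ n =>
    have h3 : ((n + 1 : ℕ) : ℝ) ≤ 2 ^ (n + 1) := by exact_mod_cast Nat.lt_two_pow_self.le
    have h4 : 0 ≤ R ^ n * W 1 := by positivity
    calc ((n + 1).factorial : ℝ) * W (n + 1)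
        = ((n + 1 : ℕ) : ℝ) * (n.factorial * W (n + 1)) := by
          rw [Nat.factorial_succ]; push_cast; ring
      _ ≤ 2 ^ (n + 1) * (R ^ n * W 1) := mul_le_mul h3 (h1 n) (by have := hW0 (n + 1); positivity)
          (by positivity)
      _ ≤ 2 ^ (n + 1) * (R ^ (n + 1) * (W 0 + W 1 + 1)) := by
          have h5 : R ^ n ≤ R ^ (n + 1) := pow_le_pow_right₀ hR1 (Nat.le_succ n)
          gcongr
          linarith
      _ = (W 0 + W 1 + 1) * (2 * R) ^ (n + 1) := by rw [mul_pow]; ring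

/-- `vbar_mul_le` decouples the vertices. At each vertex the matchings number at most 2^n n! for
local time n, and goodness compensates for the factorial; odd numbers of ends contribute zero. -/
lemma expBounded_periodic {U : ℕ → ℝ} (N : ℕ) (hv : ∀ x, v (-x) = v x) (ht : Tempered v)
    (hU : ∀ n, 0 ≤ U n) (hg : Good v U) : ExpBounded N U (periodic (d := d) L v) := by
  obtain ⟨C, ρ, hC, hρ, h⟩ := hg.exists_factorial_mul_le hU
  refine ⟨C ^ Fintype.card (Torus d L), 2 * ρ, by positivity, by linarith, fun k => ?_⟩
  let n : Torus d L → ℕ := fun x => (∑ i, k x i) / 2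
  have hsite : ∀ x, (∏ i, (matchings (k x i) : ℝ)) *
      (U (n x) * Real.exp (-vbar v * (n x : ℝ) ^ 2)) ≤ C * (2 * ρ) ^ (∑ i, k x i) := by
    intro x
    by_cases hk : ∀ i, Even (k x i)
    · have h1 : (∏ i, (matchings (k x i) : ℝ)) ≤ 2 ^ n x * ((n x).factorial : ℝ) := by
        exact_mod_cast prod_matchings_le (k x) hk
      have h2 : 0 ≤ U (n x) * Real.exp (-vbar v * (n x : ℝ) ^ 2) :=
        mul_nonneg (hU _) (Real.exp_nonneg _)
      calc _ ≤ 2 ^ n x * ((n x).factorial : ℝ) *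
              (U (n x) * Real.exp (-vbar v * (n x : ℝ) ^ 2)) :=
            mul_le_mul_of_nonneg_right h1 h2
        _ = 2 ^ n x * (((n x).factorial : ℝ) *
              (U (n x) * Real.exp (-vbar v * (n x : ℝ) ^ 2))) := by ring
        _ ≤ 2 ^ n x * (C * ρ ^ n x) := mul_le_mul_of_nonneg_left (h (n x)) (by positivity)
        _ = C * (2 * ρ) ^ n x := by rw [mul_pow]; ring
        _ ≤ C * (2 * ρ) ^ (∑ i, k x i) := by
            have : (2 * ρ) ^ n x ≤ (2 * ρ) ^ (∑ i, k x i) :=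
              pow_le_pow_right₀ (by linarith) (Nat.div_le_self _ _)
            gcongr
    · push Not at hk
      obtain ⟨i, hi⟩ := hk
      rw [Finset.prod_eq_zero (Finset.mem_univ i) (by rw [matchings_odd hi, Nat.cast_zero]),
        zero_mul]
      positivity
  have hexp : Real.exp (-∑ x, ∑ y, periodic L v x y * (n x : ℝ) * (n y : ℝ)) ≤
      ∏ x, Real.exp (-vbar v * (n x : ℝ) ^ 2) := by
    rw [← Real.exp_sum, ← Finset.mul_sum]
    refine Real.exp_le_exp.mpr ?_
    have := vbar_mul_le hv ht (fun x => (n x : ℝ)) (fun x => Nat.cast_nonneg _)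
    linarith
  calc vertexWeight U (periodic L v) k
      ≤ ((∏ x, ∏ i, (matchings (k x i) : ℝ)) * ∏ x, U (n x)) *
          ∏ x, Real.exp (-vbar v * (n x : ℝ) ^ 2) :=
        mul_le_mul_of_nonneg_left hexp (mul_nonneg (Finset.prod_nonneg fun _ _ =>
          Finset.prod_nonneg fun _ _ => Nat.cast_nonneg _) (Finset.prod_nonneg fun _ _ => hU _))
    _ = ∏ x, ((∏ i, (matchings (k x i) : ℝ)) *
          (U (n x) * Real.exp (-vbar v * (n x : ℝ) ^ 2))) := by
        rw [Finset.prod_mul_distrib, Finset.prod_mul_distrib, mul_assoc]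
    _ ≤ ∏ x, (C * (2 * ρ) ^ (∑ i, k x i)) :=
        Finset.prod_le_prod (fun x _ => mul_nonneg (Finset.prod_nonneg fun _ _ =>
          Nat.cast_nonneg _) (mul_nonneg (hU _) (Real.exp_nonneg _))) fun x _ => hsite x
    _ = C ^ Fintype.card (Torus d L) * (2 * ρ) ^ (∑ x, ∑ i, k x i) := by
        rw [Finset.prod_mul_distrib, Finset.prod_const, Finset.card_univ,
          Finset.prod_pow_eq_pow_sum]

/-- A zero of U at m ≥ 1 forces a zero at m + 1. At m = 0 this fails, so U(0) = 0 is possible. -/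
lemma Good.pos_of_le {U : ℕ → ℝ} (hU : ∀ n, 0 ≤ U n) (hg : Good v U) {n m : ℕ} (hn : 1 ≤ n)
    (hnm : n ≤ m) (hm : 0 < U m) : 0 < U n := by
  obtain ⟨M, hM⟩ := hg
  induction m, hnm using Nat.le_induction with
  | base => exact hm
  | succ m hnm ih =>
    refine ih ((hU m).lt_of_ne fun h0 => ?_)
    have h1 := hM m
    rw [← h0, zero_mul, mul_zero] at h1
    have h2 : (0 : ℝ) < m := by exact_mod_cast hn.trans hnm
    have h3 : 0 < (m : ℝ) * (U (m + 1) * Real.exp (-vbar v * ((m + 1 : ℕ) : ℝ) ^ 2)) :=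
      mul_pos h2 (mul_pos hm (Real.exp_pos _))
    linarith

lemma exists_pos_of_le_range {U : ℕ → ℝ} (hr : 2 ≤ range U) : ∃ n, 2 ≤ n ∧ 0 < U n := by
  by_contra! h
  have h1 : range U ≤ 1 := by
    refine iSup₂_le fun n hn => ?_
    have : n < 2 := by
      by_contra h2
      exact absurd hn (not_lt.mpr (h n (not_lt.mp h2)))
    exact_mod_cast Nat.le_of_lt_succ this
  have h2 := hr.trans h1
  norm_num at h2

lemma vertexWeight_pos {V : Type*} [Fintype V] {N : ℕ} {U : ℕ → ℝ} {vG : V → V → ℝ}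
    {k : V → Fin N → ℕ} (hk : ∀ x i, Even (k x i)) (hU : ∀ x, 0 < U ((∑ i, k x i) / 2)) :
    0 < vertexWeight U vG k := by
  refine mul_pos (mul_pos (Finset.prod_pos fun x _ => Finset.prod_pos fun i _ => ?_)
    (Finset.prod_pos fun x _ => hU x)) (Real.exp_pos _)
  obtain ⟨p, hp⟩ := (hk x i).exists_two_nsmul
  rw [hp, smul_eq_mul]
  exact_mod_cast matchings_two_mul_pos p

/-- The edges of the torus in direction `i`. -/
def IsDirected (i : Fin d) (e : Sym2 (Torus d L)) : Prop := ∃ x, e = s(x, x + Pi.single i 1)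

/-- As U(0) may vanish, the witness has to visit every vertex: it puts two links of one colour on
each edge in a fixed direction. The local time is then the number of such edges at a vertex, which
is 1 or 2 (on the torus with L = 2 both steps use the same edge). -/
lemma Zloop_pos {N : ℕ} {lam : ℝ} {U : ℕ → ℝ} (hN : 2 ≤ N) (hL : Even L) (hlam : 0 < lam)
    (hU : ∀ n, 0 ≤ U n) (hb : ExpBounded N U (periodic (d := d) L v)) (h1 : 0 < U 1) (h2 : 0 < U 2)
    (c₀ : Fin N) (i₀ : Fin d) : 0 < Zloop (torusGraph d L) N lam U (periodic L v) := by
  rw [Zloop_eq hN hlam.le hU hb]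
  have hs := summable_moment_one (incident (torusGraph d L)) hlam.le hU hb 0
  let q : (torusGraph d L).edgeSet → Fin N → ℕ := fun e i =>
    if IsDirected i₀ e.1 ∧ i = c₀ then 2 else 0
  refine hs.tsum_pos (fun q => mul_nonneg (linkWeight_nonneg hlam.le q)
    (mul_nonneg (vertexWeight_nonneg hU _ _) zero_le_one)) q ?_
  refine mul_pos (Finset.prod_pos fun e _ => Finset.prod_pos fun i _ => by positivity) ?_
  rw [mul_one, add_zero]
  let S : Torus d L → Finset (torusGraph d L).edgeSet := fun x =>
    Finset.univ.filter fun e => incident (torusGraph d L) x e ∧ IsDirected i₀ e.1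
  have hdeg : ∀ x i, degree (incident (torusGraph d L)) q x i =
      if i = c₀ then 2 * (S x).card else 0 := by
    intro x i
    unfold degree
    by_cases hi : i = c₀
    · rw [if_pos hi, Finset.card_filter, Finset.mul_sum]
      refine Finset.sum_congr rfl fun e _ => ?_
      by_cases h1 : incident (torusGraph d L) x e <;> by_cases h2 : IsDirected i₀ e.1 <;>
        simp [q, h1, h2, hi]
    · simp [q, hi]
  have hcard : ∀ x, (S x).card = 1 ∨ (S x).card = 2 := by
    intro x
    have hadj : (torusGraph d L).Adj x (x + Pi.single i₀ 1) := by
      refine (torusGraph_adj _ _).mpr ⟨fun h => ?_, i₀, Or.inl rfl⟩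
      obtain ⟨h', hh⟩ := hL
      have hL0 : L ≠ 0 := NeZero.ne L
      have h3 := congrFun h i₀
      simp only [Pi.add_apply, Pi.single_eq_same, left_eq_add] at h3
      have : Fact (1 < L) := ⟨by omega⟩
      exact one_ne_zero h3
    have hpos : 0 < (S x).card := Finset.card_pos.mpr ⟨⟨s(x, x + Pi.single i₀ 1), hadj⟩,
      Finset.mem_filter.mpr ⟨Finset.mem_univ _, Sym2.mem_mk_left _ _, x, rfl⟩⟩
    have hle : (S x).card ≤ 2 := by
      rw [← Finset.card_map (Function.Embedding.subtype _)]
      refine (Finset.card_le_card (t := {s(x, x + Pi.single i₀ 1), s(x - Pi.single i₀ 1, x)})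
        fun e he => ?_).trans Finset.card_le_two
      obtain ⟨⟨e, he'⟩, hmem, rfl⟩ := Finset.mem_map.mp he
      obtain ⟨-, hx, y, hy⟩ := Finset.mem_filter.mp hmem
      change e = _ at hy
      change x ∈ e at hx
      subst hy
      rw [Finset.mem_insert, Finset.mem_singleton]
      rcases Sym2.mem_iff.mp hx with rfl | rfl
      · exact Or.inl rfl
      · right; simp
    omega
  have hsum : ∀ x, (∑ i, degree (incident (torusGraph d L)) q x i) / 2 = (S x).card := by
    intro x
    simp_rw [hdeg]
    simp
  refine vertexWeight_pos (fun x i => ?_) fun x => ?_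
  · rw [hdeg]
    split_ifs <;> simp
  · rw [hsum]
    rcases hcard x with h | h <;> rw [h] <;> assumption

end

/-! ### Symmetries of the graph and sums over edges -/

section
open scoped Classical

variable {V : Type*} [Fintype V] {G : SimpleGraph V} {N : ℕ} {lam : ℝ} {U : ℕ → ℝ}
  {vG : V → V → ℝ}

lemma two_mul_sum_edgeFinset [Fintype G.edgeSet] (F : Sym2 V → ℝ) :
    2 * ∑ e ∈ G.edgeFinset, F e = ∑ x, ∑ y, if G.Adj x y then F s(x, y) else 0 := by
  rw [← Fintype.sum_prod_type' (f := fun x y => if G.Adj x y then F s(x, y) else 0),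
    ← Finset.sum_filter, ← Finset.sum_fiberwise_of_maps_to (t := G.edgeFinset)
      (g := fun p : V × V => s(p.1, p.2)) (fun p hp => by simpa using hp), Finset.mul_sum]
  refine Finset.sum_congr rfl fun e he => ?_
  induction e with
  | _ x y =>
    have hxy : G.Adj x y := by simpa using he
    have h : ((Finset.univ.filter fun p : V × V => G.Adj p.1 p.2).filter
        fun p => s(p.1, p.2) = s(x, y)) = {(x, y), (y, x)} := by
      ext ⟨a, b⟩
      simp only [Finset.mem_filter, Finset.mem_univ, true_and, Sym2.eq_iff, Finset.mem_insert,
        Finset.mem_singleton, Prod.mk.injEq]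
      refine ⟨fun h => h.2, ?_⟩
      rintro (⟨rfl, rfl⟩ | ⟨rfl, rfl⟩)
      · exact ⟨hxy, Or.inl ⟨rfl, rfl⟩⟩
      · exact ⟨hxy.symm, Or.inr ⟨rfl, rfl⟩⟩
    rw [h, Finset.sum_pair fun h => hxy.ne (Prod.ext_iff.mp h).1, Sym2.eq_swap, ← two_mul]

lemma keyForm_self [Fintype G.edgeSet] (K : V → V → ℝ) (c : Sym2 V → ℝ) (ψ : V → ℝ) :
    keyForm G K c ψ ψ = ∑ x, ∑ y, K x y * lap G ψ x * lap G ψ y -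
      ∑ e ∈ G.edgeFinset, c e * sqGrad ψ e := by
  have h := two_mul_sum_edgeFinset (G := G) (fun e => c e * sqGrad ψ e)
  have h1 : ∀ x y, (if G.Adj x y then c s(x, y) * sqGrad ψ s(x, y) else 0) =
      if G.Adj x y then c s(x, y) * (ψ y - ψ x) * (ψ y - ψ x) else 0 := fun x y => by
    split_ifs
    · change c s(x, y) * (ψ y - ψ x) ^ 2 = _
      ring
    · rfl
  simp_rw [h1] at h
  unfold keyForm
  rw [← h]
  ring

lemma expect_count_iso (hN : 2 ≤ N) (hlam : 0 ≤ lam) (hU : ∀ n, 0 ≤ U n)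
    (hb : ExpBounded N U vG) (σ : G ≃g G) (hσ : ∀ x y, vG (σ x) (σ y) = vG x y) {x y : V}
    (h : G.Adj x y) (i : Fin N) :
    expect G N lam U vG (fun w => (w.linkCount s(σ x, σ y) i : ℝ)) =
      expect G N lam U vG (fun w => (w.linkCount s(x, y) i : ℝ)) := by
  unfold expect
  congr 1
  have h1 := avg_count_eq hN hlam hU hb (⟨s(x, y), h⟩ : G.edgeSet) i
  have h2 := avg_count_eq hN hlam hU hb (σ.mapEdgeSet ⟨s(x, y), h⟩) i
  refine h2.trans (Eq.trans (Eq.symm ?_) h1.symm)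
  refine moment_comp (incident G) lam U vG σ.toEquiv σ.mapEdgeSet ?_ hσ 0
    (fun q => (q ⟨s(x, y), h⟩ i : ℝ))
  rintro z ⟨e, he⟩
  induction e with
  | _ a b =>
    change σ z ∈ s(σ a, σ b) ↔ z ∈ s(a, b)
    simp [Sym2.mem_iff, σ.injective.eq_iff]

lemma summable_closedInd_count (hN : 2 ≤ N) (hlam : 0 ≤ lam) (hU : ∀ n, 0 ≤ U n)
    (hb : ExpBounded N U vG) (e : Sym2 V) (i : Fin N) :
    AvgSummable G N lam U vG fun w => closedInd w * (w.linkCount e i : ℝ) := by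
  by_cases he : e ∈ G.edgeSet
  · exact (hasSum_closedInd_count hN hlam hU hb ⟨e, he⟩ i).summable
  · unfold AvgSummable
    simp only [linkCount_of_notMem _ he, Nat.cast_zero, mul_zero]
    exact summable_zero

end

/-! ### Mean link numbers under translations and coordinate permutations. -/

section
open scoped Classical

variable {d L : ℕ} [NeZero L] {v : (Fin d → ℤ) → ℝ}

/-- Translations and transpositions of coordinates act transitively on the edges, and both preserve
the potential. -/
lemma expect_count_eq {N : ℕ} {lam : ℝ} {U : ℕ → ℝ} (hN : 2 ≤ N) (hlam : 0 ≤ lam)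
    (hU : ∀ n, 0 ≤ U n) (hb : ExpBounded N U (periodic (d := d) L v))
    (hperm : ∀ (σ : Equiv.Perm (Fin d)) (x : Fin d → ℤ), v (x ∘ σ) = v x) (c : Fin N) (i₀ : Fin d)
    {x y : Torus d L} (hxy : (torusGraph d L).Adj x y) :
    expect (torusGraph d L) N lam U (periodic L v) (fun w => (w.linkCount s(x, y) c : ℝ)) =
      expect (torusGraph d L) N lam U (periodic L v)
        (fun w => (w.linkCount s(0, Pi.single i₀ 1) c : ℝ)) := by
  have key : ∀ (x : Torus d L) i, (torusGraph d L).Adj x (x + Pi.single i 1) →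
      expect (torusGraph d L) N lam U (periodic L v)
        (fun w => (w.linkCount s(x, x + Pi.single i 1) c : ℝ)) =
      expect (torusGraph d L) N lam U (periodic L v)
        (fun w => (w.linkCount s(0, Pi.single i₀ 1) c : ℝ)) := by
    intro x i hadj
    let τ : torusGraph d L ≃g torusGraph d L :=
      ⟨Equiv.addRight x, fun {a b} => torusGraph_adj_add x a b⟩
    let π : torusGraph d L ≃g torusGraph d L :=
      ⟨permute (Equiv.swap i i₀), fun {a b} => torusGraph_adj_permute _ a b⟩
    have hτ0 : τ 0 = x := zero_add x
    have hτ1 : τ (Pi.single i 1) = x + Pi.single i 1 := add_comm _ _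
    have hπ0 : π 0 = 0 := rfl
    have hπ1 : π (Pi.single i₀ 1) = Pi.single i 1 := by
      refine (permute_single _ _ _).trans ?_
      rw [Equiv.symm_swap, Equiv.swap_apply_right]
    have h1 : (torusGraph d L).Adj 0 (Pi.single i 1) := by
      rw [← τ.map_adj_iff, hτ0, hτ1]
      exact hadj
    have h2 : (torusGraph d L).Adj 0 (Pi.single i₀ 1) := by
      rw [← π.map_adj_iff, hπ0, hπ1]
      exact h1
    have e1 := expect_count_iso hN hlam hU hb τ (periodic_add v x) h1 c
    have e2 := expect_count_iso hN hlam hU hb π (periodic_permute v hperm (Equiv.swap i i₀)) h2 c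
    rw [hτ0, hτ1] at e1
    rw [hπ0, hπ1] at e2
    rw [e1, e2]
  obtain ⟨-, i, rfl | rfl⟩ := (torusGraph_adj x y).mp hxy
  · exact key x i hxy
  · rw [Sym2.eq_swap]
    exact key y i hxy.symm

end

end RandomPath

end

/-! ### The key inequality. -/

open scoped Classical in
theorem theorem6 (d N L : ℕ) [NeZero L] (hd : 2 < d) (hN : 2 ≤ N) (hL : Even L)
    (lam : ℝ) (hlam : 0 < lam)
    (v : (Fin d → ℤ) → ℝ) (hv_even : ∀ x, v (-x) = v x)
    (hv_temp : RandomPath.Tempered v) (hv_sep : RandomPath.Separable L v)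
    (U : ℕ → ℝ) (hU_nonneg : ∀ n, 0 ≤ U n) (hU_good : RandomPath.Good v U)
    (hU_range : 2 ≤ RandomPath.range U)
    (colour1 : Fin N) (hcolour1 : (colour1 : ℕ) = 0) (i1 : Fin d) (hi1 : (i1 : ℕ) = 0) :
    -- all the averages below are absolutely convergent, and the normalisation is positive
    (RandomPath.AvgSummable (RandomPath.torusGraph d L) N lam U (RandomPath.periodic L v)
        RandomPath.closedInd ∧
      0 < RandomPath.Zloop (RandomPath.torusGraph d L) N lam U (RandomPath.periodic L v) ∧
      (∀ e, RandomPath.AvgSummable (RandomPath.torusGraph d L) N lam U (RandomPath.periodic L v)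
        fun w => RandomPath.closedInd w * (w.linkCount e colour1 : ℝ)) ∧
      ∀ x y, RandomPath.AvgSummable (RandomPath.torusGraph d L) N lam U (RandomPath.periodic L v)
        (RandomPath.directedFun x y)) ∧
    -- an arbitrary potential: every edge carries its own mean number of links
    (∀ ψ : RandomPath.Torus d L → ℝ,
      ∑ x, ∑ y, RandomPath.torusTwoPoint d N L lam U v x y *
          RandomPath.lap (RandomPath.torusGraph d L) ψ x *
          RandomPath.lap (RandomPath.torusGraph d L) ψ y ≤
        ∑ e ∈ (RandomPath.torusGraph d L).edgeFinset,
          (1 + 2 * RandomPath.torusMeanLinks d N L lam U v colour1 e) *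
            RandomPath.sqGrad ψ e) ∧
    -- a potential that is invariant under permutations of the coordinates
    ((∀ (σ : Equiv.Perm (Fin d)) (x : Fin d → ℤ), v (x ∘ σ) = v x) →
      ∀ ψ : RandomPath.Torus d L → ℝ,
        ∑ x, ∑ y, RandomPath.torusTwoPoint d N L lam U v x y *
            RandomPath.lap (RandomPath.torusGraph d L) ψ x *
            RandomPath.lap (RandomPath.torusGraph d L) ψ y ≤
          (1 + 2 * RandomPath.torusMeanLinks d N L lam U v colour1 s(0, Pi.single i1 1)) *
            ∑ e ∈ (RandomPath.torusGraph d L).edgeFinset, RandomPath.sqGrad ψ e) := by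
  have hb : RandomPath.ExpBounded N U (RandomPath.periodic (d := d) L v) :=
    RandomPath.expBounded_periodic N hv_even hv_temp hU_nonneg hU_good
  obtain ⟨n, hn, hn0⟩ := RandomPath.exists_pos_of_le_range hU_range
  have hZ := RandomPath.Zloop_pos hN hL hlam hU_nonneg hb
    (hU_good.pos_of_le hU_nonneg le_rfl (by omega) hn0)
    (hU_good.pos_of_le hU_nonneg one_le_two hn hn0) colour1 i1
  have hkey : ∀ ψ : RandomPath.Torus d L → ℝ,
      ∑ x, ∑ y, RandomPath.torusTwoPoint d N L lam U v x y *
          RandomPath.lap (RandomPath.torusGraph d L) ψ x *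
          RandomPath.lap (RandomPath.torusGraph d L) ψ y ≤
        ∑ e ∈ (RandomPath.torusGraph d L).edgeFinset,
          (1 + 2 * RandomPath.torusMeanLinks d N L lam U v colour1 e) *
            RandomPath.sqGrad ψ e := by
    intro ψ
    have h := RandomPath.torus_keyForm_nonpos hN hL hlam hv_even hv_sep hU_nonneg hb hZ hcolour1 ψ
    rw [RandomPath.keyForm_self] at h
    exact sub_nonpos.mp h
  refine ⟨⟨(RandomPath.hasSum_closedInd hN hlam.le hU_nonneg hb).summable, hZ,
    fun e => RandomPath.summable_closedInd_count hN hlam.le hU_nonneg hb e colour1,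
    fun x y => (RandomPath.hasSum_directedFun hN hlam.le hU_nonneg hb x y).summable⟩, hkey,
    fun hperm ψ => (hkey ψ).trans_eq ?_⟩
  rw [Finset.mul_sum]
  refine Finset.sum_congr rfl fun e he => ?_
  induction e with
  | _ x y =>
    have hxy : (RandomPath.torusGraph d L).Adj x y := by simpa using he
    unfold RandomPath.torusMeanLinks
    rw [RandomPath.expect_count_eq hN hlam.le hU_nonneg hb hperm colour1 i1 hxy]
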